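/- Let $n,N\ge 1$ and $k\ge n+1$ be integers, let $\chi=\otimes_v\chi_v$ be a finite order character of $\mathbb Q^\times\backslash\mathbb A^\times$ whose conductor divides $N$, let $p\nmid 2N$ be a prime, and let $h$ be a symmetric $2n\times 2n$ matrix over $\mathbb Z_p$ with $\det h\ne 0$ and $p\mid\det h$. For $R\in\mathrm{GL}_{2n}(\mathbb Q_p)$ with $ARB=\mathrm{diag}(p^{e_1},\dots,p^{e_{2n}})$, $A,B\in \mathrm{GL}_{2n}(\mathbb Z_p)$, put $e(R)=-\sum_{e_i\le 0}e_i$. For symmetric $R$ this depends only on the class of $R$ modulo symmetric matrices over $\mathbb Z_p$, and every class contains invertible matrices. Let $$B_p(X,h)=\sum_{R\in M^{\rm sym}_{2n}(\mathbb Q_p)/M^{\rm sym}_{2n}(\mathbb Z_p)}X^{e(R)}e^{2\pi i\,\mathrm{tr}(hR)}\in\mathbb C[[X]]$$ be the local Siegel series, where $e^{2\pi i x}:=e^{2\pi i\{x\}}$ with $\{x\}\in\mathbb Z[1/p]$ the fractional part of $x\in\mathbb Q_p$. Let $\rho_h(p)$ be $0$, $1$ or $-1$ according to whether $\mathbb Q_p(\sqrt{(-1)^n\det(2h)})/\mathbb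 Q_p$ is ramified, trivial, or unramified quadratic. Then there is a unique polynomial $f_{h,p}\in\mathbb Z[X]$ with $$f_{h,p}(X)\,(1-X)\prod_{i=1}^n(1-p^{2i}X^2)=(1-\rho_h(p)p^nX)\,B_p(X,h)$$ in $\mathbb C[[X]]$ (equivalently, $f_{h,p}(\chi_p(p)p^{-s})=\frac{L_p(s,\chi)\prod_{i=1}^nL_p(2s-2i,\chi^2)}{L_p(s-n,\chi\rho_h)}B_p(\chi_p(p)p^{-s},h)$). Moreover, for every isomorphism $\mathbb C\simeq\overline{\mathbb Q_p}$, with resulting valuation $v_p\colon\mathbb C\to\mathbb Q\cup\{\infty\}$ normalized by $v_p(p)=1$, $$\left(k-n-\tfrac12\right)\left(v_p(\det h)-e_{p,h}\right)+v_p\!\left(f_{h,p}(\chi_p(p)p^{-k})\right)\ge 0,$$ where $e_{p,h}=0$ if $v_p(\det h)$ is even and $e_{p,h}=1$ if $v_p(\det h)$ is odd. -/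

import Mathlib

open scoped Polynomial PowerSeries

noncomputable section

namespace SiegelSeries

/-- Every `p`-adic number is congruent modulo `ℤ_[p]` to a rational number whose denominator is a
power of `p`. -/
theorem exists_fracPart (p : ℕ) [Fact p.Prime] (x : ℚ_[p]) :
    ∃ r : ℚ, (∃ (a : ℤ) (m : ℕ), r = a / (p : ℚ) ^ m) ∧ ‖x - (r : ℚ_[p])‖ ≤ 1 := by
  have hp0 : (p : ℚ_[p]) ≠ 0 := Nat.cast_ne_zero.mpr (Fact.out : p.Prime).ne_zero
  obtain ⟨m, hm⟩ : ∃ m : ℕ, ‖(p : ℚ_[p]) ^ m * x‖ ≤ 1 := by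
    have hlim : Filter.Tendsto (fun m : ℕ => ‖(p : ℚ_[p])‖ ^ m * ‖x‖) Filter.atTop
        (nhds (0 * ‖x‖)) :=
      (tendsto_pow_atTop_nhds_zero_of_lt_one (norm_nonneg _) Padic.norm_p_lt_one).mul_const _
    rw [zero_mul] at hlim
    obtain ⟨m, hm⟩ := (hlim.eventually (ge_mem_nhds one_pos)).exists
    exact ⟨m, by simpa [norm_mul, norm_pow] using hm⟩
  set y : ℤ_[p] := ⟨(p : ℚ_[p]) ^ m * x, hm⟩ with hy
  obtain ⟨c, hc⟩ := Ideal.mem_span_singleton'.mp (PadicInt.appr_spec m y)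
  refine ⟨(y.appr m : ℤ) / (p : ℚ) ^ m, ⟨_, _, rfl⟩, ?_⟩
  have hc' : (c : ℚ_[p]) * (p : ℚ_[p]) ^ m = (p : ℚ_[p]) ^ m * x - (y.appr m : ℚ_[p]) := by
    have := congrArg (fun z : ℤ_[p] => (z : ℚ_[p])) hc
    simp only [PadicInt.coe_mul, PadicInt.coe_sub, PadicInt.coe_pow, PadicInt.coe_natCast] at this
    exact this
  have hx : x - (((y.appr m : ℤ) / (p : ℚ) ^ m : ℚ) : ℚ_[p]) = c := by
    push_cast
    field_simp
    linear_combination -hc'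
  rw [hx]
  exact c.2

/-- The `p`-adic fractional part `{x} ∈ ℤ[1/p]` of `x`, well defined modulo `ℤ`. -/
def fracPart (p : ℕ) [Fact p.Prime] (x : ℚ_[p]) : ℚ := (exists_fracPart p x).choose

/-- The standard additive character `x ↦ e^{2πi{x}}` of `ℚ_[p]`; it is trivial on `ℤ_[p]`. -/
def addChar (p : ℕ) [Fact p.Prime] (x : ℚ_[p]) : ℂ :=
  Complex.exp (2 * Real.pi * Complex.I * (fracPart p x : ℂ))

/-- The additive group of symmetric `m × m` matrices over `ℚ_[p]`. -/
def symMat (p m : ℕ) [Fact p.Prime] : AddSubgroup (Matrix (Fin m) (Fin m) ℚ_[p]) where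
  carrier := {R | R.IsSymm}
  zero_mem' := Matrix.isSymm_zero
  add_mem' ha hb := Matrix.IsSymm.add ha hb
  neg_mem' ha := Matrix.IsSymm.neg ha

/-- The subgroup of symmetric `m × m` matrices with entries in `ℤ_[p]`. -/
def symLattice (p m : ℕ) [Fact p.Prime] : AddSubgroup (symMat p m) where
  carrier := {R | ∀ i j, ‖R.1 i j‖ ≤ 1}
  zero_mem' := by intro i j; simp
  add_mem' {a b} ha hb := fun i j =>
    (Padic.nonarchimedean (a.1 i j) (b.1 i j)).trans (max_le (ha i j) (hb i j))
  neg_mem' {a} ha := fun i j => by simpa using ha i j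

/-- `A R B = diag(p ^ d₁, …, p ^ dₘ)` for some `A, B ∈ GLₘ(ℤ_[p])`; in particular `R` is
invertible. -/
def HasElementaryDivisors {p m : ℕ} [Fact p.Prime] (R : Matrix (Fin m) (Fin m) ℚ_[p])
    (d : Fin m → ℤ) : Prop :=
  ∃ A B : GL (Fin m) ℤ_[p],
    A.1.map (algebraMap ℤ_[p] ℚ_[p]) * R * B.1.map (algebraMap ℤ_[p] ℚ_[p]) =
      Matrix.diagonal fun i => (p : ℚ_[p]) ^ d i

/-- `e(R) = j`, where `e(R)` is minus the sum of the nonpositive elementary divisor exponents of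
`R`. It depends only on the class of `R` modulo integral matrices, and every class contains
invertible matrices, so it is expressed through an invertible representative. -/
def HasExponent {p m : ℕ} [Fact p.Prime] (x : symMat p m ⧸ symLattice p m) (j : ℕ) : Prop :=
  ∃ (R : symMat p m) (d : Fin m → ℤ), (QuotientAddGroup.mk R : symMat p m ⧸ symLattice p m) = x ∧
    HasElementaryDivisors R.1 d ∧ (j : ℤ) = -∑ i with d i ≤ 0, d i

/-- The Siegel series
`B_p(X, h) = ∑_R X ^ e(R) e^{2πi tr(hR)}`, `R` running over symmetric matrices over `ℚ_[p]` modulo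
symmetric matrices over `ℤ_[p]`, as a formal power series. There are only finitely many `R` with
`e(R) = j`, and the summand does not depend on the chosen representative (`Quotient.out`) when
`h` is integral. -/
def siegelSeries {p m : ℕ} [Fact p.Prime] (h : Matrix (Fin m) (Fin m) ℤ_[p]) : ℂ⟦X⟧ :=
  PowerSeries.mk fun j =>
    ∑ᶠ (x : symMat p m ⧸ symLattice p m) (_ : HasExponent x j),
      addChar p (h.map (algebraMap ℤ_[p] ℚ_[p]) * (Quotient.out x).1).trace

open scoped Classical in
/-- For odd `p` and `D ≠ 0`: the value at `p` of the quadratic character of `ℚ_[p](√D) / ℚ_[p]`,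
which is `0` if the extension is ramified, `1` if it is trivial and `-1` if it is the unramified
quadratic extension. -/
def quadCharAt {p : ℕ} [Fact p.Prime] (D : ℚ_[p]) : ℤ :=
  if Odd D.valuation then 0 else if IsSquare D then 1 else -1

/-- `ρ_h(p)`, for `ρ_h` the character of `ℚ_[p](√((-1) ^ n det(2h)))`, `h` of size `2n`. -/
def rho {p n : ℕ} [Fact p.Prime] (h : Matrix (Fin (2 * n)) (Fin (2 * n)) ℤ_[p]) : ℤ :=
  quadCharAt ((-1) ^ n * ((2 • h).det : ℚ_[p]))

/-- `f` is the polynomial `f_{h,p}`: as formal power series,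
`f_{h,p}(X) = (1 - ρ_h(p) p ^ n X) / ((1 - X) ∏_{i=1}^n (1 - p ^ (2i) X ^ 2)) * B_p(X, h)`.
For `X = χ_p(p) p ^ (-s)` the first factor is
`L_p(s, χ) ∏_{i=1}^n L_p(2s - 2i, χ ^ 2) / L_p(s - n, χ ρ_h)`, that is,
`Λ_p(s / 2) / L_p(s - n, χ ρ_h)`. -/
def IsLocalFactor {p n : ℕ} [Fact p.Prime] (h : Matrix (Fin (2 * n)) (Fin (2 * n)) ℤ_[p])
    (f : ℤ[X]) : Prop :=
  ((f.map (Int.castRingHom ℂ) : ℂ[X]) : ℂ⟦X⟧) *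
      ((1 - PowerSeries.X) *
        ∏ i ∈ Finset.Icc 1 n, (1 - PowerSeries.C ((p : ℂ) ^ (2 * i)) * PowerSeries.X ^ 2)) =
    (1 - PowerSeries.C ((rho h : ℂ) * (p : ℂ) ^ n) * PowerSeries.X) * siegelSeries h

/-- A finite order character `χ = ⊗ χ_v` of `ℚˣ \ 𝔸ˣ` whose conductor divides `N`, given by its
local components. The conductor condition says that `χ_ℓ` is trivial on the units of `ℤ_[ℓ]` that
are `1` modulo `N`; so almost all `χ_ℓ` are unramified, all are continuous (for `N ≠ 0`), and the
product in the last field is finite. -/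
structure HeckeCharacter (N : ℕ) where
  /-- The component at the prime `ℓ`. -/
  fin : ∀ (l : ℕ) [Fact l.Prime], ℚ_[l]ˣ →* ℂˣ
  /-- The component at infinity. -/
  inf : ℝˣ →* ℂˣ
  continuous_inf : Continuous inf
  conductor : ∀ (l : ℕ) [Fact l.Prime] (u : ℚ_[l]ˣ), ‖(u : ℚ_[l])‖ = 1 →
    ‖(u : ℚ_[l]) - 1‖ ≤ ‖(N : ℚ_[l])‖ → fin l u = 1
  finite_order : ∃ r : ℕ, 0 < r ∧ (∀ x, inf x ^ r = 1) ∧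
    ∀ (l : ℕ) [Fact l.Prime] (x : ℚ_[l]ˣ), fin l x ^ r = 1
  trivial_on_rat : ∀ q : ℚˣ, inf (Units.map (algebraMap ℚ ℝ).toMonoidHom q) *
    ∏ᶠ l : Nat.Primes, (haveI : Fact (l : ℕ).Prime := ⟨l.2⟩
      fin l (Units.map (algebraMap ℚ ℚ_[l]).toMonoidHom q)) = 1

/-- `p` as an element of `ℚ_[p]ˣ`. -/
def uniformizer (p : ℕ) [Fact p.Prime] : ℚ_[p]ˣ :=
  Units.mk0 (p : ℚ_[p]) (Nat.cast_ne_zero.mpr (Fact.out : p.Prime).ne_zero)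

open scoped Classical in
/-- The valuation on `ℂ` obtained from an isomorphism of `ℂ` with an algebraic closure of `ℚ_[p]`,
normalized by `v(p) = 1`, with `v(0) = ∞`. -/
def valC {p : ℕ} [Fact p.Prime] (ι : ℂ ≃+* PadicAlgCl p) (z : ℂ) : WithTop ℝ :=
  if z = 0 then ⊤ else ((-Real.logb p ‖ι z‖ : ℝ) : WithTop ℝ)

/-- `e_{p,h}`: `0` or `1` according to the parity of `v_p(det h)`. -/
def parity {p m : ℕ} [Fact p.Prime] (h : Matrix (Fin m) (Fin m) ℤ_[p]) : ℕ :=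
  h.det.valuation % 2

end SiegelSeries

end

/-!
# Local Siegel series: integrality and a bound for the local factor

Let `m = 2n`, let `h` be a symmetric `m × m` matrix over `ℤ_[p]` with `det h ≠ 0`, `p` odd, and let
`B(h)` be its Siegel series. The local factor `f_h` is found together with its bound by induction on
`v(det h)`: the Siegel series is split into a *primitive part*, which is computed in closed form, and
the Siegel series of the forms `D⁻¹ U h Uᵀ D⁻¹` of smaller determinant.

**Gauss sums.** For a class `R = p⁻ᴹ A` the exponent `e(R)` is determined by the kernel of `A` modulo
`pᴹ` (`HasExponent.kerCard_mul`), so at `X = p⁻ᵏ` the power `X ^ e(R)` is a normalized Gauss sum of `A`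
over `m`-tuples of vectors in `k` hyperbolic planes over `ℤ/pᴹ` (`sum_stdAddChar_beta`). Restricting to
the tuples that are linearly independent modulo `p` defines a weight `wprim R`. By inclusion-exclusion
over the possible relations `v_j = ∑_{i<j} t_i v_i` modulo `p` (`ite_linearIndependent_eq_sum`),
`wprim R` is a signed sum of `X ^ (2 rk + e(Gᵀ R G))`, where `G = U⁻¹ D`, the matrix `U` is unipotent,
and `D` is diagonal with `rk` entries `p` and the other entries `1`. Moreover `wprim R = 0` unless
`p R = 0`: otherwise the tuples can be moved by multiples of `p ^ (M - 1)`, which changes the phase by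
a nontrivial character (`wprim_eq_zero`).

**Recursion.** Hence `∑_R wprim(R) e^{2πi tr(hR)}` is a polynomial, the primitive part `bprim h`, and
expanding `wprim` and substituting `R ↦ Gᵀ R G` gives (`bprim_eq_sum`)
`bprim h = ∑_o (-1) ^ rk p ^ ((m + 1) rk) X ^ (2 rk) B(D⁻¹ U h Uᵀ D⁻¹)`,
a nonintegral argument contributing `0`. The term without relations is `B(h)`; in the others the
valuation of the determinant drops by `2 rk`, while its square class and `ρ_h` do not change.

**Primitive part.** At `X = p⁻ᵏ` the primitive part counts the linearly independent families over
`ℤ/p` with Gram matrix `-2h` (`aeval_bprim`). Diagonalizing `h` modulo `p` and adding one vector at a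
time turns this count into a product of explicit factors `kappa` (`card_frames`,
`bprim_eq_prod_kappa`), in terms of the rank of `h` modulo `p` and the quadratic characters of the partial
products of the diagonal entries. After multiplication by `1 - ρ_h(p) p ^ n X` that product is divisible by `(1 - X) ∏ (1 - p ^ (2i) X ^ 2)`,
with an explicit quotient in `ℤ[X]` (`exists_prod_kappa_eq`). For a nonsingular reduction this uses
Hensel's lemma to identify `ρ_h(p)` with the sign of the reduction (`rho_eq_xi`).

**Bound.** Let `‖x‖ = p ^ k`, `k = n + 1 + t`, in a nonarchimedean field. The claim is
`‖f_h(x)‖ ≤ p ^ ((2t + 1) ⌊v(det h) / 2⌋)`. The quotient just described satisfies it because the corank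
of `h` modulo `p` is at most `v(det h)` (`corank_le_valuation_det`). A term of the recursion has the
factor `p ^ ((2n + 1) rk) x ^ (2 rk)` of norm `p ^ ((2t + 1) rk)`, exactly what the decrease of the
valuation by `2 rk` allows; so the bound passes through the induction (`exists_isLocalFactor`).
-/


noncomputable section

namespace SiegelSeries

section

variable {p m : ℕ} [hp : Fact p.Prime]

/-! ### The additive character -/

lemma toZModPow_eq_zero_iff (M : ℕ) (z : ℤ_[p]) :
    PadicInt.toZModPow M z = 0 ↔ (p : ℤ_[p]) ^ M ∣ z := by
  rw [← RingHom.mem_ker, PadicInt.ker_toZModPow, Ideal.mem_span_singleton]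

lemma toZModPow_surjective (M : ℕ) : Function.Surjective (PadicInt.toZModPow (p := p) M) := by
  intro a
  refine ⟨((a.val : ℕ) : ℤ_[p]), ?_⟩
  rw [map_natCast, ZMod.natCast_zmod_val]

lemma padic_p_ne_zero : (p : ℚ_[p]) ≠ 0 := Nat.cast_ne_zero.mpr hp.out.ne_zero

lemma padicInt_p_ne_zero : (p : ℤ_[p]) ≠ 0 := Nat.cast_ne_zero.mpr hp.out.ne_zero

lemma intCast_dvd_of_padic {b : ℤ} {M : ℕ} (hb : (p : ℤ_[p]) ^ M ∣ (b : ℤ_[p])) :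
    (p : ℤ) ^ M ∣ b := by
  rw [← PadicInt.norm_le_pow_iff_mem_span_pow _ _ |>.trans Ideal.mem_span_singleton] at hb
  have := PadicInt.norm_int_le_pow_iff_dvd.mp hb
  exact_mod_cast this

/-- On `p⁻ᴹ ℤ_[p]` the character `e^{2πi{x}}` is the standard character of `ℤ / pᴹ`. -/
lemma addChar_div (M : ℕ) (z : ℤ_[p]) :
    addChar p ((z : ℚ_[p]) / (p : ℚ_[p]) ^ M) = ZMod.stdAddChar (PadicInt.toZModPow M z) := by
  obtain ⟨⟨b, l, hr⟩, hle⟩ := (exists_fracPart p ((z : ℚ_[p]) / (p : ℚ_[p]) ^ M)).choose_spec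
  change fracPart p _ = _ at hr
  change ‖_ - ((fracPart p _ : ℚ) : ℚ_[p])‖ ≤ 1 at hle
  set a : ℕ := (PadicInt.toZModPow M z).val with ha
  have hp0 := padic_p_ne_zero (p := p)
  have hpC : (p : ℂ) ≠ 0 := Nat.cast_ne_zero.mpr hp.out.ne_zero
  -- `z = a + p^M c`, so the fractional part differs from `a / p^M` by an integer
  obtain ⟨c, hc⟩ : (p : ℤ_[p]) ^ M ∣ z - (a : ℤ_[p]) := by
    rw [← toZModPow_eq_zero_iff, map_sub, map_natCast, ha, ZMod.natCast_zmod_val, sub_self]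
  have hc' : (z : ℚ_[p]) = (a : ℚ_[p]) + (p : ℚ_[p]) ^ M * c := by
    have := congrArg (fun z : ℤ_[p] => (z : ℚ_[p])) hc
    simp only [PadicInt.coe_mul, PadicInt.coe_sub, PadicInt.coe_pow, PadicInt.coe_natCast] at this
    linear_combination this
  set d : ℤ_[p] := ⟨_, hle⟩ with hd
  have hd' : (d : ℚ_[p]) = (z : ℚ_[p]) / (p : ℚ_[p]) ^ M - (b : ℚ_[p]) / (p : ℚ_[p]) ^ l := by
    change (z : ℚ_[p]) / (p : ℚ_[p]) ^ M - ((fracPart p _ : ℚ) : ℚ_[p]) = _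
    rw [hr]; push_cast; ring
  have hdvd : (p : ℤ) ^ (M + l) ∣ b * p ^ M - a * p ^ l := by
    apply intCast_dvd_of_padic
    refine ⟨c - d, ?_⟩
    apply PadicInt.ext
    push_cast
    rw [hd', hc', pow_add]
    field_simp
    ring
  obtain ⟨e, he⟩ := hdvd
  have hfr : ((fracPart p ((z : ℚ_[p]) / (p : ℚ_[p]) ^ M) : ℚ) : ℂ) = (a : ℂ) / (p : ℂ) ^ M + e := by
    rw [hr]
    push_cast
    have he' : (b : ℂ) * (p : ℂ) ^ M - a * (p : ℂ) ^ l = (p : ℂ) ^ (M + l) * e := by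
      exact_mod_cast he
    rw [pow_add] at he'
    field_simp
    linear_combination he'
  rw [addChar, hfr]
  have h1 : (PadicInt.toZModPow M z) = ((a : ℤ) : ZMod (p ^ M)) := by
    rw [Int.cast_natCast, ha, ZMod.natCast_zmod_val]
  rw [h1, ZMod.stdAddChar_coe, mul_add, Complex.exp_add,
    show (2 * Real.pi * Complex.I * (e : ℂ)) = e * (2 * Real.pi * Complex.I) by ring,
    Complex.exp_int_mul_two_pi_mul_I, mul_one]
  congr 1
  push_cast
  ring

/-! ### Symmetric matrices modulo integral ones -/

variable (p m) in
/-- Symmetric matrices over `ℚ_[p]` modulo symmetric matrices over `ℤ_[p]`. -/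
abbrev SymQuot := symMat p m ⧸ symLattice p m

/-- The class of `p⁻ᴹ A`, for a symmetric matrix `A` over `ℤ_[p]`. -/
def frac (M : ℕ) (A : Matrix (Fin m) (Fin m) ℤ_[p]) (hA : A.IsSymm) : SymQuot p m :=
  QuotientAddGroup.mk (⟨((p : ℚ_[p]) ^ M)⁻¹ • A.map (algebraMap ℤ_[p] ℚ_[p]), by
    change Matrix.IsSymm _
    exact (hA.map _).smul _⟩ : symMat p m)

lemma frac_zero (M : ℕ) : frac M 0 Matrix.isSymm_zero = (0 : SymQuot p m) := by
  rw [frac, ← QuotientAddGroup.mk_zero]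
  congr 1
  apply Subtype.ext
  change ((p : ℚ_[p]) ^ M)⁻¹ • (0 : Matrix _ _ _).map (algebraMap ℤ_[p] ℚ_[p]) = (0 : Matrix _ _ _)
  rw [Matrix.map_zero _ (map_zero _), smul_zero]

lemma mk_eq_mk_iff (R S : symMat p m) :
    (QuotientAddGroup.mk R : SymQuot p m) = QuotientAddGroup.mk S ↔
      ∀ i j, ‖R.1 i j - S.1 i j‖ ≤ 1 := by
  rw [QuotientAddGroup.eq_iff_sub_mem]
  rfl

lemma norm_inv_pow_mul_le_one_iff (M : ℕ) (z : ℤ_[p]) :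
    ‖((p : ℚ_[p]) ^ M)⁻¹ * (z : ℚ_[p])‖ ≤ 1 ↔ (p : ℤ_[p]) ^ M ∣ z := by
  have hp0 := padic_p_ne_zero (p := p)
  constructor
  · intro h
    obtain ⟨c, hc⟩ : ∃ c : ℤ_[p], (c : ℚ_[p]) = ((p : ℚ_[p]) ^ M)⁻¹ * (z : ℚ_[p]) := ⟨⟨_, h⟩, rfl⟩
    refine ⟨c, PadicInt.ext ?_⟩
    push_cast
    rw [hc, mul_inv_cancel_left₀ (pow_ne_zero _ hp0)]
  · rintro ⟨c, rfl⟩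
    push_cast
    rw [inv_mul_cancel_left₀ (pow_ne_zero _ hp0)]
    exact c.2

lemma frac_eq_frac_iff (M : ℕ) {A B : Matrix (Fin m) (Fin m) ℤ_[p]} (hA : A.IsSymm)
    (hB : B.IsSymm) :
    frac M A hA = frac M B hB ↔
      A.map (PadicInt.toZModPow M) = B.map (PadicInt.toZModPow M) := by
  rw [frac, frac, mk_eq_mk_iff, ← Matrix.ext_iff]
  refine forall_congr' fun i => forall_congr' fun j => ?_
  change ‖((p : ℚ_[p]) ^ M)⁻¹ * (A i j : ℚ_[p]) - ((p : ℚ_[p]) ^ M)⁻¹ * (B i j : ℚ_[p])‖ ≤ 1 ↔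
    PadicInt.toZModPow M (A i j) = PadicInt.toZModPow M (B i j)
  rw [← mul_sub, ← PadicInt.coe_sub, norm_inv_pow_mul_le_one_iff, ← toZModPow_eq_zero_iff, map_sub,
    sub_eq_zero]

lemma exists_mk_eq_frac (M : ℕ) (R : symMat p m) (h : ∀ i j, ‖(p : ℚ_[p]) ^ M * R.1 i j‖ ≤ 1) :
    ∃ (A : Matrix (Fin m) (Fin m) ℤ_[p]) (hA : A.IsSymm),
      (QuotientAddGroup.mk R : SymQuot p m) = frac M A hA := by
  have hp0 := padic_p_ne_zero (p := p)
  choose A hA using fun i j =>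
    show ∃ c : ℤ_[p], (c : ℚ_[p]) = (p : ℚ_[p]) ^ M * R.1 i j from ⟨⟨_, h i j⟩, rfl⟩
  have hR : R.1.IsSymm := R.2
  have hs : Matrix.IsSymm (Matrix.of A) := by
    refine Matrix.IsSymm.ext fun i j => PadicInt.ext ?_
    change (A j i : ℚ_[p]) = A i j
    rw [hA, hA, hR.apply]
  refine ⟨Matrix.of A, hs, ?_⟩
  rw [frac, mk_eq_mk_iff]
  intro i j
  change ‖R.1 i j - ((p : ℚ_[p]) ^ M)⁻¹ * (A i j : ℚ_[p])‖ ≤ 1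
  rw [hA, inv_mul_cancel_left₀ (pow_ne_zero _ hp0), sub_self]
  simp

/-- Every class is the class of `p⁻ᴹ A` for all large `M`. -/
lemma exists_eq_frac_ge (x : SymQuot p m) :
    ∃ M₀, ∀ M ≥ M₀, ∃ (A : Matrix (Fin m) (Fin m) ℤ_[p]) (hA : A.IsSymm), x = frac M A hA := by
  obtain ⟨R, rfl⟩ := QuotientAddGroup.mk_surjective x
  obtain ⟨M₀, hM⟩ : ∃ M₀, ∀ M ≥ M₀, ∀ i j, ‖(p : ℚ_[p]) ^ M * R.1 i j‖ ≤ 1 := by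
    have : ∀ᶠ M in Filter.atTop, ∀ i j, ‖(p : ℚ_[p]) ^ M * R.1 i j‖ ≤ 1 := by
      rw [Filter.eventually_all]; intro i
      rw [Filter.eventually_all]; intro j
      have hlim : Filter.Tendsto (fun m : ℕ => ‖(p : ℚ_[p])‖ ^ m * ‖R.1 i j‖) Filter.atTop
          (nhds (0 * ‖R.1 i j‖)) :=
        (tendsto_pow_atTop_nhds_zero_of_lt_one (norm_nonneg _) Padic.norm_p_lt_one).mul_const _
      rw [zero_mul] at hlim
      filter_upwards [hlim.eventually (ge_mem_nhds one_pos)] with M hM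
      simpa [norm_mul, norm_pow] using hM
    exact Filter.eventually_atTop.mp this
  exact ⟨M₀, fun M hM' => exists_mk_eq_frac M R (hM M hM')⟩

/-- The classes killed by `pᴹ` are those of the matrices with denominator `pᴹ`. -/
lemma exists_eq_frac_iff (M : ℕ) (x : SymQuot p m) :
    (∃ (A : Matrix (Fin m) (Fin m) ℤ_[p]) (hA : A.IsSymm), x = frac M A hA) ↔
      (p ^ M) • x = 0 := by
  have hp0 := padic_p_ne_zero (p := p)
  have key : ∀ R : symMat p m, (p ^ M) • (QuotientAddGroup.mk R : SymQuot p m) = 0 ↔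
      ∀ i j, ‖(p : ℚ_[p]) ^ M * R.1 i j‖ ≤ 1 := fun R => by
    rw [← QuotientAddGroup.mk_nsmul, ← QuotientAddGroup.mk_zero, mk_eq_mk_iff]
    refine forall_congr' fun i => forall_congr' fun j => ?_
    have : ((p ^ M) • R : symMat p m).1 i j = (p : ℚ_[p]) ^ M * R.1 i j := by
      rw [AddSubgroup.coe_nsmul, Matrix.smul_apply, nsmul_eq_mul, Nat.cast_pow]
    rw [this, show (0 : symMat p m).1 i j = 0 from rfl, sub_zero]
  constructor
  · rintro ⟨A, hA, rfl⟩
    rw [frac, key]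
    intro i j
    change ‖(p : ℚ_[p]) ^ M * (((p : ℚ_[p]) ^ M)⁻¹ * (A i j : ℚ_[p]))‖ ≤ 1
    rw [mul_inv_cancel_left₀ (pow_ne_zero _ hp0)]
    exact (A i j).2
  · obtain ⟨R, rfl⟩ := QuotientAddGroup.mk_surjective x
    exact fun h => exists_mk_eq_frac M R ((key R).mp h)

lemma frac_add (M : ℕ) {A B : Matrix (Fin m) (Fin m) ℤ_[p]} (hA : A.IsSymm) (hB : B.IsSymm) :
    frac M A hA + frac M B hB = frac M (A + B) (hA.add hB) := by
  rw [frac, frac, frac, ← QuotientAddGroup.mk_add]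
  congr 1
  apply Subtype.ext
  ext i j
  simp [mul_add]

/-! ### The pairing with a symmetric matrix -/

/-- `x ↦ e^{2πi{tr(hx)}}`, computed on a representative. -/
def pair (h : Matrix (Fin m) (Fin m) ℤ_[p]) (x : SymQuot p m) : ℂ :=
  addChar p (h.map (algebraMap ℤ_[p] ℚ_[p]) * (Quotient.out x).1).trace

lemma pair_frac (h : Matrix (Fin m) (Fin m) ℤ_[p]) (M : ℕ)
    (A : Matrix (Fin m) (Fin m) ℤ_[p]) (hA : A.IsSymm) :
    pair h (frac M A hA) = ZMod.stdAddChar (PadicInt.toZModPow M (h * A).trace) := by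
  have hp0 := padic_p_ne_zero (p := p)
  have hout : (QuotientAddGroup.mk (Quotient.out (frac M A hA)) : SymQuot p m) = frac M A hA :=
    Quotient.out_eq _
  rw [frac, mk_eq_mk_iff] at hout
  choose! c hc using fun i j => show ∃ c : ℤ_[p], (Quotient.out (frac M A hA)).1 i j =
      ((p : ℚ_[p]) ^ M)⁻¹ * A i j + c from ⟨⟨_, hout i j⟩, by simp [frac]⟩
  have key : (h.map (algebraMap ℤ_[p] ℚ_[p]) * (Quotient.out (frac M A hA)).1).trace =
      (((h * (A + (p : ℤ_[p]) ^ M • Matrix.of c)).trace : ℤ_[p]) : ℚ_[p]) / (p : ℚ_[p]) ^ M := by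
    simp only [Matrix.trace, Matrix.diag, Matrix.mul_apply, hc, Matrix.map_apply, Matrix.add_apply,
      Matrix.smul_apply, Matrix.of_apply, PadicInt.coe_sum, smul_eq_mul, Finset.sum_div]
    refine Finset.sum_congr rfl fun i _ => Finset.sum_congr rfl fun j _ => ?_
    change (h i j : ℚ_[p]) * _ = _
    push_cast
    field_simp
  rw [pair, key, addChar_div]
  congr 1
  rw [← sub_eq_zero, ← map_sub, toZModPow_eq_zero_iff, mul_add, Matrix.trace_add, add_sub_cancel_left,
    Matrix.mul_smul, Matrix.trace_smul]
  exact ⟨_, rfl⟩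

lemma pair_add (h : Matrix (Fin m) (Fin m) ℤ_[p]) (x y : SymQuot p m) :
    pair h (x + y) = pair h x * pair h y := by
  obtain ⟨M, hM⟩ := exists_eq_frac_ge x
  obtain ⟨N, hN⟩ := exists_eq_frac_ge y
  obtain ⟨A, hA, rfl⟩ := hM (max M N) (le_max_left _ _)
  obtain ⟨B, hB, rfl⟩ := hN (max M N) (le_max_right _ _)
  rw [frac_add, pair_frac, pair_frac, pair_frac, mul_add, Matrix.trace_add, map_add,
    AddChar.map_add_eq_mul]

/-! ### Congruence transformations -/

/-- `R ↦ Gᵀ R G` on symmetric matrices. -/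
def conj (G : Matrix (Fin m) (Fin m) ℤ_[p]) : symMat p m →+ symMat p m where
  toFun R := ⟨(G.map (algebraMap ℤ_[p] ℚ_[p])).transpose * R.1 * G.map (algebraMap ℤ_[p] ℚ_[p]), by
    have hR : R.1.IsSymm := R.2
    change Matrix.IsSymm _
    simp [Matrix.IsSymm, Matrix.transpose_mul, hR.eq, Matrix.mul_assoc]⟩
  map_zero' := by apply Subtype.ext; simp
  map_add' R S := by apply Subtype.ext; simp [Matrix.mul_add, Matrix.add_mul]

/-- `R ↦ Gᵀ R G` on symmetric matrices modulo integral ones. -/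
def conjQ (G : Matrix (Fin m) (Fin m) ℤ_[p]) : SymQuot p m →+ SymQuot p m :=
  QuotientAddGroup.map _ _ (conj G) (by
    intro R hR
    change ∀ i j, ‖_‖ ≤ 1
    choose c hc using fun i j => show ∃ c : ℤ_[p], R.1 i j = c from ⟨⟨_, hR i j⟩, rfl⟩
    have : R.1 = (Matrix.of c).map (algebraMap ℤ_[p] ℚ_[p]) := by ext i j; exact hc i j
    intro i j
    change ‖((G.map (algebraMap ℤ_[p] ℚ_[p])).transpose * R.1 *
      G.map (algebraMap ℤ_[p] ℚ_[p])) i j‖ ≤ 1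
    rw [this, ← Matrix.transpose_map, ← Matrix.map_mul, ← Matrix.map_mul]
    exact (((G.transpose * Matrix.of c * G) i j) : ℤ_[p]).2)

lemma isSymm_conj (G : Matrix (Fin m) (Fin m) ℤ_[p]) {A : Matrix (Fin m) (Fin m) ℤ_[p]}
    (hA : A.IsSymm) : (G.transpose * A * G).IsSymm := by
  simp [Matrix.IsSymm, Matrix.transpose_mul, hA.eq, Matrix.mul_assoc]

lemma conjQ_frac (G : Matrix (Fin m) (Fin m) ℤ_[p]) (M : ℕ) (A : Matrix (Fin m) (Fin m) ℤ_[p])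
    (hA : A.IsSymm) :
    conjQ G (frac M A hA) = frac M (G.transpose * A * G) (isSymm_conj G hA) := by
  rw [frac, frac, conjQ, QuotientAddGroup.map_mk]
  congr 1
  apply Subtype.ext
  simp [conj, Matrix.map_mul, Matrix.transpose_map]

lemma conjQ_mul (G H : Matrix (Fin m) (Fin m) ℤ_[p]) (x : SymQuot p m) :
    conjQ (G * H) x = conjQ H (conjQ G x) := by
  obtain ⟨M, hM⟩ := exists_eq_frac_ge x
  obtain ⟨A, hA, rfl⟩ := hM M le_rfl
  rw [conjQ_frac, conjQ_frac, conjQ_frac]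
  congr 1
  simp [Matrix.transpose_mul, Matrix.mul_assoc]

lemma conjQ_one (x : SymQuot p m) : conjQ 1 x = x := by
  obtain ⟨M, hM⟩ := exists_eq_frac_ge x
  obtain ⟨A, hA, rfl⟩ := hM M le_rfl
  rw [conjQ_frac]
  congr 1
  simp

lemma pair_conjQ (h G : Matrix (Fin m) (Fin m) ℤ_[p]) (x : SymQuot p m) :
    pair h (conjQ G x) = pair (G * h * G.transpose) x := by
  obtain ⟨M, hM⟩ := exists_eq_frac_ge x
  obtain ⟨A, hA, rfl⟩ := hM M le_rfl
  rw [conjQ_frac, pair_frac, pair_frac]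
  congr 2
  calc (h * (G.transpose * A * G)).trace = (h * (G.transpose * A) * G).trace := by
        simp only [Matrix.mul_assoc]
    _ = (G * (h * (G.transpose * A))).trace := Matrix.trace_mul_comm _ _
    _ = _ := by simp only [Matrix.mul_assoc]

end

section

variable {p m : ℕ} [hp : Fact p.Prime]

/-! ### Elementary divisors and kernels modulo prime powers -/

/-- The number of solutions of `A y = 0` modulo `pᴹ`. -/
def kerCard (M : ℕ) (A : Matrix (Fin m) (Fin m) ℤ_[p]) : ℕ :=
  Nat.card {y : Fin m → ZMod (p ^ M) // (A.map (PadicInt.toZModPow M)).mulVec y = 0}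

lemma card_natCast_mul_eq_zero (N d : ℕ) [NeZero N] :
    Nat.card {a : ZMod N // (d : ZMod N) * a = 0} = N.gcd d := by
  have := IsAddCyclic.card_nsmulAddMonoidHom_ker (G := ZMod N) d
  rw [Nat.card_zmod] at this
  rw [← this]
  refine Nat.card_congr (Equiv.subtypeEquivRight fun a => ?_)
  simp [AddMonoidHom.mem_ker]

lemma card_pow_mul_eq_zero (M e : ℕ) :
    Nat.card {a : ZMod (p ^ M) // (p : ZMod (p ^ M)) ^ e * a = 0} = p ^ min M e := by
  have := card_natCast_mul_eq_zero (p ^ M) (p ^ e)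
  rw [Nat.cast_pow] at this
  rw [this]
  rcases le_total M e with h | h
  · rw [min_eq_left h, Nat.gcd_eq_left (pow_dvd_pow p h)]
  · rw [min_eq_right h, Nat.gcd_eq_right (pow_dvd_pow p h)]

/-- The kernel modulo `pᴹ` of a matrix with elementary divisors `p ^ e i`. -/
lemma kerCard_eq_of_diagonal (M : ℕ) (A : Matrix (Fin m) (Fin m) ℤ_[p])
    (P Q : GL (Fin m) ℤ_[p]) (e : Fin m → ℕ)
    (h : P.1 * A * Q.1 = Matrix.diagonal fun i => (p : ℤ_[p]) ^ e i) :
    kerCard M A = ∏ i, p ^ min M (e i) := by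
  set f := PadicInt.toZModPow (p := p) M
  have hmap : ∀ X Y : Matrix (Fin m) (Fin m) ℤ_[p], (X * Y).map f = X.map f * Y.map f :=
    fun X Y => Matrix.map_mul
  have hQ1 : Q.1.map f * (Q⁻¹).1.map f = 1 := by
    rw [← hmap, ← Units.val_mul, mul_inv_cancel]; simp [f]
  have hQ2 : (Q⁻¹).1.map f * Q.1.map f = 1 := by
    rw [← hmap, ← Units.val_mul, inv_mul_cancel]; simp [f]
  have hP2 : (P⁻¹).1.map f * P.1.map f = 1 := by
    rw [← hmap, ← Units.val_mul, inv_mul_cancel]; simp [f]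
  have hd : P.1.map f * A.map f * Q.1.map f = Matrix.diagonal fun i => (p : ZMod (p ^ M)) ^ e i := by
    rw [← hmap, ← hmap, h, Matrix.diagonal_map (map_zero f)]
    congr 1
    ext i
    simp
  have e1 : {y : Fin m → ZMod (p ^ M) // (A.map f).mulVec y = 0} ≃
      {z : Fin m → ZMod (p ^ M) // ∀ i, (p : ZMod (p ^ M)) ^ e i * z i = 0} :=
    { toFun := fun y => ⟨((Q⁻¹).1.map f).mulVec y.1, by
        have : (Matrix.diagonal fun i => (p : ZMod (p ^ M)) ^ e i).mulVec
            (((Q⁻¹).1.map f).mulVec y.1) = 0 := by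
          rw [← hd, Matrix.mulVec_mulVec, Matrix.mul_assoc, hQ1, Matrix.mul_one,
            ← Matrix.mulVec_mulVec, y.2, Matrix.mulVec_zero]
        intro i
        simpa [Matrix.mulVec_diagonal] using congrFun this i⟩
      invFun := fun z => ⟨(Q.1.map f).mulVec z.1, by
        have hz : (Matrix.diagonal fun i => (p : ZMod (p ^ M)) ^ e i).mulVec z.1 = 0 := by
          ext i
          simpa [Matrix.mulVec_diagonal] using z.2 i
        rw [← hd, ← Matrix.mulVec_mulVec, ← Matrix.mulVec_mulVec] at hz
        have := congrArg ((P⁻¹).1.map f).mulVec hz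
        rwa [Matrix.mulVec_mulVec, hP2, Matrix.one_mulVec, Matrix.mulVec_zero] at this⟩
      left_inv := fun y => Subtype.ext (by
        simp only [Matrix.mulVec_mulVec, hQ1, Matrix.one_mulVec])
      right_inv := fun y => Subtype.ext (by
        simp only [Matrix.mulVec_mulVec, hQ2, Matrix.one_mulVec]) }
  rw [kerCard, Nat.card_congr (e1.trans (Equiv.subtypePiEquivPi
    (p := fun i a => (p : ZMod (p ^ M)) ^ e i * a = 0))), Nat.card_pi]
  exact Finset.prod_congr rfl fun i _ => card_pow_mul_eq_zero M (e i)

lemma map_int_injective {A B : Matrix (Fin m) (Fin m) ℤ_[p]}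
    (h : A.map (algebraMap ℤ_[p] ℚ_[p]) = B.map (algebraMap ℤ_[p] ℚ_[p])) : A = B := by
  ext1 i j
  exact PadicInt.ext (congrFun (congrFun h i) j)

lemma zpow_norm_le_one {z : ℤ_[p]} {d : ℤ} (h : (z : ℚ_[p]) = (p : ℚ_[p]) ^ d) : 0 ≤ d := by
  have h1 := z.2
  rw [h, norm_zpow, Padic.norm_p, inv_zpow, ← zpow_neg] at h1
  by_contra hd
  have : (1 : ℝ) < (p : ℝ) ^ (-d) :=
    one_lt_zpow₀ (by exact_mod_cast hp.out.one_lt) (by omega)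
  linarith

/-- A representative of a class with exponent `j` scaled by `pᴹ`, in diagonal form. -/
lemma HasExponent.exists_diagonal {M j : ℕ} {A : Matrix (Fin m) (Fin m) ℤ_[p]} {hA : A.IsSymm}
    (h : HasExponent (frac M A hA) j) :
    ∃ (A' : Matrix (Fin m) (Fin m) ℤ_[p]) (P Q : GL (Fin m) ℤ_[p]) (e : Fin m → ℕ),
      A'.map (PadicInt.toZModPow M) = A.map (PadicInt.toZModPow M) ∧
      P.1 * A' * Q.1 = Matrix.diagonal (fun i => (p : ℤ_[p]) ^ e i) ∧
      j = ∑ i, (M - e i) := by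
  obtain ⟨R, d, hR, ⟨P, Q, hPQ⟩, hj⟩ := h
  have hp0 := padic_p_ne_zero (p := p)
  rw [frac, mk_eq_mk_iff] at hR
  choose c hc using fun i j => show ∃ c : ℤ_[p], (c : ℚ_[p]) =
    R.1 i j - ((p : ℚ_[p]) ^ M)⁻¹ * (A i j : ℚ_[p]) from ⟨⟨_, hR i j⟩, rfl⟩
  set A' : Matrix (Fin m) (Fin m) ℤ_[p] := A + (p : ℤ_[p]) ^ M • Matrix.of c with hA'
  have hA'R : A'.map (algebraMap ℤ_[p] ℚ_[p]) = (p : ℚ_[p]) ^ M • R.1 := by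
    ext i j
    change (((A i j + (p : ℤ_[p]) ^ M * c i j : ℤ_[p])) : ℚ_[p]) = (p : ℚ_[p]) ^ M * R.1 i j
    push_cast
    rw [hc]
    field_simp
    ring
  have hD : (P.1 * A' * Q.1).map (algebraMap ℤ_[p] ℚ_[p]) =
      Matrix.diagonal fun i => (p : ℚ_[p]) ^ ((M : ℤ) + d i) := by
    rw [Matrix.map_mul, Matrix.map_mul, hA'R, Matrix.mul_smul, Matrix.smul_mul, hPQ,
      Matrix.smul_eq_diagonal_mul, Matrix.diagonal_mul_diagonal]
    congr 1
    ext i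
    rw [zpow_add₀ hp0, zpow_natCast]
  have hnn : ∀ i, 0 ≤ (M : ℤ) + d i := fun i => by
    refine zpow_norm_le_one (p := p) (z := (P.1 * A' * Q.1) i i) ?_
    have := congrFun (congrFun hD i) i
    rw [Matrix.diagonal_apply_eq] at this
    exact this
  refine ⟨A', P, Q, fun i => ((M : ℤ) + d i).toNat, ?_, ?_, ?_⟩
  · ext i j
    change PadicInt.toZModPow M (A i j + (p : ℤ_[p]) ^ M * c i j) = PadicInt.toZModPow M (A i j)
    rw [map_add, (toZModPow_eq_zero_iff M _).mpr ⟨_, rfl⟩, add_zero]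
  · apply map_int_injective
    rw [hD, Matrix.diagonal_map (map_zero _)]
    congr 1
    ext i
    rw [map_pow, map_natCast, ← zpow_natCast, Int.toNat_of_nonneg (hnn i)]
  · zify
    rw [hj, Finset.sum_filter, ← Finset.sum_neg_distrib]
    refine Finset.sum_congr rfl fun i _ => ?_
    have := hnn i
    split_ifs <;> omega

/-- The exponent of the class of `p⁻ᴹ A` is determined by the kernel of `A` modulo `pᴹ`; in particular it
does not depend on the representative. -/
lemma HasExponent.kerCard_mul {M j : ℕ} {A : Matrix (Fin m) (Fin m) ℤ_[p]} {hA : A.IsSymm}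
    (h : HasExponent (frac M A hA) j) : kerCard M A * p ^ j = p ^ (M * m) := by
  obtain ⟨A', P, Q, e, h1, h2, h3⟩ := h.exists_diagonal
  have : kerCard M A = kerCard M A' := by rw [kerCard, kerCard, h1]
  rw [this, kerCard_eq_of_diagonal M A' P Q e h2, h3, ← Finset.prod_pow_eq_pow_sum,
    ← Finset.prod_mul_distrib]
  have : ∀ i ∈ Finset.univ, p ^ min M (e i) * p ^ (M - e i) = p ^ M := fun i _ => by
    rw [← pow_add]; congr 1; omega
  rw [Finset.prod_congr rfl this, Finset.prod_const, Finset.card_univ, Fintype.card_fin, pow_mul]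

/-- A class with exponent `j` is killed by `pʲ`, so there are finitely many such classes. -/
lemma HasExponent.nsmul_eq_zero {j : ℕ} {x : SymQuot p m} (h : HasExponent x j) :
    (p ^ j) • x = 0 := by
  obtain ⟨M₀, hM⟩ := exists_eq_frac_ge x
  obtain ⟨A, hA, rfl⟩ := hM (max M₀ j) (le_max_left _ _)
  set M := max M₀ j
  obtain ⟨A', P, Q, e, h1, h2, h3⟩ := h.exists_diagonal
  -- every elementary divisor of `pᴹ R` is divisible by `p ^ (M - j)`
  have hle : ∀ i, M ≤ e i + j := fun i => by
    have : M - e i ≤ ∑ i, (M - e i) :=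
      Finset.single_le_sum (f := fun i => M - e i) (fun _ _ => Nat.zero_le _) (Finset.mem_univ i)
    omega
  have hdiag : (p : ℤ_[p]) ^ j • (P.1 * A' * Q.1) =
      (p : ℤ_[p]) ^ M • Matrix.diagonal fun i => (p : ℤ_[p]) ^ (e i + j - M) := by
    rw [h2]
    ext a b
    by_cases hab : a = b
    · subst hab
      simp only [Matrix.smul_apply, Matrix.diagonal_apply_eq, smul_eq_mul, ← pow_add]
      congr 1
      have := hle a
      omega
    · simp [Matrix.diagonal_apply_ne _ hab]
  have hA'j : (p : ℤ_[p]) ^ j • A' = (p : ℤ_[p]) ^ M • ((P⁻¹).1 *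
      (Matrix.diagonal fun i => (p : ℤ_[p]) ^ (e i + j - M)) * (Q⁻¹).1) := by
    rw [← Matrix.smul_mul, ← Matrix.mul_smul, ← hdiag, Matrix.mul_smul, Matrix.smul_mul]
    congr 1
    rw [← mul_assoc, ← mul_assoc, ← Units.val_mul, inv_mul_cancel, Units.val_one, one_mul,
      mul_assoc, ← Units.val_mul, mul_inv_cancel, Units.val_one, mul_one]
  have hz : ((p : ℤ_[p]) ^ j • A).map (PadicInt.toZModPow M) = 0 := by
    have h4 : ((p : ℤ_[p]) ^ j • A).map (PadicInt.toZModPow M) =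
        ((p : ℤ_[p]) ^ j • A').map (PadicInt.toZModPow M) := by
      ext a b
      have := congrFun (congrFun h1 a) b
      simp only [Matrix.map_apply] at this
      simp only [Matrix.map_apply, Matrix.smul_apply, smul_eq_mul, map_mul, this]
    rw [h4, hA'j]
    ext a b
    simp only [Matrix.map_apply, Matrix.smul_apply, smul_eq_mul, Matrix.zero_apply]
    exact (toZModPow_eq_zero_iff M _).mpr ⟨_, rfl⟩
  have hs : ((p : ℤ_[p]) ^ j • A).IsSymm := hA.smul _
  have h5 : (p ^ j) • frac M A hA = frac M _ hs := by
    rw [frac, frac, ← QuotientAddGroup.mk_nsmul]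
    congr 1
    apply Subtype.ext
    ext a b
    change ((p ^ j) • (((p : ℚ_[p]) ^ M)⁻¹ • A.map (algebraMap ℤ_[p] ℚ_[p]))) a b =
      ((p : ℚ_[p]) ^ M)⁻¹ * ((((p : ℤ_[p]) ^ j * A a b : ℤ_[p])) : ℚ_[p])
    rw [Matrix.smul_apply, nsmul_eq_mul]
    change _ * (((p : ℚ_[p]) ^ M)⁻¹ * (A a b : ℚ_[p])) = _
    push_cast
    ring
  have h0 : (0 : SymQuot p m) = frac M 0 Matrix.isSymm_zero := (frac_zero M).symm
  rw [h5, h0, frac_eq_frac_iff, hz]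
  ext a b
  simp

/-! ### Existence of elementary divisors -/

/-- Elementary divisors of a nonsingular matrix over `ℤ_[p]`, from the Smith normal form of its image. -/
lemma exists_diagonal_form (A : Matrix (Fin m) (Fin m) ℤ_[p]) (hdet : A.det ≠ 0) :
    ∃ (P Q : GL (Fin m) ℤ_[p]) (e : Fin m → ℕ),
      P.1 * A * Q.1 = Matrix.diagonal fun i => (p : ℤ_[p]) ^ e i := by
  classical
  set f : (Fin m → ℤ_[p]) →ₗ[ℤ_[p]] (Fin m → ℤ_[p]) := Matrix.toLin' A with hf
  have hinj : Function.Injective f := by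
    rw [hf]
    intro x y hxy
    rw [Matrix.toLin'_apply, Matrix.toLin'_apply] at hxy
    exact Matrix.mulVec_injective_of_det_ne_zero hdet hxy
  set E := LinearEquiv.ofInjective f hinj
  set b := Pi.basisFun ℤ_[p] (Fin m)
  obtain ⟨b', a, ab', hab⟩ := Submodule.exists_smith_normal_form_of_rank_eq b
    (N := LinearMap.range f) (LinearEquiv.finrank_eq E).symm
  set c := ab'.map E.symm with hc
  have hfc : ∀ i, f (c i) = a i • b' i := fun i => by
    rw [← hab, hc, Module.Basis.map_apply]
    change (E (E.symm (ab' i)) : Fin m → ℤ_[p]) = _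
    rw [LinearEquiv.apply_symm_apply]
  have hdiag : LinearMap.toMatrix c b' f = Matrix.diagonal a := by
    ext i j
    rw [LinearMap.toMatrix_apply, hfc, map_smul, Module.Basis.repr_self]
    by_cases hij : i = j
    · subst hij; simp
    · simp [Matrix.diagonal_apply_ne _ hij, Ne.symm hij]
  have hA : LinearMap.toMatrix b b f = A := by
    rw [hf]; exact LinearMap.toMatrix'_toLin' A
  have key := basis_toMatrix_mul_linearMap_toMatrix_mul_basis_toMatrix c b b' b f
  rw [hA, hdiag] at key
  have ha0 : ∀ i, a i ≠ 0 := fun i h0 => by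
    have h1 : f (c i) = f 0 := by rw [hfc, h0, zero_smul, map_zero]
    exact c.ne_zero i (hinj h1)
  let P : GL (Fin m) ℤ_[p] := ⟨b'.toMatrix b, b.toMatrix b', Module.Basis.toMatrix_mul_toMatrix_flip _ _,
    Module.Basis.toMatrix_mul_toMatrix_flip _ _⟩
  let Q : GL (Fin m) ℤ_[p] := ⟨b.toMatrix c, c.toMatrix b, Module.Basis.toMatrix_mul_toMatrix_flip _ _,
    Module.Basis.toMatrix_mul_toMatrix_flip _ _⟩
  -- the unit parts of the diagonal entries are absorbed into the left factor
  let u : Fin m → ℤ_[p]ˣ := fun i => PadicInt.unitCoeff (ha0 i)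
  let D : GL (Fin m) ℤ_[p] := ⟨Matrix.diagonal fun i => ((u i)⁻¹ : ℤ_[p]ˣ).1,
    Matrix.diagonal fun i => (u i).1, by simp [Matrix.diagonal_mul_diagonal],
    by simp [Matrix.diagonal_mul_diagonal]⟩
  refine ⟨D * P, Q, fun i => (a i).valuation, ?_⟩
  rw [Units.val_mul, Matrix.mul_assoc, Matrix.mul_assoc, ← Matrix.mul_assoc P.1]
  change Matrix.diagonal _ * (b'.toMatrix b * A * b.toMatrix c) = _
  rw [key, Matrix.diagonal_mul_diagonal]
  congr 1
  ext1 i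
  conv_lhs => rw [PadicInt.unitCoeff_spec (ha0 i)]
  rw [← mul_assoc]
  change (((u i)⁻¹ : ℤ_[p]ˣ).1 * (u i).1) * _ = _
  rw [Units.inv_mul, one_mul]

/-- Every class has an exponent. -/
lemma exists_hasExponent (x : SymQuot p m) : ∃ j, HasExponent x j := by
  obtain ⟨M, hM⟩ := exists_eq_frac_ge x
  obtain ⟨A, hA, rfl⟩ := hM M le_rfl
  have hp0 := padic_p_ne_zero (p := p)
  -- a translate of `A` by a scalar matrix divisible by `pᴹ` is nonsingular, as the characteristic
  -- polynomial has finitely many roots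
  obtain ⟨t, ht⟩ : ∃ t : ℕ, (A + ((t : ℤ_[p]) * (p : ℤ_[p]) ^ M) • (1 : Matrix _ _ _)).det ≠ 0 := by
    by_contra hcon
    push Not at hcon
    have hfin : ((-A).charpoly.rootSet ℤ_[p]).Finite := Polynomial.rootSet_finite _ _
    refine Set.infinite_range_of_injective (f := fun t : ℕ => (t : ℤ_[p]) * (p : ℤ_[p]) ^ M)
      (fun s t hst => ?_) (hfin.subset ?_)
    · have := mul_right_cancel₀ (pow_ne_zero _ (padicInt_p_ne_zero (p := p))) hst
      exact_mod_cast this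
    · rintro _ ⟨t, rfl⟩
      rw [Polynomial.mem_rootSet_of_ne (Matrix.charpoly_monic _).ne_zero, Polynomial.aeval_def,
        Algebra.algebraMap_self, Polynomial.eval₂_id, Matrix.eval_charpoly, sub_neg_eq_add,
        add_comm]
      have := hcon t
      rwa [Matrix.smul_one_eq_diagonal] at this
  set A' := A + ((t : ℤ_[p]) * (p : ℤ_[p]) ^ M) • (1 : Matrix (Fin m) (Fin m) ℤ_[p]) with hA'
  have hs : A'.IsSymm := hA.add (Matrix.isSymm_one.smul _)
  have hx : frac M A hA = frac M A' hs := by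
    rw [frac_eq_frac_iff]
    ext i j
    simp only [Matrix.map_apply, hA', Matrix.add_apply, Matrix.smul_apply, smul_eq_mul, map_add]
    rw [(toZModPow_eq_zero_iff M (_ * _ * _)).mpr ⟨t * (1 : Matrix _ _ _) i j, by ring⟩, add_zero]
  obtain ⟨P, Q, e, hPQ⟩ := exists_diagonal_form A' ht
  let d : Fin m → ℤ := fun i => (e i : ℤ) - M
  refine ⟨(-∑ i with d i ≤ 0, d i).toNat, _, d, hx.symm, ⟨P, Q, ?_⟩, ?_⟩
  · have := congrArg (fun X => ((p : ℚ_[p]) ^ M)⁻¹ • Matrix.map X (algebraMap ℤ_[p] ℚ_[p])) hPQ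
    simp only [Matrix.map_mul, Matrix.diagonal_map (map_zero (algebraMap ℤ_[p] ℚ_[p]))] at this
    rw [Matrix.mul_smul, Matrix.smul_mul, this, Matrix.smul_eq_diagonal_mul,
      Matrix.diagonal_mul_diagonal]
    congr 1
    ext i
    simp only [d]
    rw [zpow_sub₀ hp0, zpow_natCast, zpow_natCast, map_pow, map_natCast, div_eq_inv_mul]
  · rw [Int.toNat_of_nonneg]
    rw [← Finset.sum_neg_distrib]
    exact Finset.sum_nonneg fun i hi => by
      have := (Finset.mem_filter.mp hi).2
      omega

/-- The exponent `e(R)` of a class. -/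
def expo (x : SymQuot p m) : ℕ := (exists_hasExponent x).choose

lemma hasExponent_expo (x : SymQuot p m) : HasExponent x (expo x) :=
  (exists_hasExponent x).choose_spec

lemma HasExponent.unique {x : SymQuot p m} {i j : ℕ} (hi : HasExponent x i)
    (hj : HasExponent x j) : i = j := by
  obtain ⟨M, hM⟩ := exists_eq_frac_ge x
  obtain ⟨A, hA, rfl⟩ := hM M le_rfl
  have h := hi.kerCard_mul.trans hj.kerCard_mul.symm
  have h0 : 0 < kerCard M A := by
    rcases Nat.eq_zero_or_pos (kerCard M A) with h0 | h0
    · have := hi.kerCard_mul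
      rw [h0, zero_mul] at this
      exact absurd this.symm (pow_ne_zero _ hp.out.ne_zero)
    · exact h0
  exact Nat.pow_right_injective hp.out.two_le (Nat.eq_of_mul_eq_mul_left h0 h)

lemma hasExponent_iff (x : SymQuot p m) (j : ℕ) : HasExponent x j ↔ expo x = j :=
  ⟨fun h => (hasExponent_expo x).unique h, fun h => h ▸ hasExponent_expo x⟩

lemma kerCard_mul_pow_expo (M : ℕ) (A : Matrix (Fin m) (Fin m) ℤ_[p]) (hA : A.IsSymm) :
    kerCard M A * p ^ expo (frac M A hA) = p ^ (M * m) :=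
  (hasExponent_expo _).kerCard_mul

lemma pow_expo_nsmul (x : SymQuot p m) : (p ^ expo x) • x = 0 :=
  (hasExponent_expo x).nsmul_eq_zero

end

section

/-! ### Character sums over finite groups -/

open scoped Classical in
lemma sum_stdAddChar_comp {G : Type*} [AddCommGroup G] [Fintype G] {N : ℕ} [NeZero N]
    (L : G →+ ZMod N) :
    ∑ g, ZMod.stdAddChar (L g) = if L = 0 then (Fintype.card G : ℂ) else 0 := by
  have h1 : ((ZMod.stdAddChar (N := N)).compAddMonoidHom L = 0) ↔ L = 0 := by
    constructor
    · intro h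
      ext g
      have := DFunLike.congr_fun h g
      rw [AddChar.compAddMonoidHom_apply, AddChar.zero_apply] at this
      exact ZMod.injective_stdAddChar (this.trans (AddChar.map_zero_eq_one _).symm)
    · rintro rfl
      ext g
      simp
  have h2 := AddChar.sum_eq_ite ((ZMod.stdAddChar (N := N)).compAddMonoidHom L)
  simp only [h1, AddChar.compAddMonoidHom_apply] at h2
  exact h2

/-- Summation along a homomorphism of finite groups. -/
lemma sum_comp_addMonoidHom {G H R : Type*} [AddCommGroup G] [AddCommGroup H] [Fintype G]
    [Fintype H] [DecidableEq H] [CommRing R] (φ : G →+ H) (P : H → Prop) [DecidablePred P]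
    (hP : ∀ h, P h ↔ ∃ g, φ g = h) (F : H → R) :
    ∑ g, F (φ g) = (Nat.card {g // φ g = 0} : R) * ∑ h, if P h then F h else 0 := by
  rw [← Finset.sum_fiberwise (s := Finset.univ) (g := φ), Finset.mul_sum]
  refine Finset.sum_congr rfl fun h _ => ?_
  rw [Finset.sum_congr rfl (g := fun _ => F h) (fun g hg => by rw [(Finset.mem_filter.mp hg).2]),
    Finset.sum_const, nsmul_eq_mul]
  by_cases hh : P h
  · rw [if_pos hh]
    congr 2
    rw [AddMonoidHom.card_fiber_eq_of_mem_range φ (x := h) (y := 0) ((hP h).mp hh) ⟨0, map_zero φ⟩,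
      Nat.card_eq_fintype_card, Fintype.card_subtype]
  · rw [if_neg hh, mul_zero]
    have : (Finset.univ.filter fun g => φ g = h) = ∅ := by
      rw [Finset.filter_eq_empty_iff]
      intro g _ hg
      exact hh ((hP h).mpr ⟨g, hg⟩)
    rw [this]
    simp

/-! ### Gauss sums of symmetric matrices -/

variable {m k N : ℕ}

/-- The module `(ℤ/N)^k × (ℤ/N)^k`, with its hyperbolic quadratic form `(x, y) ↦ x · y`. -/
abbrev Hyp (N k : ℕ) := (Fin k → ZMod N) × (Fin k → ZMod N)

/-- `∑ S i j (x i · y j)` for `v i = (x i, y i)` and `w j = (x j, y j)`; on the diagonal it is the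
trace of `S` against the Gram matrix of `v`, up to symmetrization. -/
def beta (S : Matrix (Fin m) (Fin m) (ZMod N)) (v w : Fin m → Hyp N k) : ZMod N :=
  ∑ i, ∑ j, S i j * ((v i).1 ⬝ᵥ (w j).2)

lemma beta_add_left (S : Matrix (Fin m) (Fin m) (ZMod N)) (v v' w : Fin m → Hyp N k) :
    beta S (v + v') w = beta S v w + beta S v' w := by
  simp [beta, mul_add, Finset.sum_add_distrib]

lemma beta_add_right (S : Matrix (Fin m) (Fin m) (ZMod N)) (v w w' : Fin m → Hyp N k) :
    beta S v (w + w') = beta S v w + beta S v w' := by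
  simp [beta, mul_add, Finset.sum_add_distrib]

lemma beta_smul_left (S : Matrix (Fin m) (Fin m) (ZMod N)) (c : ZMod N) (v w : Fin m → Hyp N k) :
    beta S (c • v) w = c * beta S v w := by
  simp only [beta, Finset.mul_sum, Pi.smul_apply, Prod.smul_fst, smul_dotProduct, smul_eq_mul]
  exact Finset.sum_congr rfl fun i _ => Finset.sum_congr rfl fun j _ => by ring

lemma beta_smul_right (S : Matrix (Fin m) (Fin m) (ZMod N)) (c : ZMod N) (v w : Fin m → Hyp N k) :
    beta S v (c • w) = c * beta S v w := by
  simp only [beta, Finset.mul_sum, Pi.smul_apply, Prod.smul_snd, dotProduct_smul, smul_eq_mul]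
  exact Finset.sum_congr rfl fun i _ => Finset.sum_congr rfl fun j _ => by ring

/-- The action of a matrix on tuples of vectors. -/
def tupleMul {R W : Type*} [CommRing R] [AddCommGroup W] [Module R W]
    (G : Matrix (Fin m) (Fin m) R) : (Fin m → W) →+ (Fin m → W) where
  toFun v i := ∑ j, G i j • v j
  map_zero' := by ext1 i; simp
  map_add' v w := by ext1 i; simp [Finset.sum_add_distrib]

lemma tupleMul_apply {R W : Type*} [CommRing R] [AddCommGroup W] [Module R W]
    (G : Matrix (Fin m) (Fin m) R) (v : Fin m → W) (i : Fin m) :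
    tupleMul G v i = ∑ j, G i j • v j := rfl

lemma tupleMul_mul {R W : Type*} [CommRing R] [AddCommGroup W] [Module R W]
    (G H : Matrix (Fin m) (Fin m) R) (v : Fin m → W) :
    tupleMul (G * H) v = tupleMul G (tupleMul H v) := by
  ext1 i
  simp only [tupleMul_apply, Matrix.mul_apply, Finset.sum_smul, Finset.smul_sum, mul_smul]
  exact Finset.sum_comm

lemma tupleMul_one {R W : Type*} [CommRing R] [AddCommGroup W] [Module R W] (v : Fin m → W) :
    tupleMul (1 : Matrix (Fin m) (Fin m) R) v = v := by
  ext1 i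
  simp [tupleMul_apply, Matrix.one_apply]

lemma beta_tupleMul (S G : Matrix (Fin m) (Fin m) (ZMod N)) (v w : Fin m → Hyp N k) :
    beta S (tupleMul G v) (tupleMul G w) = beta (G.transpose * S * G) v w := by
  have h1 : ∀ i j, ((tupleMul G v i).1 ⬝ᵥ (tupleMul G w j).2) =
      ∑ a, ∑ b, G i a * G j b * ((v a).1 ⬝ᵥ (w b).2) := fun i j => by
    simp only [tupleMul_apply, Prod.fst_sum, Prod.snd_sum, sum_dotProduct, dotProduct_sum,
      Prod.smul_fst, Prod.smul_snd, smul_dotProduct, dotProduct_smul, smul_eq_mul,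
      Finset.mul_sum]
    rw [Finset.sum_comm]
    exact Finset.sum_congr rfl fun a _ => Finset.sum_congr rfl fun b _ => by ring
  have h2 : ∀ a b, (G.transpose * S * G) a b = ∑ i, ∑ j, S i j * (G i a * G j b) := fun a b => by
    simp only [Matrix.mul_apply, Finset.sum_mul, Matrix.transpose_apply]
    rw [Finset.sum_comm]
    exact Finset.sum_congr rfl fun i _ => Finset.sum_congr rfl fun j _ => by ring
  simp only [beta, h1, h2, Finset.mul_sum, Finset.sum_mul]
  calc _ = ∑ i, ∑ a, ∑ j, ∑ b, S i j * (G i a * G j b * ((v a).1 ⬝ᵥ (w b).2)) :=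
        Finset.sum_congr rfl fun i _ => Finset.sum_comm
    _ = ∑ a, ∑ i, ∑ j, ∑ b, S i j * (G i a * G j b * ((v a).1 ⬝ᵥ (w b).2)) := Finset.sum_comm
    _ = ∑ a, ∑ i, ∑ b, ∑ j, S i j * (G i a * G j b * ((v a).1 ⬝ᵥ (w b).2)) :=
        Finset.sum_congr rfl fun a _ => Finset.sum_congr rfl fun i _ => Finset.sum_comm
    _ = ∑ a, ∑ b, ∑ i, ∑ j, S i j * (G i a * G j b * ((v a).1 ⬝ᵥ (w b).2)) :=
        Finset.sum_congr rfl fun a _ => Finset.sum_comm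
    _ = _ := by
        refine Finset.sum_congr rfl fun a _ => Finset.sum_congr rfl fun b _ =>
          Finset.sum_congr rfl fun i _ => Finset.sum_congr rfl fun j _ => by ring

/-- The Gauss sum of a symmetric matrix `S` on `k` hyperbolic planes is a power of `N` times the `k`-th
power of the order of the kernel of `S`: summing over the second components leaves the tuples of
first components killed by `S`. -/
lemma sum_stdAddChar_beta [NeZero N] (S : Matrix (Fin m) (Fin m) (ZMod N)) (hS : S.IsSymm) :
    ∑ v : Fin m → Hyp N k, ZMod.stdAddChar (beta S v v) =
      (N : ℂ) ^ (m * k) * (Nat.card {y : Fin m → ZMod N // S.mulVec y = 0} : ℂ) ^ k := by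
  classical
  rw [← (Equiv.arrowProdEquivProdArrow (Fin m) (fun _ => Fin k → ZMod N)
    (fun _ => Fin k → ZMod N)).symm.sum_comp, Fintype.sum_prod_type]
  let L : (Fin m → Fin k → ZMod N) → (Fin m → Fin k → ZMod N) →+ ZMod N := fun x =>
    { toFun := fun y => ∑ i, ∑ j, S i j * (x i ⬝ᵥ y j)
      map_zero' := by simp
      map_add' := fun y z => by simp [mul_add, Finset.sum_add_distrib] }
  have h1 : ∀ x : Fin m → Fin k → ZMod N, ∑ y : Fin m → Fin k → ZMod N,
      ZMod.stdAddChar (beta S ((Equiv.arrowProdEquivProdArrow (Fin m) (fun _ => Fin k → ZMod N)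
        (fun _ => Fin k → ZMod N)).symm (x, y)) ((Equiv.arrowProdEquivProdArrow (Fin m)
        (fun _ => Fin k → ZMod N) (fun _ => Fin k → ZMod N)).symm (x, y))) =
      if ∀ c, S.mulVec (fun i => x i c) = 0 then (N : ℂ) ^ (m * k) else 0 := fun x => by
    change ∑ y, ZMod.stdAddChar (L x y) = _
    rw [sum_stdAddChar_comp]
    have hcard : Fintype.card (Fin m → Fin k → ZMod N) = N ^ (m * k) := by
      simp [ZMod.card, ← pow_mul, mul_comm]
    rw [hcard, Nat.cast_pow]
    refine if_congr ?_ rfl rfl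
    have hL : ∀ y, L x y = ∑ j, ∑ c, (S.mulVec (fun i => x i c)) j * y j c := fun y => by
      change ∑ i, ∑ j, S i j * (x i ⬝ᵥ y j) = _
      rw [Finset.sum_comm]
      refine Finset.sum_congr rfl fun j _ => ?_
      simp only [dotProduct, Matrix.mulVec, Finset.mul_sum, Finset.sum_mul]
      rw [Finset.sum_comm]
      exact Finset.sum_congr rfl fun c _ => Finset.sum_congr rfl fun i _ => by
        rw [hS.apply]; ring
    constructor
    · intro h c
      ext j
      have := DFunLike.congr_fun h (Pi.single j (Pi.single c 1))
      rw [hL] at this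
      rw [Finset.sum_eq_single j, Finset.sum_eq_single c] at this
      · simpa using this
      · intro c' _ hc'; simp [hc']
      · simp
      · intro j' _ hj'; simp [hj']
      · simp
    · intro h
      refine AddMonoidHom.ext fun y => ?_
      rw [hL]
      simp [h]
  rw [Finset.sum_congr rfl fun x _ => h1 x, ← Finset.sum_filter, Finset.sum_const, nsmul_eq_mul,
    mul_comm]
  congr 1
  rw [← Fintype.card_subtype, ← Nat.card_eq_fintype_card]
  have e : {x : Fin m → Fin k → ZMod N // ∀ c, S.mulVec (fun i => x i c) = 0} ≃
      (Fin k → {y : Fin m → ZMod N // S.mulVec y = 0}) :=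
    ((Equiv.piComm fun _ _ => ZMod N).subtypeEquiv
      (q := fun z : Fin k → Fin m → ZMod N => ∀ c, S.mulVec (z c) = 0)
      (fun x => Iff.rfl)).trans (Equiv.subtypePiEquivPi (p := fun _ y => S.mulVec y = 0))
  rw [Nat.card_congr e, Nat.card_fun, Nat.card_fin, Nat.cast_pow]

end

section

/-! ### Linear independence as an alternating sum -/

/-- A dependent family has a member in the span of the earlier ones. -/
lemma exists_eq_sum_of_not_linearIndependent {ι F W : Type*} [LinearOrder ι] [Fintype ι] [Field F]
    [AddCommGroup W] [Module F W] {v : ι → W} (h : ¬ LinearIndependent F v) :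
    ∃ (j : ι) (t : {i // i < j} → F), v j = ∑ i, t i • v i := by
  rw [Fintype.linearIndependent_iff] at h
  push Not at h
  obtain ⟨g, hg, i₀, hi₀⟩ := h
  classical
  obtain ⟨j, hj⟩ := (Finset.univ.filter fun i => g i ≠ 0).exists_maximal ⟨i₀, by simpa using hi₀⟩
  have hj0 : g j ≠ 0 := by simpa using hj.1
  have hgt : ∀ i, j < i → g i = 0 := fun i hi => by
    by_contra hne
    exact absurd (hj.2 (by simpa using hne) hi.le) (not_le.mpr hi)
  refine ⟨j, fun i => -((g j)⁻¹ * g i), ?_⟩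
  have h1 : ∑ i : {i // ¬ i < j}, g i • v i = g j • v j := by
    rw [Finset.sum_eq_single (⟨j, lt_irrefl j⟩ : {i // ¬ i < j})]
    · intro b _ hb
      have : j < b.1 := lt_of_le_of_ne (not_lt.mp b.2) fun h => hb (Subtype.ext h.symm)
      rw [hgt _ this, zero_smul]
    · simp
  rw [← Fintype.sum_subtype_add_sum_subtype (· < j), h1] at hg
  have h2 : g j • v j = - ∑ i : {i // i < j}, g i • v i := eq_neg_of_add_eq_zero_right hg
  rw [← inv_smul_smul₀ hj0 (v j), h2, ← Finset.sum_neg_distrib, Finset.smul_sum]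
  exact Finset.sum_congr rfl fun i _ => by rw [neg_smul, mul_smul, smul_neg]

open scoped Classical in
/-- Linear independence of `v` is detected by the product over `j` of `1 - #{t | v j = ∑ t i v i}`,
the sum running over `i < j`: at the first `j` with a solution, that solution is unique. -/
lemma ite_linearIndependent {m : ℕ} {F W : Type*} [Field F] [Fintype F] [AddCommGroup W]
    [Module F W] (v : Fin m → W) :
    (if LinearIndependent F v then (1 : ℤ) else 0) =
      ∏ j, (1 - ∑ t : {i : Fin m // i < j} → F, if v j = ∑ i, t i • v i then 1 else 0) := by
  split_ifs with h
  · refine (Finset.prod_eq_one fun j _ => ?_).symm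
    rw [Finset.sum_eq_zero, sub_zero]
    intro t _
    rw [if_neg]
    intro heq
    refine h.notMem_span_image (s := Set.Iio j) (x := j) (by simp) ?_
    rw [heq]
    exact Submodule.sum_mem _ fun i _ => Submodule.smul_mem _ _
      (Submodule.subset_span ⟨i, i.2, rfl⟩)
  · have hex : ∃ j : Fin m, ∃ t : {i // i < j} → F, v j = ∑ i, t i • v i :=
      exists_eq_sum_of_not_linearIndependent h
    let j := WellFounded.min (wellFounded_lt (α := Fin m)) {j | ∃ t : {i // i < j} → F,
      v j = ∑ i, t i • v i} hex
    obtain ⟨t, ht⟩ : ∃ t : {i // i < j} → F, v j = ∑ i, t i • v i :=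
      WellFounded.min_mem (wellFounded_lt (α := Fin m)) _ hex
    have hmin : ∀ j' < j, ¬ ∃ t : {i // i < j'} → F, v j' = ∑ i, t i • v i := fun j' hj' hc =>
      WellFounded.not_lt_min (wellFounded_lt (α := Fin m))
        {j | ∃ t : {i // i < j} → F, v j = ∑ i, t i • v i} hc hj'
    have hli : LinearIndependent F fun i : {i // i < j} => v i := by
      by_contra hnot
      obtain ⟨⟨j', hj'⟩, s, hs⟩ := exists_eq_sum_of_not_linearIndependent hnot
      refine hmin j' hj' ⟨fun i => s ⟨⟨i, i.2.trans hj'⟩, i.2⟩, hs.trans ?_⟩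
      exact Fintype.sum_equiv
        { toFun := fun i => (⟨i.1.1, i.2⟩ : {i // i < j'})
          invFun := fun i => ⟨⟨i.1, i.2.trans hj'⟩, i.2⟩
          left_inv := fun i => rfl
          right_inv := fun i => rfl } _ _ fun i => rfl
    symm
    apply Finset.prod_eq_zero (Finset.mem_univ j)
    rw [Finset.sum_eq_single t, if_pos ht, sub_self]
    · intro s _ hst
      rw [if_neg]
      intro hs
      exact hst (hli.fintypeLinearCombination_injective (hs.symm.trans ht))
    · simp

/-! ### The matrices detecting linear dependence modulo `p` -/

variable {p m k : ℕ} [hp : Fact p.Prime]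

/-- `ZMod (p ^ 1)` is the residue field in the tower of the rings `ZMod (p ^ M)`. -/
instance factPowOne : Fact (p ^ 1).Prime := ⟨by rw [pow_one]; exact hp.out⟩

variable (p m) in
/-- For each `j`, either nothing or the coefficients of a relation expressing the `j`-th vector
through the earlier ones modulo `p`. -/
abbrev Relations := ∀ j : Fin m, Option ({i : Fin m // i < j} → ZMod (p ^ 1))

/-- The coefficient of the `i`-th vector in the `j`-th relation. -/
def Relations.coef (o : Relations p m) (j i : Fin m) : ZMod (p ^ 1) :=
  (o j).elim 0 fun t => if h : i < j then t ⟨i, h⟩ else 0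

/-- The number of relations. -/
def Relations.rk (o : Relations p m) : ℕ := (Finset.univ.filter fun j => (o j).isSome).card

/-- The family without relations. -/
def Relations.empty : Relations p m := fun _ => none

/-- The unipotent matrix with rows `e_j - ∑ t_i e_i`. -/
def Relations.U (o : Relations p m) : Matrix (Fin m) (Fin m) ℤ_[p] :=
  1 - Matrix.of fun j i => (((o.coef j i).val : ℕ) : ℤ_[p])

/-- The diagonal matrix with entry `p` at the relations, and `1` elsewhere. -/
def Relations.D (o : Relations p m) : Matrix (Fin m) (Fin m) ℤ_[p] :=
  Matrix.diagonal fun j => if (o j).isSome then (p : ℤ_[p]) else 1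

/-- The tuples of vectors satisfying the relations `o` modulo `p` are the multiples of this matrix.
-/
def Relations.G (o : Relations p m) : Matrix (Fin m) (Fin m) ℤ_[p] := (o.U)⁻¹ * o.D

/-- `v` satisfies the relations `o`. -/
def Relations.Holds {W : Type*} [AddCommGroup W] [Module (ZMod (p ^ 1)) W] (o : Relations p m)
    (v : Fin m → W) : Prop :=
  ∀ j, (o j).isSome → v j = ∑ i, o.coef j i • v i

lemma Relations.coef_eq_zero (o : Relations p m) {j i : Fin m} (h : ¬ i < j) : o.coef j i = 0 := by
  rw [Relations.coef]
  cases o j <;> simp [h]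

lemma Relations.det_U (o : Relations p m) : o.U.det = 1 := by
  rw [Matrix.det_of_isLowerTriangular]
  · refine Finset.prod_eq_one fun j _ => ?_
    simp [Relations.U, o.coef_eq_zero (lt_irrefl j)]
  · intro j i (hij : j < i)
    simp [Relations.U, o.coef_eq_zero hij.not_gt, Matrix.one_apply_ne hij.ne]

lemma Relations.U_mul_inv (o : Relations p m) : o.U * (o.U)⁻¹ = 1 :=
  Matrix.mul_nonsing_inv _ (by rw [o.det_U]; exact isUnit_one)

lemma Relations.inv_mul_U (o : Relations p m) : (o.U)⁻¹ * o.U = 1 :=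
  Matrix.nonsing_inv_mul _ (by rw [o.det_U]; exact isUnit_one)

lemma Relations.det_D (o : Relations p m) : o.D.det = (p : ℤ_[p]) ^ o.rk := by
  rw [Relations.D, Matrix.det_diagonal, Finset.prod_ite, Finset.prod_const, Finset.prod_const,
    one_pow, mul_one, Relations.rk]

lemma Relations.rk_eq_zero_iff (o : Relations p m) : o.rk = 0 ↔ o = Relations.empty := by
  rw [Relations.rk, Finset.card_eq_zero, Finset.filter_eq_empty_iff, funext_iff]
  simp [Relations.empty]

open scoped Classical in
/-- Inclusion-exclusion over systems of relations. -/
lemma ite_linearIndependent_eq_sum {W : Type*} [AddCommGroup W] [Module (ZMod (p ^ 1)) W]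
    (v : Fin m → W) :
    (if LinearIndependent (ZMod (p ^ 1)) v then (1 : ℤ) else 0) =
      ∑ o : Relations p m, (-1) ^ o.rk * if o.Holds v then 1 else 0 := by
  have key : ∀ (o : Relations p m) (j : Fin m) (t : {i : Fin m // i < j} → ZMod (p ^ 1)),
      o j = some t → ∑ i, o.coef j i • v i = ∑ i, t i • v i := fun o j t ht => by
    rw [← Fintype.sum_subtype_add_sum_subtype (· < j),
      Finset.sum_eq_zero (s := (Finset.univ : Finset {i // ¬ i < j}))
        (fun i _ => by rw [o.coef_eq_zero i.2, zero_smul]), add_zero]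
    exact Finset.sum_congr rfl fun i _ => by
      have hi := i.2
      simp [Relations.coef, ht, dif_pos hi]
  rw [ite_linearIndependent]
  have h1 : ∀ j : Fin m,
      (1 - ∑ t : {i : Fin m // i < j} → ZMod (p ^ 1), if v j = ∑ i, t i • v i then (1 : ℤ) else 0) =
      ∑ r : Option ({i : Fin m // i < j} → ZMod (p ^ 1)),
        r.elim 1 fun t => -if v j = ∑ i, t i • v i then (1 : ℤ) else 0 := fun j => by
    rw [Fintype.sum_option]
    simp [sub_eq_add_neg]
  rw [Finset.prod_congr rfl fun j _ => h1 j, Finset.prod_univ_sum, Fintype.piFinset_univ]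
  refine Finset.sum_congr rfl fun (o : Relations p m) _ => ?_
  rw [Relations.rk, ← Finset.prod_const, Finset.prod_filter]
  have h2 : (if o.Holds v then (1 : ℤ) else 0) =
      ∏ j, if (o j).isSome → v j = ∑ i, o.coef j i • v i then 1 else 0 := by
    by_cases h : o.Holds v
    · rw [if_pos h, Finset.prod_eq_one fun j _ => if_pos (h j)]
    · rw [if_neg h]
      rw [Relations.Holds] at h
      push Not at h
      obtain ⟨j, hj1, hj2⟩ := h
      exact (Finset.prod_eq_zero (Finset.mem_univ j) (if_neg (by tauto))).symm
  rw [h2, ← Finset.prod_mul_distrib]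
  refine Finset.prod_congr rfl fun j _ => ?_
  cases hj : o j with
  | none => simp
  | some t =>
    simp only [key o j t hj]
    split_ifs <;> simp_all

/-! ### Reduction modulo `p` -/

/-- Reduction `ℤ/pᴹ → ℤ/p`. -/
def red {M : ℕ} (hM : 1 ≤ M) : ZMod (p ^ M) →+* ZMod (p ^ 1) :=
  ZMod.castHom (pow_dvd_pow p hM) _

lemma red_toZModPow {M : ℕ} (hM : 1 ≤ M) (z : ℤ_[p]) :
    red hM (PadicInt.toZModPow M z) = PadicInt.toZModPow 1 z := by
  rw [← PadicInt.zmod_cast_comp_toZModPow 1 M hM]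
  rfl

lemma red_eq_zero_iff {M : ℕ} (hM : 1 ≤ M) (a : ZMod (p ^ M)) :
    red hM a = 0 ↔ ∃ b, a = (p : ZMod (p ^ M)) * b := by
  obtain ⟨z, rfl⟩ := toZModPow_surjective M a
  rw [red_toZModPow, toZModPow_eq_zero_iff, pow_one]
  constructor
  · rintro ⟨c, rfl⟩
    exact ⟨PadicInt.toZModPow M c, by rw [map_mul, map_natCast]⟩
  · rintro ⟨b, hb⟩
    obtain ⟨c, rfl⟩ := toZModPow_surjective M b
    rw [← map_natCast (PadicInt.toZModPow (p := p) M), ← map_mul, ← sub_eq_zero, ← map_sub,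
      toZModPow_eq_zero_iff] at hb
    have : (p : ℤ_[p]) ∣ z - p * c := (dvd_pow_self _ (by omega)).trans hb
    simpa using dvd_add this (dvd_mul_right _ c)

/-- Reduction of vectors modulo `p`. -/
def redHyp {M : ℕ} (hM : 1 ≤ M) (w : Hyp (p ^ M) k) : Hyp (p ^ 1) k :=
  (fun c => red hM (w.1 c), fun c => red hM (w.2 c))

lemma redHyp_tupleMul {M : ℕ} (hM : 1 ≤ M) (A : Matrix (Fin m) (Fin m) (ZMod (p ^ M)))
    (v : Fin m → Hyp (p ^ M) k) (j : Fin m) :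
    redHyp hM (tupleMul A v j) = tupleMul (A.map (red hM)) (fun i => redHyp hM (v i)) j := by
  ext c <;> simp [redHyp, tupleMul_apply, Prod.fst_sum, Prod.snd_sum, Finset.sum_apply]

lemma redHyp_eq_zero_iff {M : ℕ} (hM : 1 ≤ M) (w : Hyp (p ^ M) k) :
    redHyp hM w = 0 ↔ ∃ w', w = (p : ZMod (p ^ M)) • w' := by
  constructor
  · intro h
    have h1 : ∀ c, red hM (w.1 c) = 0 := fun c => congrFun (congrArg Prod.fst h) c
    have h2 : ∀ c, red hM (w.2 c) = 0 := fun c => congrFun (congrArg Prod.snd h) c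
    choose b hb using fun c => (red_eq_zero_iff hM _).mp (h1 c)
    choose b' hb' using fun c => (red_eq_zero_iff hM _).mp (h2 c)
    exact ⟨(b, b'), Prod.ext (funext hb) (funext hb')⟩
  · rintro ⟨w', rfl⟩
    ext c
    · exact (red_eq_zero_iff hM _).mpr ⟨_, rfl⟩
    · exact (red_eq_zero_iff hM _).mpr ⟨_, rfl⟩

lemma card_smul_eq_zero {M : ℕ} (hM : 1 ≤ M) :
    Nat.card {w : Hyp (p ^ M) k // (p : ZMod (p ^ M)) • w = 0} = p ^ (2 * k) := by
  have h0 : Nat.card {a : ZMod (p ^ M) // (p : ZMod (p ^ M)) * a = 0} = p := by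
    have := card_pow_mul_eq_zero (p := p) M 1
    simpa [min_eq_right hM] using this
  have e1 : {w : Hyp (p ^ M) k // (p : ZMod (p ^ M)) • w = 0} ≃
      (Fin k → {a : ZMod (p ^ M) // (p : ZMod (p ^ M)) * a = 0}) ×
      (Fin k → {a : ZMod (p ^ M) // (p : ZMod (p ^ M)) * a = 0}) :=
    { toFun := fun w => (fun c => ⟨w.1.1 c, congrFun (congrArg Prod.fst w.2) c⟩,
        fun c => ⟨w.1.2 c, congrFun (congrArg Prod.snd w.2) c⟩)
      invFun := fun w => ⟨(fun c => (w.1 c).1, fun c => (w.2 c).1),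
        Prod.ext (funext fun c => (w.1 c).2) (funext fun c => (w.2 c).2)⟩
      left_inv := fun w => rfl
      right_inv := fun w => rfl }
  rw [Nat.card_congr e1, Nat.card_prod, Nat.card_fun, Nat.card_fin, h0, ← pow_add, two_mul]

/-- Over `ℤ/pᴹ`, the relations say that the coordinates of `U v` at the relations are divisible by `p`. -/
lemma Relations.holds_iff {M : ℕ} (hM : 1 ≤ M) (o : Relations p m) (v : Fin m → Hyp (p ^ M) k) :
    o.Holds (fun i => redHyp hM (v i)) ↔
      ∀ j, (o j).isSome → redHyp hM (tupleMul (o.U.map (PadicInt.toZModPow M)) v j) = 0 := by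
  refine forall_congr' fun j => imp_congr_right fun _ => ?_
  have hU : (o.U.map (PadicInt.toZModPow M)).map (red hM) = 1 - Matrix.of o.coef := by
    ext a b
    simp only [Matrix.map_apply, red_toZModPow, Relations.U, Matrix.sub_apply, Matrix.of_apply,
      map_sub, map_natCast, ZMod.natCast_zmod_val]
    by_cases hab : a = b
    · subst hab; simp
    · simp [Matrix.one_apply_ne hab]
  rw [redHyp_tupleMul, hU, tupleMul_apply]
  simp only [Matrix.sub_apply, sub_smul, Finset.sum_sub_distrib, Matrix.of_apply, sub_eq_zero]
  simp [Matrix.one_apply]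

lemma Relations.exists_tupleMul_D_iff {M : ℕ} (hM : 1 ≤ M) (o : Relations p m)
    (u : Fin m → Hyp (p ^ M) k) :
    (∀ j, (o j).isSome → redHyp hM (u j) = 0) ↔
      ∃ v, tupleMul (o.D.map (PadicInt.toZModPow M)) v = u := by
  have hD : ∀ (v : Fin m → Hyp (p ^ M) k) j,
      tupleMul (o.D.map (PadicInt.toZModPow M)) v j =
        if (o j).isSome then (p : ZMod (p ^ M)) • v j else v j := fun v j => by
    rw [tupleMul_apply, Finset.sum_eq_single j]
    · by_cases h : (o j).isSome <;> simp [Relations.D, h]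
    · intro i _ hi
      simp [Relations.D, Matrix.diagonal_apply_ne _ hi.symm]
    · simp
  constructor
  · intro h
    choose! w hw using fun j hj => (redHyp_eq_zero_iff hM (u j)).mp (h j hj)
    refine ⟨fun j => if (o j).isSome then w j else u j, ?_⟩
    ext1 j
    rw [hD]
    by_cases hj : (o j).isSome
    · simp only [if_pos hj]
      exact (hw j hj).symm
    · simp only [if_neg hj]
  · rintro ⟨v, rfl⟩ j hj
    rw [hD, if_pos hj, redHyp_eq_zero_iff]
    exact ⟨_, rfl⟩

lemma Relations.card_tupleMul_D {M : ℕ} (hM : 1 ≤ M) (o : Relations p m) :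
    Nat.card {v : Fin m → Hyp (p ^ M) k // tupleMul (o.D.map (PadicInt.toZModPow M)) v = 0} =
      p ^ (2 * k * o.rk) := by
  have hD : ∀ (v : Fin m → Hyp (p ^ M) k),
      tupleMul (o.D.map (PadicInt.toZModPow M)) v = 0 ↔
        ∀ j, if (o j).isSome then (p : ZMod (p ^ M)) • v j = 0 else v j = 0 := fun v => by
    rw [funext_iff]
    refine forall_congr' fun j => ?_
    rw [tupleMul_apply, Finset.sum_eq_single j]
    · by_cases h : (o j).isSome <;> simp [Relations.D, h]
    · intro i _ hi
      simp [Relations.D, Matrix.diagonal_apply_ne _ hi.symm]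
    · simp
  rw [Nat.card_congr ((Equiv.subtypeEquivRight hD).trans (Equiv.subtypePiEquivPi
    (p := fun j w => if (o j).isSome then (p : ZMod (p ^ M)) • w = 0 else w = 0))), Nat.card_pi]
  have : ∀ j, Nat.card {w : Hyp (p ^ M) k //
      if (o j).isSome then (p : ZMod (p ^ M)) • w = 0 else w = 0} =
      if (o j).isSome then p ^ (2 * k) else 1 := fun j => by
    by_cases h : (o j).isSome
    · simp only [h, if_true]
      exact card_smul_eq_zero hM
    · simp [h]
  rw [Finset.prod_congr rfl fun j _ => this j, Finset.prod_ite, Finset.prod_const,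
    Finset.prod_const, one_pow, mul_one, ← pow_mul, Relations.rk]

open scoped Classical in
/-- Summing over the tuples `G v` is summing over the tuples satisfying the relations modulo `p`, each of
which is reached `p ^ (2 k rk)` times. -/
lemma Relations.sum_tupleMul_G {M : ℕ} (hM : 1 ≤ M) (o : Relations p m)
    (f : (Fin m → Hyp (p ^ M) k) → ℂ) :
    ∑ v, f (tupleMul (o.G.map (PadicInt.toZModPow M)) v) =
      (p : ℂ) ^ (2 * k * o.rk) * ∑ v, if o.Holds (fun i => redHyp hM (v i)) then f v else 0 := by
  set T := PadicInt.toZModPow (p := p) M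
  have hUU : (o.U.map T) * ((o.U)⁻¹.map T) = 1 := by
    rw [← Matrix.map_mul, o.U_mul_inv]; simp [T]
  have hUU' : ((o.U)⁻¹.map T) * (o.U.map T) = 1 := by
    rw [← Matrix.map_mul, o.inv_mul_U]; simp [T]
  let e : (Fin m → Hyp (p ^ M) k) ≃ (Fin m → Hyp (p ^ M) k) :=
    { toFun := tupleMul (o.U.map T)
      invFun := tupleMul ((o.U)⁻¹.map T)
      left_inv := fun v => by rw [← tupleMul_mul, hUU', tupleMul_one]
      right_inv := fun v => by rw [← tupleMul_mul, hUU, tupleMul_one] }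
  have h1 : ∀ v : Fin m → Hyp (p ^ M) k, tupleMul (o.G.map T) v =
      tupleMul ((o.U)⁻¹.map T) (tupleMul (o.D.map T) v) := fun v => by
    rw [← tupleMul_mul, ← Matrix.map_mul, Relations.G]
  simp only [h1]
  rw [sum_comp_addMonoidHom (tupleMul (o.D.map T)) _ (o.exists_tupleMul_D_iff hM)
    (fun u => f (tupleMul ((o.U)⁻¹.map T) u)), o.card_tupleMul_D hM, Nat.cast_pow]
  congr 1
  rw [← e.sum_comp]
  refine Finset.sum_congr rfl fun v _ => ?_
  rw [show tupleMul ((o.U)⁻¹.map T) (e v) = v from e.left_inv v]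
  exact if_congr (o.holds_iff hM v).symm rfl rfl

end

section

variable {p m k : ℕ} [hp : Fact p.Prime]

/-! ### The primitive weight -/

/-- The primitive weight `∑_o (-1)^{rk o} X ^ (2 rk o + e(R[G_o]))` of a class `R`, with
`R[G] = Gᵀ R G`. At `X = p⁻ᵏ` the power `X ^ e(R)` is a normalized Gauss sum over tuples of `m` vectors
in `k` hyperbolic planes; the primitive weight is the part of the sum over the tuples that are
linearly independent modulo `p`. -/
def wprim (x : SymQuot p m) : ℤ[X] :=
  ∑ o : Relations p m, Polynomial.C ((-1) ^ o.rk) * Polynomial.X ^ (2 * o.rk + expo (conjQ o.G x))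

open scoped Classical in
/-- At `X = p⁻ᵏ` the primitive weight is a Gauss sum over tuples that are linearly independent
modulo `p`. -/
lemma aeval_wprim {M : ℕ} (hM : 1 ≤ M) (A : Matrix (Fin m) (Fin m) ℤ_[p]) (hA : A.IsSymm) :
    Polynomial.aeval (((p : ℂ) ^ k)⁻¹) (wprim (frac M A hA)) =
      (((p : ℂ) ^ (2 * M * m * k))⁻¹) * ∑ v : Fin m → Hyp (p ^ M) k,
        if LinearIndependent (ZMod (p ^ 1)) (fun i => redHyp hM (v i)) then
          ZMod.stdAddChar (beta (A.map (PadicInt.toZModPow M)) v v) else 0 := by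
  set T := PadicInt.toZModPow (p := p) M
  have hpC : (p : ℂ) ≠ 0 := Nat.cast_ne_zero.mpr hp.out.ne_zero
  have hterm : ∀ o : Relations p m, ((p : ℂ) ^ k)⁻¹ ^ (2 * o.rk + expo (conjQ o.G (frac M A hA))) =
      (((p : ℂ) ^ (2 * M * m * k))⁻¹) * ∑ v : Fin m → Hyp (p ^ M) k,
        if o.Holds (fun i => redHyp hM (v i)) then ZMod.stdAddChar (beta (A.map T) v v) else 0 := by
    intro o
    have hs := isSymm_conj o.G hA
    have hS : ((o.G.transpose * A * o.G).map T).IsSymm := hs.map _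
    have hg := sum_stdAddChar_beta (k := k) _ hS
    have hmap : (o.G.transpose * A * o.G).map T =
        (o.G.map T).transpose * A.map T * o.G.map T := by
      rw [Matrix.map_mul, Matrix.map_mul, Matrix.transpose_map]
    simp only [hmap, ← beta_tupleMul] at hg
    rw [o.sum_tupleMul_G hM (fun v => ZMod.stdAddChar (beta (A.map T) v v)), ← hmap] at hg
    have hk : (kerCard M (o.G.transpose * A * o.G) : ℂ) *
        (p : ℂ) ^ expo (conjQ o.G (frac M A hA)) = (p : ℂ) ^ (M * m) := by
      rw [conjQ_frac]
      exact_mod_cast kerCard_mul_pow_expo M _ hs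
    change _ = _ * (kerCard M (o.G.transpose * A * o.G) : ℂ) ^ k at hg
    set W := ∑ v : Fin m → Hyp (p ^ M) k,
        if o.Holds (fun i => redHyp hM (v i)) then ZMod.stdAddChar (beta (A.map T) v v) else 0
    set e := expo (conjQ o.G (frac M A hA))
    set K : ℂ := (kerCard M (o.G.transpose * A * o.G) : ℂ)
    rw [inv_pow, inv_mul_eq_div, eq_div_iff (pow_ne_zero _ hpC), inv_mul_eq_div,
      div_eq_iff (pow_ne_zero _ (pow_ne_zero _ hpC))]
    have h3 : (p : ℂ) ^ (2 * k * o.rk) * (W * ((p : ℂ) ^ k) ^ (2 * o.rk + e)) =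
        (p : ℂ) ^ (2 * k * o.rk) * (p : ℂ) ^ (2 * M * m * k) := by
      calc (p : ℂ) ^ (2 * k * o.rk) * (W * ((p : ℂ) ^ k) ^ (2 * o.rk + e))
          = ((p : ℂ) ^ (2 * k * o.rk) * W) * ((p : ℂ) ^ k) ^ (2 * o.rk + e) := by ring
        _ = (p : ℂ) ^ (2 * k * o.rk) * ((p : ℂ) ^ (M * m * k)) * (K * (p : ℂ) ^ e) ^ k := by
            rw [hg]; push_cast; ring
        _ = _ := by rw [hk]; ring
    exact (mul_left_cancel₀ (pow_ne_zero _ hpC) h3).symm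
  have hli : ∀ v : Fin m → Hyp (p ^ M) k,
      (if LinearIndependent (ZMod (p ^ 1)) (fun i => redHyp hM (v i)) then
        (ZMod.stdAddChar (beta (A.map T) v v) : ℂ) else 0) =
      ∑ o : Relations p m, (-1) ^ o.rk *
        if o.Holds (fun i => redHyp hM (v i)) then ZMod.stdAddChar (beta (A.map T) v v) else 0 := by
    intro v
    have := congrArg (fun z : ℤ => (z : ℂ) * ZMod.stdAddChar (beta (A.map T) v v))
      (ite_linearIndependent_eq_sum (p := p) fun i => redHyp hM (v i))
    push_cast at this
    rw [Finset.sum_mul] at this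
    simp only [ite_mul, one_mul, zero_mul, mul_assoc] at this
    exact this
  simp only [hli]
  rw [Finset.sum_comm, wprim, map_sum, Finset.mul_sum]
  refine Finset.sum_congr rfl fun o _ => ?_
  rw [map_mul, Polynomial.aeval_X_pow, hterm, Polynomial.aeval_C, ← Finset.mul_sum]
  simp only [algebraMap_int_eq, map_pow, map_neg, map_one]
  ring

/-- Polynomial identities may be checked at the points `p⁻ᵏ`. -/
lemma eq_zero_of_aeval_inv_pow {P : ℤ[X]}
    (h : ∀ k : ℕ, Polynomial.aeval (((p : ℂ) ^ k)⁻¹) P = 0) : P = 0 := by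
  have hinj : Function.Injective (algebraMap ℤ ℂ) := RingHom.injective_int _
  apply Polynomial.map_injective _ hinj
  rw [Polynomial.map_zero]
  apply Polynomial.eq_zero_of_infinite_isRoot
  refine Set.infinite_of_injective_forall_mem (f := fun k : ℕ => ((p : ℂ) ^ k)⁻¹) ?_ fun k => ?_
  · intro a b hab
    have h1 : (p : ℂ) ^ a = (p : ℂ) ^ b := inv_injective hab
    have h2 : p ^ a = p ^ b := by exact_mod_cast h1
    exact Nat.pow_right_injective hp.out.two_le h2
  · change Polynomial.IsRoot _ _
    rw [Polynomial.IsRoot, Polynomial.eval_map_algebraMap]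
    exact h k

lemma redHyp_add_smul {M : ℕ} (hM : 1 ≤ M) (v δ : Hyp (p ^ M) k) {a : ℕ} (ha : 1 ≤ a) :
    redHyp hM (v + (p : ZMod (p ^ M)) ^ a • δ) = redHyp hM v := by
  have h0 : red hM ((p : ZMod (p ^ M)) ^ a) = 0 := by
    rw [red_eq_zero_iff]
    exact ⟨(p : ZMod (p ^ M)) ^ (a - 1), by rw [← pow_succ']; congr 1; omega⟩
  ext c <;> simp [redHyp, h0]

lemma pow_mul_eq_zero_iff_red {M : ℕ} (hM : 1 ≤ M) (a : ZMod (p ^ M)) :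
    (p : ZMod (p ^ M)) ^ (M - 1) * a = 0 ↔ red hM a = 0 := by
  obtain ⟨z, rfl⟩ := toZModPow_surjective M a
  rw [red_toZModPow, toZModPow_eq_zero_iff, pow_one, ← map_natCast (PadicInt.toZModPow (p := p) M),
    ← map_pow, ← map_mul, toZModPow_eq_zero_iff]
  have : (p : ℤ_[p]) ^ M = (p : ℤ_[p]) ^ (M - 1) * p := by
    rw [← pow_succ]; congr 1; omega
  rw [this, mul_dvd_mul_iff_left (pow_ne_zero _ (padicInt_p_ne_zero (p := p)))]

/-- The primitive weight vanishes off the `p`-torsion. Tuples that are linearly independent modulo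
`p` can be moved by multiples of `p ^ (M - 1)`, where `pᴹ` is the exact denominator of `x`; the
quadratic term of the phase vanishes for `M ≥ 2`, and the linear one is a nontrivial character. -/
lemma wprim_eq_zero {x : SymQuot p m} (hx : p • x ≠ 0) : wprim x = 0 := by
  classical
  obtain ⟨M₀, hM₀⟩ := exists_eq_frac_ge x
  have hex : ∃ M, (p ^ M) • x = 0 := ⟨M₀, (exists_eq_frac_iff M₀ x).mp (hM₀ M₀ le_rfl)⟩
  let M := Nat.find hex
  have hMx : (p ^ M) • x = 0 := Nat.find_spec hex
  have hmin : ∀ M' < M, (p ^ M') • x ≠ 0 := fun M' h => Nat.find_min hex h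
  have hM2 : 2 ≤ M := by
    by_contra hlt
    have : M = 0 ∨ M = 1 := by omega
    rcases this with h | h
    · rw [h, pow_zero, one_smul] at hMx
      exact hx (by rw [hMx, smul_zero])
    · rw [h, pow_one] at hMx
      exact hx hMx
  have hM : 1 ≤ M := by omega
  clear_value M
  obtain ⟨A, hA, rfl⟩ := (exists_eq_frac_iff M x).mpr hMx
  set T := PadicInt.toZModPow (p := p) M
  -- some entry of `A` is a unit, as the denominator `pᴹ` is exact
  obtain ⟨a, b, hab⟩ : ∃ a b, red hM (T (A a b)) ≠ 0 := by
    by_contra hcon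
    push Not at hcon
    apply hmin (M - 1) (by omega)
    rw [← exists_eq_frac_iff]
    have hd : ∀ i j, (p : ℤ_[p]) ∣ A i j := fun i j => by
      have := hcon i j
      rwa [red_toZModPow, toZModPow_eq_zero_iff, pow_one] at this
    choose B hB using hd
    have hBs : (Matrix.of B).IsSymm := Matrix.IsSymm.ext fun i j => by
      have := hA.apply i j
      rw [hB, hB i j] at this
      exact mul_left_cancel₀ (padicInt_p_ne_zero (p := p)) this
    refine ⟨Matrix.of B, hBs, ?_⟩
    rw [frac, frac]
    congr 1
    apply Subtype.ext
    ext i j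
    change ((p : ℚ_[p]) ^ M)⁻¹ * ((A i j : ℤ_[p]) : ℚ_[p]) = ((p : ℚ_[p]) ^ (M - 1))⁻¹ * (B i j : ℚ_[p])
    have hp0 := padic_p_ne_zero (p := p)
    rw [hB, show M = (M - 1) + 1 by omega, pow_succ]
    push_cast
    field_simp
  apply eq_zero_of_aeval_inv_pow (p := p)
  intro k
  rw [aeval_wprim hM]
  apply mul_eq_zero_of_right
  set S := A.map T
  set P := (p : ZMod (p ^ M)) ^ (M - 1) with hP
  have hPP : P * P = 0 := by
    rw [hP, ← pow_add, show M - 1 + (M - 1) = M + (M - 2) by omega, pow_add]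
    have : (p : ZMod (p ^ M)) ^ M = 0 := by
      rw [← Nat.cast_pow, ZMod.natCast_self]
    rw [this, zero_mul]
  let F : (Fin m → Hyp (p ^ M) k) → ℂ := fun v =>
    if LinearIndependent (ZMod (p ^ 1)) (fun i => redHyp hM (v i)) then
      ZMod.stdAddChar (beta S v v) else 0
  -- the change of the phase under `v ↦ v + P • δ` is linear in `δ`, since `P * P = 0`
  let L : (Fin m → Hyp (p ^ M) k) → (Fin m → Hyp (p ^ M) k) →+ ZMod (p ^ M) := fun v =>
    { toFun := fun δ => P * (beta S v δ + beta S δ v)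
      map_zero' := by simp [beta]
      map_add' := fun δ δ' => by rw [beta_add_left, beta_add_right]; ring }
  have hshift : ∀ v δ, F (v + P • δ) = F v * ZMod.stdAddChar (L v δ) := fun v δ => by
    have h1 : (fun i => redHyp hM ((v + P • δ) i)) = fun i => redHyp hM (v i) :=
      funext fun i => redHyp_add_smul hM _ _ (by omega)
    have h2 : beta S (v + P • δ) (v + P • δ) = beta S v v + L v δ := by
      change _ = _ + P * (beta S v δ + beta S δ v)
      rw [beta_add_left, beta_add_right, beta_add_right, beta_smul_left, beta_smul_right,
        beta_smul_left, beta_smul_right, ← mul_assoc, hPP]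
      ring
    simp only [F]
    rw [h1, h2]
    split_ifs
    · rw [AddChar.map_add_eq_mul]
    · rw [zero_mul]
  have hL : ∀ v : Fin m → Hyp (p ^ M) k,
      LinearIndependent (ZMod (p ^ 1)) (fun i => redHyp hM (v i)) → L v ≠ 0 := by
    intro v hv h0
    -- the combination of the `v i` with coefficients `A i b` vanishes modulo `p`
    have hSs : S.IsSymm := hA.map _
    have hcoord : ∀ c, red hM (∑ i, S i b * (v i).1 c) = 0 ∧ red hM (∑ i, S i b * (v i).2 c) = 0 := by
      intro c
      have e1 := DFunLike.congr_fun h0 (Pi.single b (0, Pi.single c 1))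
      have e2 := DFunLike.congr_fun h0 (Pi.single b (Pi.single c 1, 0))
      change P * (beta S v (Pi.single b (0, Pi.single c 1)) +
        beta S (Pi.single b (0, Pi.single c 1)) v) = 0 at e1
      change P * (beta S v (Pi.single b (Pi.single c 1, 0)) +
        beta S (Pi.single b (Pi.single c 1, 0)) v) = 0 at e2
      have f1 : beta S v (Pi.single b (0, Pi.single c 1)) = ∑ i, S i b * (v i).1 c := by
        refine Finset.sum_congr rfl fun i _ => ?_
        rw [Finset.sum_eq_single b]
        · simp
        · intro j _ hj; simp [hj]
        · simp
      have f2 : beta S (Pi.single b (0, Pi.single c 1)) v = 0 :=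
        Finset.sum_eq_zero fun i _ => Finset.sum_eq_zero fun j _ => by
          by_cases hi : i = b
          · subst hi; simp
          · simp [hi]
      have f3 : beta S v (Pi.single b (Pi.single c 1, 0)) = 0 :=
        Finset.sum_eq_zero fun i _ => Finset.sum_eq_zero fun j _ => by
          by_cases hi : j = b
          · subst hi; simp
          · simp [hi]
      have f4 : beta S (Pi.single b (Pi.single c 1, 0)) v = ∑ i, S i b * (v i).2 c := by
        rw [beta, Finset.sum_eq_single b]
        · refine Finset.sum_congr rfl fun i _ => ?_
          simp [hSs.apply]
        · intro j _ hj; simp [hj]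
        · simp
      rw [f1, f2, add_zero] at e1
      rw [f3, f4, zero_add] at e2
      exact ⟨(pow_mul_eq_zero_iff_red hM _).mp e1, (pow_mul_eq_zero_iff_red hM _).mp e2⟩
    have hzero : ∑ i, red hM (S i b) • redHyp hM (v i) = 0 := by
      ext c
      · have := (hcoord c).1
        simpa [redHyp, Prod.fst_sum] using this
      · have := (hcoord c).2
        simpa [redHyp, Prod.snd_sum] using this
    exact hab (Fintype.linearIndependent_iff.mp hv _ hzero a)
  have hsum : (Fintype.card (Fin m → Hyp (p ^ M) k) : ℂ) * ∑ v, F v = 0 := by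
    calc (Fintype.card (Fin m → Hyp (p ^ M) k) : ℂ) * ∑ v, F v
        = ∑ δ : Fin m → Hyp (p ^ M) k, ∑ v, F (v + P • δ) := by
          have : ∀ δ : Fin m → Hyp (p ^ M) k, ∑ v, F (v + P • δ) = ∑ v, F v := fun δ =>
            Equiv.sum_comp (Equiv.addRight (P • δ)) F
          simp only [this]
          rw [Finset.sum_const, nsmul_eq_mul, Finset.card_univ]
      _ = ∑ v, F v * ∑ δ, ZMod.stdAddChar (L v δ) := by
          rw [Finset.sum_comm]
          simp only [hshift, Finset.mul_sum]
      _ = 0 := by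
          refine Finset.sum_eq_zero fun v _ => ?_
          by_cases hv : LinearIndependent (ZMod (p ^ 1)) (fun i => redHyp hM (v i))
          · rw [sum_stdAddChar_comp, if_neg (hL v hv), mul_zero]
          · simp only [F]
            rw [if_neg hv, zero_mul]
  exact (mul_eq_zero.mp hsum).resolve_left (Nat.cast_ne_zero.mpr Fintype.card_ne_zero)

end

section

/-! ### Counting symmetric matrices -/

/-- A symmetric matrix is given by its entries on and above the diagonal. -/
lemma card_isSymm {m : ℕ} {T : Type*} (P : Fin m → Fin m → T → Prop)
    (hP : ∀ i j a, P i j a → P j i a) :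
    Nat.card {S : Matrix (Fin m) (Fin m) T // S.IsSymm ∧ ∀ i j, P i j (S i j)} =
      ∏ q : {q : Fin m × Fin m // q.1 ≤ q.2}, Nat.card {a // P q.1.1 q.1.2 a} := by
  rw [← Nat.card_pi]
  refine Nat.card_congr
    { toFun := fun S q => ⟨S.1 q.1.1 q.1.2, S.2.2 _ _⟩
      invFun := fun f => ⟨Matrix.of fun i j => if h : i ≤ j then (f ⟨(i, j), h⟩).1 else
          (f ⟨(j, i), (not_le.mp h).le⟩).1, ?_, ?_⟩
      left_inv := ?_
      right_inv := ?_ }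
  · refine Matrix.IsSymm.ext fun i j => ?_
    simp only [Matrix.of_apply]
    rcases lt_trichotomy i j with h | h | h
    · rw [dif_neg h.not_ge, dif_pos h.le]
    · subst h; rfl
    · rw [dif_pos h.le, dif_neg h.not_ge]
  · intro i j
    simp only [Matrix.of_apply]
    split_ifs with h
    · exact (f ⟨(i, j), h⟩).2
    · exact hP _ _ _ (f ⟨(j, i), (not_le.mp h).le⟩).2
  · intro S
    apply Subtype.ext
    ext i j
    simp only [Matrix.of_apply]
    split_ifs with h
    · rfl
    · exact S.2.1.apply i j
  · intro f
    ext1 q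
    apply Subtype.ext
    simp only [Matrix.of_apply]
    rw [dif_pos q.2]

lemma sum_pairs {m : ℕ} (e : Fin m → ℕ) :
    ∑ q : {q : Fin m × Fin m // q.1 ≤ q.2}, (e q.1.1 + e q.1.2) = (m + 1) * ∑ i, e i := by
  have h0 : ∑ q : {q : Fin m × Fin m // q.1 ≤ q.2}, (e q.1.1 + e q.1.2) =
      ∑ q ∈ Finset.univ.filter (fun q : Fin m × Fin m => q.1 ≤ q.2), (e q.1 + e q.2) :=
    (Finset.sum_subtype _ (fun q => by rw [Finset.mem_filter]; exact and_iff_right (Finset.mem_univ q))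
      (fun q : Fin m × Fin m => e q.1 + e q.2)).symm
  rw [h0, Finset.sum_filter, Fintype.sum_prod_type]
  have h1 : ∑ i, ∑ j, (if i ≤ j then e i + e j else 0) =
      ∑ i, ∑ j, (if i ≤ j then e i else 0) + ∑ i, ∑ j, (if i ≤ j then e j else 0) := by
    simp only [← Finset.sum_add_distrib]
    exact Finset.sum_congr rfl fun i _ => Finset.sum_congr rfl fun j _ => by split_ifs <;> simp
  change ∑ i, ∑ j, (if i ≤ j then e i + e j else 0) = _
  rw [h1, Finset.sum_comm (f := fun i j => if i ≤ j then e j else 0), ← Finset.sum_add_distrib,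
    Finset.mul_sum]
  refine Finset.sum_congr rfl fun i _ => ?_
  rw [← Finset.sum_add_distrib]
  have h2 : ∀ j, (if i ≤ j then e i else 0) + (if j ≤ i then e i else 0) =
      e i + if i = j then e i else 0 := fun j => by
    rcases lt_trichotomy i j with h | h | h
    · simp [h.le, h.not_ge, h.ne]
    · subst h; simp
    · simp [h.le, h.not_ge, h.ne']
  rw [Finset.sum_congr rfl fun j _ => h2 j, Finset.sum_add_distrib, Finset.sum_ite_eq]
  simp
  ring

variable {p m : ℕ} [hp : Fact p.Prime]

/-! ### Torsion in the group of classes -/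

/-- The class of `p⁻ᴹ S` for a symmetric matrix over `ℤ/pᴹ`. -/
def ofSym (M : ℕ) (S : {S : Matrix (Fin m) (Fin m) (ZMod (p ^ M)) // S.IsSymm}) : SymQuot p m :=
  frac M (S.1.map fun a => ((a.val : ℕ) : ℤ_[p])) (S.2.map _)

lemma map_map_val (M : ℕ) (S : Matrix (Fin m) (Fin m) (ZMod (p ^ M))) :
    (S.map fun a => ((a.val : ℕ) : ℤ_[p])).map (PadicInt.toZModPow M) = S := by
  ext i j
  simp

lemma ofSym_injective (M : ℕ) : Function.Injective (ofSym (p := p) (m := m) M) := by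
  intro S S' h
  rw [ofSym, ofSym, frac_eq_frac_iff, map_map_val, map_map_val] at h
  exact Subtype.ext h

lemma frac_eq_ofSym (M : ℕ) (A : Matrix (Fin m) (Fin m) ℤ_[p]) (hA : A.IsSymm) :
    frac M A hA = ofSym M ⟨A.map (PadicInt.toZModPow M), hA.map _⟩ := by
  rw [ofSym, frac_eq_frac_iff, map_map_val]

variable (p m) in
/-- The classes killed by `pᴹ`. -/
def tors (M : ℕ) : AddSubgroup (SymQuot p m) := (nsmulAddMonoidHom (p ^ M)).ker

lemma mem_tors {M : ℕ} {x : SymQuot p m} : x ∈ tors p m M ↔ (p ^ M) • x = 0 := Iff.rfl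

/-- Classes killed by `pᴹ` are symmetric matrices over `ℤ/pᴹ`. -/
def torsEquiv (M : ℕ) : {S : Matrix (Fin m) (Fin m) (ZMod (p ^ M)) // S.IsSymm} ≃ tors p m M :=
  Equiv.ofBijective (fun S => ⟨ofSym M S, (exists_eq_frac_iff M _).mp ⟨_, _, rfl⟩⟩) (by
    constructor
    · intro S S' h
      exact ofSym_injective M (congrArg Subtype.val h)
    · rintro ⟨x, hx⟩
      obtain ⟨A, hA, rfl⟩ := (exists_eq_frac_iff M x).mpr hx
      exact ⟨_, Subtype.ext (frac_eq_ofSym M A hA).symm⟩)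

lemma torsEquiv_coe (M : ℕ) (S : {S : Matrix (Fin m) (Fin m) (ZMod (p ^ M)) // S.IsSymm}) :
    (torsEquiv M S : SymQuot p m) = ofSym M S := rfl

instance (M : ℕ) : Finite (tors p m M) := by
  have : NeZero (p ^ M) := inferInstance
  exact Finite.of_equiv _ (torsEquiv M)

instance (M : ℕ) : Fintype (tors p m M) := Fintype.ofFinite _

lemma tors_mono {M N : ℕ} (h : M ≤ N) : tors p m M ≤ tors p m N := fun x hx => by
  obtain ⟨c, hc⟩ := pow_dvd_pow p h
  rw [mem_tors] at *
  rw [hc, mul_comm, mul_smul, hx, smul_zero]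

lemma mem_tors_of_expo_le {M : ℕ} {x : SymQuot p m} (h : expo x ≤ M) : x ∈ tors p m M :=
  tors_mono h (pow_expo_nsmul x)

end

section

variable {p m : ℕ} [hp : Fact p.Prime]

lemma sum_tors_extend {M N : ℕ} (h : M ≤ N) (F : SymQuot p m → ℂ)
    (hF : ∀ x, x ∉ tors p m M → F x = 0) :
    ∑ x : tors p m N, F x = ∑ x : tors p m M, F x := by
  classical
  symm
  refine Finset.sum_of_injOn (AddSubgroup.inclusion (tors_mono h))
    (AddSubgroup.inclusion_injective _).injOn (fun _ _ => Finset.mem_coe.mpr (Finset.mem_univ _))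
    (fun x _ hx => hF x fun hxM => hx ⟨⟨x.1, hxM⟩, Finset.mem_coe.mpr (Finset.mem_univ _), ?_⟩) fun x _ => ?_
  · exact Subtype.ext (AddSubgroup.coe_inclusion (tors_mono h) _)
  · rw [AddSubgroup.coe_inclusion]

open scoped Classical in
/-- The coefficients of the Siegel series as finite sums over torsion classes: a class with exponent
`j ≤ M` is killed by `pᴹ`. -/
lemma coeff_siegelSeries (h : Matrix (Fin m) (Fin m) ℤ_[p]) {j M : ℕ} (hj : j ≤ M) :
    PowerSeries.coeff j (siegelSeries h) =
      ∑ x : tors p m M, if expo x.1 = j then pair h x else 0 := by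
  rw [siegelSeries, PowerSeries.coeff_mk]
  have h1 : ∀ x : SymQuot p m, (∑ᶠ (_ : HasExponent x j),
      addChar p (h.map (algebraMap ℤ_[p] ℚ_[p]) * (Quotient.out x).1).trace) =
      if expo x = j then pair h x else 0 := fun x => by
    rw [finsum_eq_if]
    exact if_congr (hasExponent_iff x j) rfl rfl
  rw [finsum_congr h1]
  have hfin : (tors p m M : Set (SymQuot p m)).Finite := inferInstanceAs (Finite (tors p m M))
  rw [finsum_eq_sum_of_support_subset (s := hfin.toFinset)]
  · exact Finset.sum_subtype _ (by simp) _
  · intro x hx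
    rw [Function.mem_support] at hx
    have : expo x = j := by
      by_contra hne
      exact hx (if_neg hne)
    rw [Set.Finite.coe_toFinset]
    exact mem_tors_of_expo_le (this.trans_le hj)

/-! ### Change of variables -/

lemma conjQ_mem_tors {M : ℕ} (G : Matrix (Fin m) (Fin m) ℤ_[p]) {x : SymQuot p m}
    (hx : x ∈ tors p m M) : conjQ G x ∈ tors p m M := by
  rw [mem_tors] at *
  rw [← map_nsmul, hx, map_zero]

/-- `R ↦ Gᵀ R G` on the classes killed by `pᴹ`. -/
def conjTors (M : ℕ) (G : Matrix (Fin m) (Fin m) ℤ_[p]) : tors p m M →+ tors p m M :=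
  ((conjQ G).comp (tors p m M).subtype).codRestrict _ fun x => conjQ_mem_tors G x.2

lemma conjTors_coe (M : ℕ) (G : Matrix (Fin m) (Fin m) ℤ_[p]) (x : tors p m M) :
    (conjTors M G x : SymQuot p m) = conjQ G x := rfl

lemma conjQ_smul_one (c : ℤ_[p]) (x : SymQuot p m) {q : ℕ} (hq : (q : ℤ_[p]) = c * c) :
    conjQ (c • 1) x = q • x := by
  obtain ⟨R, rfl⟩ := QuotientAddGroup.mk_surjective x
  rw [conjQ, QuotientAddGroup.map_mk, ← QuotientAddGroup.mk_nsmul]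
  congr 1
  apply Subtype.ext
  ext i j
  have hq' : (q : ℚ_[p]) = (c : ℚ_[p]) * c := by
    have := congrArg (fun z : ℤ_[p] => (z : ℚ_[p])) hq
    simpa using this
  have hc : (c • (1 : Matrix (Fin m) (Fin m) ℤ_[p])).map (algebraMap ℤ_[p] ℚ_[p]) =
      (c : ℚ_[p]) • (1 : Matrix (Fin m) (Fin m) ℚ_[p]) := by
    ext i j
    change ((c * (1 : Matrix (Fin m) (Fin m) ℤ_[p]) i j : ℤ_[p]) : ℚ_[p]) =
      (c : ℚ_[p]) * (1 : Matrix (Fin m) (Fin m) ℚ_[p]) i j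
    by_cases hij : i = j
    · subst hij; simp
    · simp [Matrix.one_apply_ne hij]
  change (((c • (1 : Matrix (Fin m) (Fin m) ℤ_[p])).map (algebraMap ℤ_[p] ℚ_[p])).transpose * R.1 *
    (c • (1 : Matrix (Fin m) (Fin m) ℤ_[p])).map (algebraMap ℤ_[p] ℚ_[p])) i j = (q • R.1) i j
  rw [hc, Matrix.smul_apply, nsmul_eq_mul, hq']
  simp
  ring

/-- The diagonal matrix complementary to `D`, that is, `coD * D = p`. -/
def Relations.coD (o : Relations p m) : Matrix (Fin m) (Fin m) ℤ_[p] :=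
  Matrix.diagonal fun j => if (o j).isSome then 1 else (p : ℤ_[p])

lemma Relations.D_mul_coD (o : Relations p m) : o.D * o.coD = (p : ℤ_[p]) • 1 := by
  rw [Relations.D, Relations.coD, Matrix.diagonal_mul_diagonal, Matrix.smul_one_eq_diagonal]
  congr 1
  ext1 j
  split_ifs <;> simp

lemma Relations.coD_mul_D (o : Relations p m) : o.coD * o.D = (p : ℤ_[p]) • 1 := by
  rw [Relations.D, Relations.coD, Matrix.diagonal_mul_diagonal, Matrix.smul_one_eq_diagonal]
  congr 1
  ext1 j
  split_ifs <;> simp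

lemma Relations.transpose_D (o : Relations p m) : o.D.transpose = o.D :=
  Matrix.diagonal_transpose _

lemma conjQ_p (x : SymQuot p m) : conjQ ((p : ℤ_[p]) • 1) x = (p ^ 2) • x :=
  conjQ_smul_one _ x (by push_cast; ring)

lemma Relations.mem_tors_of_conjQ_D (o : Relations p m) {M : ℕ} {x : SymQuot p m}
    (h : conjQ o.D x ∈ tors p m M) : x ∈ tors p m (M + 2) := by
  rw [mem_tors, pow_add, mul_smul, ← conjQ_p, ← o.D_mul_coD, conjQ_mul, ← map_nsmul, mem_tors.mp h,
    map_zero]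

lemma smul_frac_surj (x : SymQuot p m) {M : ℕ} (hx : x ∈ tors p m M) :
    ∃ y ∈ tors p m (M + 2), (p ^ 2) • y = x := by
  obtain ⟨A, hA, rfl⟩ := (exists_eq_frac_iff M x).mpr hx
  refine ⟨frac (M + 2) A hA, (exists_eq_frac_iff _ _).mp ⟨A, hA, rfl⟩, ?_⟩
  rw [frac, frac, ← QuotientAddGroup.mk_nsmul]
  congr 1
  apply Subtype.ext
  ext i j
  change ((p ^ 2) • (((p : ℚ_[p]) ^ (M + 2))⁻¹ • A.map (algebraMap ℤ_[p] ℚ_[p]))) i j =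
    ((p : ℚ_[p]) ^ M)⁻¹ * (A i j : ℚ_[p])
  rw [Matrix.smul_apply, nsmul_eq_mul]
  change _ * (((p : ℚ_[p]) ^ (M + 2))⁻¹ * (A i j : ℚ_[p])) = _
  have hp0 := padic_p_ne_zero (p := p)
  push_cast
  rw [pow_add]
  field_simp

lemma Relations.exists_conjQ_D (o : Relations p m) {M : ℕ} {x : SymQuot p m}
    (hx : x ∈ tors p m M) : ∃ y ∈ tors p m (M + 2), conjQ o.D y = x := by
  obtain ⟨y, hy, rfl⟩ := smul_frac_surj x hx
  refine ⟨conjQ o.coD y, conjQ_mem_tors _ hy, ?_⟩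
  rw [← conjQ_mul, o.coD_mul_D, conjQ_p]

lemma Relations.D_mul_mul_D (o : Relations p m) {R : Type*} [CommRing R] (f : ℤ_[p] →+* R)
    (S : Matrix (Fin m) (Fin m) R) (i j : Fin m) :
    (o.D.map f * S * o.D.map f) i j =
      f p ^ ((if (o i).isSome then 1 else 0) + if (o j).isSome then 1 else 0) * S i j := by
  rw [Relations.D, Matrix.diagonal_map (map_zero f), Matrix.mul_diagonal, Matrix.diagonal_mul,
    pow_add]
  split_ifs <;> simp <;> ring

end

section

variable {p m : ℕ} [hp : Fact p.Prime]

/-- The kernel of `R ↦ D R D`: the conditions on the entries of a symmetric matrix over `ℤ/p²` are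
independent. The order does not depend on `M ≥ 2` because `D` divides `p`. -/
lemma Relations.card_ker_D (o : Relations p m) {M : ℕ} (hM : 2 ≤ M) :
    Nat.card {x : tors p m M // conjTors M o.D x = 0} = p ^ ((m + 1) * o.rk) := by
  let e : Fin m → ℕ := fun i => if (o i).isSome then 1 else 0
  have hker : ∀ x : tors p m M, conjTors M o.D x = 0 ↔ conjQ o.D x.1 = 0 := fun x => by
    rw [← conjTors_coe, ← ZeroMemClass.coe_zero (tors p m M), Subtype.coe_inj]
  have h2 : ∀ x : SymQuot p m, conjQ o.D x = 0 → x ∈ tors p m 2 := fun x hx =>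
    o.mem_tors_of_conjQ_D (M := 0) (by rw [hx]; exact (tors p m 0).zero_mem)
  have e1 : {x : tors p m M // conjTors M o.D x = 0} ≃ {x : tors p m 2 // conjQ o.D x.1 = 0} :=
    ((Equiv.subtypeEquivRight hker).trans (Equiv.subtypeSubtypeEquivSubtype
      (p := fun x => x ∈ tors p m M) (q := fun x => conjQ o.D x = 0)
      fun {x} hx => tors_mono hM (h2 x hx))).trans (Equiv.subtypeSubtypeEquivSubtype
      (p := fun x => x ∈ tors p m 2) (q := fun x => conjQ o.D x = 0) fun {x} hx => h2 x hx).symm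
  have e2 : {x : tors p m 2 // conjQ o.D x = 0} ≃
      {S : Matrix (Fin m) (Fin m) (ZMod (p ^ 2)) //
        S.IsSymm ∧ ∀ i j, (p : ZMod (p ^ 2)) ^ (e i + e j) * S i j = 0} := by
    refine ((torsEquiv 2).symm.subtypeEquiv (q := fun S => ∀ i j,
      (p : ZMod (p ^ 2)) ^ (e i + e j) * S.1 i j = 0) fun x => ?_).trans
      (Equiv.subtypeSubtypeEquivSubtypeInter _ fun S : Matrix (Fin m) (Fin m) (ZMod (p ^ 2)) =>
        ∀ i j, (p : ZMod (p ^ 2)) ^ (e i + e j) * S i j = 0)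
    obtain ⟨S, rfl⟩ := (torsEquiv 2).surjective x
    rw [Equiv.symm_apply_apply, torsEquiv_coe, ofSym, conjQ_frac]
    have h0 : (0 : SymQuot p m) = frac 2 0 Matrix.isSymm_zero := (frac_zero 2).symm
    rw [h0, frac_eq_frac_iff, Matrix.map_mul, Matrix.map_mul, map_map_val, o.transpose_D,
      Matrix.map_zero _ (map_zero _), ← Matrix.ext_iff]
    refine forall_congr' fun i => forall_congr' fun j => ?_
    rw [o.D_mul_mul_D, map_natCast]
    rfl
  rw [Nat.card_congr (e1.trans e2), card_isSymm (fun i j a => (p : ZMod (p ^ 2)) ^ (e i + e j) * a = 0)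
    (fun i j a h => by rwa [add_comm (e j)])]
  have he : ∀ i, e i ≤ 1 := fun i => by simp only [e]; split_ifs <;> simp
  have h1 : ∀ q : {q : Fin m × Fin m // q.1 ≤ q.2},
      Nat.card {a : ZMod (p ^ 2) // (p : ZMod (p ^ 2)) ^ (e q.1.1 + e q.1.2) * a = 0} =
      p ^ (e q.1.1 + e q.1.2) := fun q => by
    rw [card_pow_mul_eq_zero, min_eq_right]
    have := he q.1.1
    have := he q.1.2
    omega
  rw [Finset.prod_congr rfl fun q _ => h1 q, Finset.prod_pow_eq_pow_sum, sum_pairs]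
  congr 2
  simp only [e, Relations.rk, Finset.card_filter]

end

section

variable {p m : ℕ} [hp : Fact p.Prime]

/-- If `h` is not of the form `D h' D`, the character of `h` is nontrivial on the kernel of
`R ↦ D R D`. -/
lemma Relations.exists_pair_ne_one (o : Relations p m) (hp2 : p ≠ 2)
    {h : Matrix (Fin m) (Fin m) ℤ_[p]} (hh : h.IsSymm)
    (hno : ¬ ∃ h' : Matrix (Fin m) (Fin m) ℤ_[p], h = o.D * h' * o.D) :
    ∃ κ ∈ tors p m 2, conjQ o.D κ = 0 ∧ pair h κ ≠ 1 := by
  let e : Fin m → ℕ := fun i => if (o i).isSome then 1 else 0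
  have he : ∀ i, e i ≤ 1 := fun i => by simp only [e]; split_ifs <;> simp
  have hent : ∀ (S : Matrix (Fin m) (Fin m) ℤ_[p]) i j,
      (o.D * S * o.D) i j = (p : ℤ_[p]) ^ (e i + e j) * S i j := fun S i j => by
    have := o.D_mul_mul_D (RingHom.id _) S i j
    simpa using this
  obtain ⟨a, b, hab⟩ : ∃ a b, ¬ (p : ℤ_[p]) ^ (e a + e b) ∣ h a b := by
    by_contra hcon
    push Not at hcon
    choose h' hh' using hcon
    exact hno ⟨Matrix.of h', by ext i j; rw [hent]; exact hh' i j⟩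
  -- `κ` is supported on the entries `(a, b)` and `(b, a)`; `tr(hκ) = 2 h a b / p ^ (e a + e b)`
  set c : ℤ_[p] := (p : ℤ_[p]) ^ (2 - (e a + e b)) with hc
  let E : Matrix (Fin m) (Fin m) ℤ_[p] := Matrix.single a b c + Matrix.single b a c
  have hE : E.IsSymm := by
    rw [Matrix.IsSymm, Matrix.transpose_add, Matrix.transpose_single, Matrix.transpose_single,
      add_comm]
  have hcp : (p : ℤ_[p]) ^ (e a + e b) * c = (p : ℤ_[p]) ^ 2 := by
    rw [hc, ← pow_add]
    congr 1
    have := he a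
    have := he b
    omega
  refine ⟨frac 2 E hE, (exists_eq_frac_iff _ _).mp ⟨E, hE, rfl⟩, ?_, ?_⟩
  · have h0 : (0 : SymQuot p m) = frac 2 0 Matrix.isSymm_zero := (frac_zero 2).symm
    rw [conjQ_frac, h0, frac_eq_frac_iff]
    ext i j
    rw [Matrix.map_apply, o.transpose_D, hent, Matrix.map_apply, Matrix.zero_apply, map_zero,
      toZModPow_eq_zero_iff]
    simp only [E, Matrix.add_apply, mul_add]
    refine dvd_add ?_ ?_
    · by_cases hij : a = i ∧ b = j
      · obtain ⟨rfl, rfl⟩ := hij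
        rw [Matrix.single_apply_same, hcp]
      · rw [Matrix.single_apply_of_ne _ _ _ _ _ hij, mul_zero]
        exact dvd_zero _
    · by_cases hij : b = i ∧ a = j
      · obtain ⟨rfl, rfl⟩ := hij
        rw [Matrix.single_apply_same, add_comm, hcp]
      · rw [Matrix.single_apply_of_ne _ _ _ _ _ hij, mul_zero]
        exact dvd_zero _
  · rw [pair_frac, ne_eq, ← AddChar.map_zero_eq_one (ZMod.stdAddChar (N := p ^ 2)),
      ZMod.injective_stdAddChar.eq_iff, toZModPow_eq_zero_iff]
    have htr : (h * E).trace = c * (2 * h a b) := by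
      simp only [E, mul_add, Matrix.trace_add, Matrix.trace_mul_single]
      rw [hh.apply]
      simp
      ring
    rw [htr, ← hcp, mul_comm, mul_dvd_mul_iff_left (by rw [hc]; exact pow_ne_zero _ padicInt_p_ne_zero)]
    intro hdvd
    have h2 : IsUnit (2 : ℤ_[p]) := by
      have : ((2 : ℕ) : ℤ_[p]) = 2 := by norm_num
      rw [← this, PadicInt.isUnit_iff]
      by_contra hne
      have hlt : ‖((2 : ℕ) : ℤ_[p])‖ < 1 := lt_of_le_of_ne (PadicInt.norm_le_one _) hne
      have := (PadicInt.norm_int_lt_one_iff_dvd (p := p) 2).mp (by exact_mod_cast hlt)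
      have h3 : p ∣ 2 := by exact_mod_cast this
      exact hp2 ((Nat.prime_dvd_prime_iff_eq hp.out Nat.prime_two).mp h3)
    exact hab ((h2.dvd_mul_left).mp hdvd)

end

section

variable {p m : ℕ} [hp : Fact p.Prime]

/-! ### Recursion for the Siegel series -/

open scoped Classical in
/-- The Siegel series of `D⁻¹ U h Uᵀ D⁻¹` if this matrix is integral, and `0` otherwise. -/
def Relations.siegel (o : Relations p m) (h : Matrix (Fin m) (Fin m) ℤ_[p]) : ℂ⟦X⟧ :=
  if H : ∃ h' : Matrix (Fin m) (Fin m) ℤ_[p], o.U * h * o.U.transpose = o.D * h' * o.D then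
    siegelSeries H.choose
  else 0

lemma conjQ_U_inv (o : Relations p m) (x : SymQuot p m) : conjQ o.U (conjQ (o.U)⁻¹ x) = x := by
  rw [← conjQ_mul, o.inv_mul_U, conjQ_one]

lemma conjQ_inv_U (o : Relations p m) (x : SymQuot p m) : conjQ (o.U)⁻¹ (conjQ o.U x) = x := by
  rw [← conjQ_mul, o.U_mul_inv, conjQ_one]

open scoped Classical in
/-- The part of the Siegel series of `h` weighted by `e(R[D])`: summing over the fibres of
`R ↦ D R D` gives `p ^ ((m + 1) rk)` times a Siegel series or zero. -/
lemma Relations.sum_expo_conjQ_D (o : Relations p m) (hp2 : p ≠ 2)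
    {h : Matrix (Fin m) (Fin m) ℤ_[p]} (hh : h.IsSymm) {j M : ℕ} (hM : j + 2 ≤ M) :
    (∑ y : tors p m M, if expo (conjQ o.D y.1) = j then pair h y.1 else 0) =
      (p : ℂ) ^ ((m + 1) * o.rk) * PowerSeries.coeff j
        (if H : ∃ h' : Matrix (Fin m) (Fin m) ℤ_[p], h = o.D * h' * o.D then
          siegelSeries H.choose else 0) := by
  by_cases H : ∃ h' : Matrix (Fin m) (Fin m) ℤ_[p], h = o.D * h' * o.D
  · rw [dif_pos H]
    obtain ⟨h', hh', hdef⟩ : ∃ h', h = o.D * h' * o.D ∧ H.choose = h' := ⟨_, H.choose_spec, rfl⟩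
    rw [hdef, coeff_siegelSeries h' (show j ≤ M by omega)]
    have hpair : ∀ y : SymQuot p m, pair h y = pair h' (conjQ o.D y) := fun y => by
      rw [pair_conjQ, o.transpose_D, ← hh']
    -- `pair h y` depends only on `D y D`, and every class with exponent `j` has the form `D y D`
    let F : tors p m M → ℂ := fun z => if expo z.1 = j then pair h' z.1 else 0
    have h1 := sum_comp_addMonoidHom (conjTors M o.D) (fun z => ∃ y, conjTors M o.D y = z)
      (fun _ => Iff.rfl) F
    rw [o.card_ker_D (by omega), Nat.cast_pow] at h1
    simp only [hpair]
    refine Eq.trans ?_ (h1.trans ?_)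
    · refine Finset.sum_congr rfl fun y _ => ?_
      simp only [F, conjTors_coe]
      exact if_congr Iff.rfl rfl rfl
    · congr 1
      refine Finset.sum_congr rfl fun z _ => ?_
      by_cases hz : expo z.1 = j
      · obtain ⟨y, hy, hyz⟩ := o.exists_conjQ_D (mem_tors_of_expo_le hz.le)
        have : ∃ y, conjTors M o.D y = z :=
          ⟨⟨y, tors_mono hM hy⟩, Subtype.ext (by rw [conjTors_coe]; exact hyz)⟩
        rw [if_pos this]
      · simp only [F, if_neg hz, ite_self]
  · rw [dif_neg H, map_zero, mul_zero]
    obtain ⟨κ, hκ, hκ0, hκ1⟩ := o.exists_pair_ne_one hp2 hh H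
    -- translation by an element of the kernel with nontrivial character annihilates the sum
    let κ' : tors p m M := ⟨κ, tors_mono (by omega) hκ⟩
    set S := ∑ y : tors p m M, if expo (conjQ o.D y.1) = j then pair h y.1 else 0 with hS
    have h1 : S = pair h κ * S := by
      conv_lhs => rw [hS, ← Equiv.sum_comp (Equiv.addLeft κ')]
      rw [hS, Finset.mul_sum]
      refine Finset.sum_congr rfl fun y _ => ?_
      have : (Equiv.addLeft κ' y).1 = κ + y.1 := AddSubgroup.coe_add _ _ _
      rw [this, map_add, hκ0, zero_add, pair_add, mul_ite, mul_zero]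
    have h2 : (pair h κ - 1) * S = 0 := by linear_combination -h1
    exact (mul_eq_zero.mp h2).resolve_left (sub_ne_zero.mpr hκ1)

open scoped Classical in
/-- The part of the Siegel series of `h` weighted by `e(R[G])`, after the unipotent substitution
`R ↦ Uᵀ R U`. -/
lemma Relations.sum_expo_conjQ_G (o : Relations p m) (hp2 : p ≠ 2)
    {h : Matrix (Fin m) (Fin m) ℤ_[p]} (hh : h.IsSymm) {j M : ℕ} (hM : j + 2 ≤ M) :
    (∑ x : tors p m M, if expo (conjQ o.G x.1) = j then pair h x.1 else 0) =
      (p : ℂ) ^ ((m + 1) * o.rk) * PowerSeries.coeff j (o.siegel h) := by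
  have hs : (o.U * h * o.U.transpose).IsSymm := by
    simp [Matrix.IsSymm, Matrix.transpose_mul, hh.eq, Matrix.mul_assoc]
  rw [Relations.siegel, ← o.sum_expo_conjQ_D hp2 hs hM]
  let e : tors p m M ≃ tors p m M :=
    { toFun := conjTors M o.U
      invFun := conjTors M (o.U)⁻¹
      left_inv := fun x => Subtype.ext (by rw [conjTors_coe, conjTors_coe, conjQ_inv_U])
      right_inv := fun x => Subtype.ext (by rw [conjTors_coe, conjTors_coe, conjQ_U_inv]) }
  rw [← e.sum_comp]
  refine Finset.sum_congr rfl fun x _ => ?_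
  have h1 : (e x).1 = conjQ o.U x.1 := conjTors_coe M o.U x
  rw [h1, pair_conjQ, ← conjQ_mul, Relations.G, ← Matrix.mul_assoc, o.U_mul_inv, Matrix.one_mul]

/-- The primitive part of the Siegel series of `h`: the series `∑_R wprim(R) e^{2πi tr(hR)}`. The sum is
taken over the `p`-torsion classes only, as the primitive weight of the others is zero
(`wprim_eq_zero`); so the primitive part is a polynomial. -/
def bprim (h : Matrix (Fin m) (Fin m) ℤ_[p]) : ℂ[X] :=
  ∑ x : tors p m 1, Polynomial.C (pair h x.1) * (wprim x.1).map (Int.castRingHom ℂ)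

/-- The primitive part is an alternating sum of Siegel series of the forms induced by `h` on
overlattices, the one for the trivial overlattice being the Siegel series of `h`. -/
theorem bprim_eq_sum (hp2 : p ≠ 2) {h : Matrix (Fin m) (Fin m) ℤ_[p]} (hh : h.IsSymm) :
    ((bprim h : ℂ[X]) : ℂ⟦X⟧) = ∑ o : Relations p m,
      PowerSeries.C ((-1) ^ o.rk * (p : ℂ) ^ ((m + 1) * o.rk)) * PowerSeries.X ^ (2 * o.rk) *
        o.siegel h := by
  classical
  ext j
  have h1 : PowerSeries.coeff j ((bprim h : ℂ[X]) : ℂ⟦X⟧) =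
      ∑ x : tors p m (j + 2), pair h x.1 * (((wprim x.1).coeff j : ℤ) : ℂ) := by
    rw [sum_tors_extend (show 1 ≤ j + 2 by omega)
      (fun x => pair h x * (((wprim x).coeff j : ℤ) : ℂ)) (fun x hx => by
        rw [wprim_eq_zero (fun h0 => hx (by rw [mem_tors, pow_one]; exact h0))]; simp)]
    simp [bprim]
  have h2 : ∀ x : SymQuot p m, (((wprim x).coeff j : ℤ) : ℂ) =
      ∑ o : Relations p m, (-1) ^ o.rk * if 2 * o.rk + expo (conjQ o.G x) = j then 1 else 0 := by
    intro x
    rw [wprim, Polynomial.finsetSum_coeff]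
    push_cast
    refine Finset.sum_congr rfl fun o _ => ?_
    rw [Polynomial.coeff_C_mul, Polynomial.coeff_X_pow]
    push_cast
    congr 1
    exact if_congr eq_comm rfl rfl
  rw [h1, map_sum]
  simp only [h2, Finset.mul_sum]
  rw [Finset.sum_comm]
  refine Finset.sum_congr rfl fun o _ => ?_
  rw [mul_assoc, PowerSeries.coeff_C_mul, PowerSeries.coeff_X_pow_mul']
  split_ifs with hle
  · rw [mul_assoc, ← o.sum_expo_conjQ_G hp2 hh (show j - 2 * o.rk + 2 ≤ j + 2 by omega),
      Finset.mul_sum]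
    refine Finset.sum_congr rfl fun x _ => ?_
    by_cases hx : expo (conjQ o.G x.1) = j - 2 * o.rk
    · rw [if_pos hx, if_pos (by omega)]; ring
    · rw [if_neg hx, if_neg (by omega)]; ring
  · rw [mul_zero]
    refine Finset.sum_eq_zero fun x _ => ?_
    rw [if_neg (by omega), mul_zero, mul_zero]

end

section

/-! ### Gauss sums over the prime field -/

lemma addChar_sum_eq_prod {A R ι : Type*} [AddCommMonoid A] [CommRing R] (ψ : AddChar A R)
    (s : Finset ι) (f : ι → A) : ψ (∑ i ∈ s, f i) = ∏ i ∈ s, ψ (f i) := by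
  classical
  induction s using Finset.induction_on with
  | empty => simp
  | insert a s ha ih =>
    rw [Finset.sum_insert ha, Finset.prod_insert ha, AddChar.map_add_eq_mul, ih]

variable {q k : ℕ} [hq : Fact q.Prime]

/-- The hyperbolic quadratic form. -/
def hQ (w : Hyp q k) : ZMod q := w.1 ⬝ᵥ w.2

/-- The polar form of the hyperbolic quadratic form. -/
def hB (w w' : Hyp q k) : ZMod q := w.1 ⬝ᵥ w'.2 + w'.1 ⬝ᵥ w.2

lemma hB_self (w : Hyp q k) : hB w w = 2 * hQ w := by rw [hB, hQ, two_mul]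

lemma hB_comm (w w' : Hyp q k) : hB w w' = hB w' w := by rw [hB, hB, add_comm]

/-- `hB w` as a linear map. -/
def hBlin (w : Hyp q k) : Hyp q k →ₗ[ZMod q] ZMod q where
  toFun := hB w
  map_add' a b := by simp [hB]; ring
  map_smul' c a := by simp [hB]; ring

lemma hB_sum_right {ι : Type*} [Fintype ι] (w : Hyp q k) (t : ι → ZMod q) (v : ι → Hyp q k) :
    hB w (∑ b, t b • v b) = ∑ b, t b * hB w (v b) := by
  change hBlin w _ = _
  rw [map_sum]
  exact Finset.sum_congr rfl fun b _ => by rw [map_smul]; rfl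

lemma hQ_add_smul (w z : Hyp q k) {a : ZMod q} (ha : a ≠ 0) :
    a * hQ (w + a⁻¹ • z) = a * hQ w + hB w z + a⁻¹ * hQ z := by
  simp only [hQ, hB, Prod.fst_add, Prod.snd_add, Prod.smul_fst, Prod.smul_snd, add_dotProduct,
    dotProduct_add, smul_dotProduct, dotProduct_smul, smul_eq_mul]
  field_simp
  ring

lemma two_ne_zero_zmod (hq2 : q ≠ 2) : (2 : ZMod q) ≠ 0 := by
  intro h
  have h' : ((2 : ℕ) : ZMod q) = 0 := by exact_mod_cast h
  rw [ZMod.natCast_eq_zero_iff] at h'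
  exact hq2 ((Nat.prime_dvd_prime_iff_eq hq.out Nat.prime_two).mp h')

variable (q) in
/-- The quadratic character with values in `ℂ`. -/
def eta : MulChar (ZMod q) ℂ := (quadraticChar (ZMod q)).ringHomComp (Int.castRingHom ℂ)

lemma eta_apply (a : ZMod q) : eta q a = (quadraticChar (ZMod q) a : ℂ) := rfl

variable (q) in
/-- The quadratic Gauss sum. -/
def gauss : ℂ := gaussSum (eta q) ZMod.stdAddChar

lemma ringChar_ne_two (hq2 : q ≠ 2) : ringChar (ZMod q) ≠ 2 := by
  rwa [ZMod.ringChar_zmod_n]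

lemma eta_ne_one (hq2 : q ≠ 2) : eta q ≠ 1 := by
  have h := quadraticChar_ne_one (ringChar_ne_two hq2)
  exact (MulChar.ringHomComp_ne_one_iff (RingHom.injective_int _)).mpr h

lemma eta_mul_self {a : ZMod q} (ha : a ≠ 0) : eta q a * eta q a = 1 := by
  rw [eta_apply]
  exact_mod_cast (by rw [← pow_two]; exact quadraticChar_sq_one ha :
    quadraticChar (ZMod q) a * quadraticChar (ZMod q) a = 1)

lemma eta_inv (a : ZMod q) : eta q a⁻¹ = eta q a := by
  by_cases ha : a = 0
  · subst ha; simp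
  · have h1 : eta q a⁻¹ * eta q a = 1 := by rw [← map_mul, inv_mul_cancel₀ ha, map_one]
    calc eta q a⁻¹ = eta q a⁻¹ * (eta q a * eta q a) := by rw [eta_mul_self ha, mul_one]
      _ = _ := by rw [← mul_assoc, h1, one_mul]

lemma gauss_sq (hq2 : q ≠ 2) : gauss q ^ 2 = eta q (-1) * q := by
  have h := gaussSum_sq (χ := eta q) (eta_ne_one hq2)
    ((quadraticChar_isQuadratic (ZMod q)).comp _) (ZMod.isPrimitive_stdAddChar q)
  rw [ZMod.card] at h
  exact h

lemma sum_stdAddChar_mul (y : ZMod q) :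
    ∑ t : ZMod q, ZMod.stdAddChar (y * t) = if y = 0 then (q : ℂ) else 0 := by
  have := AddChar.sum_mulShift y (ZMod.isPrimitive_stdAddChar q)
  simp only [ZMod.card, mul_comm _ y] at this
  rw [this]
  split_ifs <;> simp

lemma sum_eta_mul (hq2 : q ≠ 2) (y : ZMod q) :
    ∑ t : ZMod q, eta q t * ZMod.stdAddChar (y * t) = eta q y * gauss q := by
  by_cases hy : y = 0
  · subst hy
    simp only [zero_mul, AddChar.map_zero_eq_one, mul_one, MulChar.map_zero]
    exact MulChar.sum_eq_zero_of_ne_one (eta_ne_one hq2)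
  · have h := gaussSum_mulShift (eta q) (ZMod.stdAddChar (N := q)) (Units.mk0 y hy)
    rw [Units.val_mk0] at h
    rw [gauss, ← h, ← mul_assoc, eta_mul_self hy, one_mul]
    rfl

/-- A sum over squares: `z` has `1 + η(z)` square roots. -/
lemma sum_stdAddChar_sq (hq2 : q ≠ 2) {y : ZMod q} (hy : y ≠ 0) :
    ∑ t : ZMod q, ZMod.stdAddChar (y * t ^ 2) = eta q y * gauss q := by
  rw [← Finset.sum_fiberwise (s := Finset.univ) (g := fun t : ZMod q => t ^ 2)]
  have h1 : ∀ z : ZMod q, (∑ t ∈ Finset.univ.filter (fun t : ZMod q => t ^ 2 = z),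
      (ZMod.stdAddChar (y * t ^ 2) : ℂ)) = (eta q z + 1) * ZMod.stdAddChar (y * z) := fun z => by
    rw [Finset.sum_congr rfl (g := fun _ => (ZMod.stdAddChar (y * z) : ℂ)) (fun t ht => by
      rw [(Finset.mem_filter.mp ht).2]), Finset.sum_const, nsmul_eq_mul]
    congr 1
    have h := quadraticChar_card_sqrts (ringChar_ne_two hq2) z
    rw [eta_apply]
    have h2 : ((Finset.univ.filter (fun t : ZMod q => t ^ 2 = z)).card : ℤ) =
        quadraticChar (ZMod q) z + 1 := by
      rw [← h]
      congr 2
      ext t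
      simp
    exact_mod_cast congrArg (fun n : ℤ => (n : ℂ)) h2
  simp only [h1, add_mul, one_mul, Finset.sum_add_distrib]
  rw [sum_eta_mul hq2, sum_stdAddChar_mul, if_neg hy, add_zero]

/-! ### Vectors orthogonal to an independent family -/

lemma sum_stdAddChar_hQ {a : ZMod q} (ha : a ≠ 0) :
    ∑ w : Hyp q k, ZMod.stdAddChar (a * hQ w) = (q : ℂ) ^ k := by
  classical
  rw [Fintype.sum_prod_type]
  have h1 : ∀ x : Fin k → ZMod q, ∑ y : Fin k → ZMod q,
      (ZMod.stdAddChar (a * hQ ((x, y) : Hyp q k)) : ℂ) = if x = 0 then (q : ℂ) ^ k else 0 := by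
    intro x
    let L : (Fin k → ZMod q) →+ ZMod q :=
      { toFun := fun y => a * (x ⬝ᵥ y), map_zero' := by simp, map_add' := fun y z => by simp [mul_add] }
    have := sum_stdAddChar_comp L
    have hL : L = 0 ↔ x = 0 := by
      constructor
      · intro h
        ext c
        have := DFunLike.congr_fun h (Pi.single c 1)
        change a * (x ⬝ᵥ Pi.single c 1) = 0 at this
        rw [dotProduct_single, mul_one] at this
        exact (mul_eq_zero.mp this).resolve_left ha
      · rintro rfl
        refine AddMonoidHom.ext fun y => ?_
        change a * (0 ⬝ᵥ y) = 0
        simp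
    simp only [hL] at this
    rw [Fintype.card_fun, Fintype.card_fin, ZMod.card, Nat.cast_pow] at this
    exact this
  rw [Finset.sum_congr rfl fun x _ => h1 x, Finset.sum_ite_eq']
  simp

lemma sum_stdAddChar_hB (z : Hyp q k) :
    ∑ w : Hyp q k, ZMod.stdAddChar (hB w z) = if z = 0 then ((q : ℂ) ^ (2 * k)) else 0 := by
  classical
  have := sum_stdAddChar_comp (hBlin z).toAddMonoidHom
  have hL : (hBlin z).toAddMonoidHom = 0 ↔ z = 0 := by
    constructor
    · intro h
      ext c
      · have := DFunLike.congr_fun h (0, Pi.single c 1)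
        change hB z (0, Pi.single c 1) = 0 at this
        simpa [hB] using this
      · have := DFunLike.congr_fun h (Pi.single c 1, 0)
        change hB z (Pi.single c 1, 0) = 0 at this
        simpa [hB] using this
    · rintro rfl
      refine AddMonoidHom.ext fun y => ?_
      change hB 0 y = 0
      simp [hB]
  simp only [hL] at this
  have hc : Fintype.card (Hyp q k) = q ^ (2 * k) := by
    simp [Fintype.card_prod, ZMod.card, ← pow_add, two_mul]
  rw [hc, Nat.cast_pow] at this
  rw [← this]
  exact Finset.sum_congr rfl fun w _ => by rw [hB_comm]; rfl

/-- The quadratic form takes the values `u a` at the vectors `v a`, which are pairwise orthogonal. The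
diagonal is given by a function on `ℕ`, so that families of different lengths share it. -/
def DiagGram {i : ℕ} (u : ℕ → ZMod q) (v : Fin i → Hyp q k) : Prop :=
  ∀ a b, hB (v a) (v b) = if a = b then 2 * u a else 0

lemma DiagGram.hQ_sum (hq2 : q ≠ 2) {i : ℕ} {u : ℕ → ZMod q} {v : Fin i → Hyp q k}
    (hv : DiagGram u v) (t : Fin i → ZMod q) : hQ (∑ b, t b • v b) = ∑ b, t b ^ 2 * u b := by
  apply mul_left_cancel₀ (two_ne_zero_zmod hq2)
  rw [← hB_self, hB_sum_right, Finset.mul_sum]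
  refine Finset.sum_congr rfl fun b _ => ?_
  rw [hB_comm, hB_sum_right, Finset.sum_eq_single b]
  · rw [hv, if_pos rfl]; ring
  · intro c _ hc
    rw [hv, if_neg (Ne.symm hc), mul_zero]
  · simp

open scoped Classical in
/-- The number of vectors `w` with `Q(w) = c` orthogonal to an independent family with diagonal
Gram matrix, through Gauss sums: the conditions are detected by additive characters, with
parameters `a` for `Q(w) = c` and `t b` for the orthogonality to `v b`. -/
lemma DiagGram.card_orthogonal (hq2 : q ≠ 2) {i : ℕ} {u : ℕ → ZMod q} {v : Fin i → Hyp q k}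
    (hv : DiagGram u v) (hli : LinearIndependent (ZMod q) v) (c : ZMod q) :
    (q : ℂ) ^ (i + 1) * (Finset.univ.filter fun w => hQ w = c ∧ ∀ b, hB w (v b) = 0).card =
      (q : ℂ) ^ (2 * k) + (q : ℂ) ^ k * ∑ a ∈ Finset.univ.filter (fun a : ZMod q => a ≠ 0),
        ZMod.stdAddChar (-(a * c)) *
          ∏ b : Fin i, ∑ t : ZMod q, ZMod.stdAddChar (-(a⁻¹ * u b) * t ^ 2) := by
  have hind : ∀ w : Hyp q k, (if hQ w = c ∧ ∀ b, hB w (v b) = 0 then (q : ℂ) ^ (i + 1) else 0) =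
      ∑ a : ZMod q, ∑ t : Fin i → ZMod q,
        ZMod.stdAddChar (a * (hQ w - c)) * ZMod.stdAddChar (∑ b, hB w (v b) * t b) := by
    intro w
    simp only [← Finset.mul_sum]
    rw [← Finset.sum_mul]
    have h1 : ∑ a : ZMod q, (ZMod.stdAddChar (a * (hQ w - c)) : ℂ) =
        if hQ w = c then (q : ℂ) else 0 := by
      simp only [mul_comm _ (hQ w - c)]
      rw [sum_stdAddChar_mul]
      exact if_congr sub_eq_zero rfl rfl
    have h2 : ∑ t : Fin i → ZMod q, (ZMod.stdAddChar (∑ b, hB w (v b) * t b) : ℂ) =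
        if ∀ b, hB w (v b) = 0 then (q : ℂ) ^ i else 0 := by
      have h3 : ∀ t : Fin i → ZMod q, (ZMod.stdAddChar (∑ b, hB w (v b) * t b) : ℂ) =
          ∏ b, ZMod.stdAddChar (hB w (v b) * t b) := fun t => addChar_sum_eq_prod _ _ _
      simp only [h3]
      have h4 := Finset.prod_univ_sum (fun _ : Fin i => (Finset.univ : Finset (ZMod q)))
        (fun b t => (ZMod.stdAddChar (hB w (v b) * t) : ℂ))
      rw [Fintype.piFinset_univ] at h4
      rw [← h4]
      simp only [sum_stdAddChar_mul]
      by_cases hall : ∀ b, hB w (v b) = 0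
      · simp [hall]
      · rw [if_neg hall]
        push Not at hall
        obtain ⟨b, hb⟩ := hall
        exact Finset.prod_eq_zero (Finset.mem_univ b) (if_neg hb)
    rw [h1, h2]
    by_cases hc : hQ w = c <;> by_cases hall : ∀ b, hB w (v b) = 0 <;>
      simp [hc, hall, pow_succ, mul_comm]
  have hLHS : (q : ℂ) ^ (i + 1) * (Finset.univ.filter
      fun w => hQ w = c ∧ ∀ b, hB w (v b) = 0).card =
      ∑ w : Hyp q k, if hQ w = c ∧ ∀ b, hB w (v b) = 0 then (q : ℂ) ^ (i + 1) else 0 := by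
    rw [← Finset.sum_filter, Finset.sum_const, nsmul_eq_mul, mul_comm]
  rw [hLHS, Finset.sum_congr rfl fun w _ => hind w, Finset.sum_comm]
  have hsw : ∀ a : ZMod q, ∑ w : Hyp q k, ∑ t : Fin i → ZMod q,
      (ZMod.stdAddChar (a * (hQ w - c)) * ZMod.stdAddChar (∑ b, hB w (v b) * t b) : ℂ) =
      ∑ t : Fin i → ZMod q, ZMod.stdAddChar (-(a * c)) *
        ∑ w : Hyp q k, ZMod.stdAddChar (a * hQ w + hB w (∑ b, t b • v b)) := by
    intro a
    rw [Finset.sum_comm]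
    refine Finset.sum_congr rfl fun t _ => ?_
    rw [Finset.mul_sum]
    refine Finset.sum_congr rfl fun w _ => ?_
    rw [← AddChar.map_add_eq_mul, ← AddChar.map_add_eq_mul, hB_sum_right]
    congr 1
    have : ∑ b, t b * hB w (v b) = ∑ b, hB w (v b) * t b :=
      Finset.sum_congr rfl fun b _ => mul_comm _ _
    rw [this]
    ring
  simp only [hsw]
  rw [← Finset.add_sum_erase _ _ (Finset.mem_univ (0 : ZMod q))]
  have hset : (Finset.univ : Finset (ZMod q)).erase 0 = Finset.univ.filter (fun a => a ≠ 0) := by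
    ext a; simp
  rw [hset, Finset.mul_sum]
  congr 1
  · -- the term `a = 0` counts the orthogonal complement
    simp only [zero_mul, neg_zero, AddChar.map_zero_eq_one, one_mul, zero_add, sum_stdAddChar_hB]
    rw [Finset.sum_eq_single 0]
    · simp
    · intro t _ ht
      rw [if_neg]
      intro h0
      exact ht (funext fun b => Fintype.linearIndependent_iff.mp hli t h0 b)
    · simp
  · refine Finset.sum_congr rfl fun a ha => ?_
    have ha0 : a ≠ 0 := (Finset.mem_filter.mp ha).2
    rw [← Finset.mul_sum, mul_left_comm]
    congr 1
    -- completing the square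
    have h1 : ∀ t : Fin i → ZMod q,
        ∑ w : Hyp q k, (ZMod.stdAddChar (a * hQ w + hB w (∑ b, t b • v b)) : ℂ) =
        (q : ℂ) ^ k * ∏ b : Fin i, ZMod.stdAddChar (-(a⁻¹ * u b) * t b ^ 2) := by
      intro t
      rw [← addChar_sum_eq_prod, ← sum_stdAddChar_hQ ha0, Finset.sum_mul,
        ← Equiv.sum_comp (Equiv.addRight (a⁻¹ • ∑ b, t b • v b))
          (fun w => (ZMod.stdAddChar (a * hQ w) : ℂ) * _)]
      refine Finset.sum_congr rfl fun w _ => ?_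
      rw [← AddChar.map_add_eq_mul]
      congr 1
      rw [Equiv.coe_addRight, hQ_add_smul _ _ ha0, hv.hQ_sum hq2, Finset.mul_sum, add_assoc,
        ← Finset.sum_add_distrib]
      have hz : ∑ b : Fin i, (a⁻¹ * (t b ^ 2 * u b) + -(a⁻¹ * u b) * t b ^ 2) = 0 :=
        Finset.sum_eq_zero fun b _ => by ring
      rw [hz, add_zero]
    simp only [h1]
    rw [← Finset.mul_sum, Finset.prod_univ_sum, Fintype.piFinset_univ]

open scoped Classical in
/-- The vectors as in `DiagGram.card_orthogonal` that lie in the span of the family form its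
radical. -/
lemma DiagGram.card_radical (hq2 : q ≠ 2) {i : ℕ} {u : ℕ → ZMod q} {v : Fin i → Hyp q k}
    (hv : DiagGram u v) (hli : LinearIndependent (ZMod q) v) (c : ZMod q) :
    (Finset.univ.filter fun w => (hQ w = c ∧ ∀ b, hB w (v b) = 0) ∧
      w ∈ Submodule.span (ZMod q) (Set.range v)).card =
      if c = 0 then q ^ (Finset.univ.filter fun b : Fin i => u b = 0).card else 0 := by
  have hB' : ∀ (t : Fin i → ZMod q) b, hB (∑ b, t b • v b) (v b) = 2 * (t b * u b) := fun t b => by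
    rw [hB_comm, hB_sum_right, Finset.sum_eq_single b]
    · rw [hv, if_pos rfl]; ring
    · intro a _ ha
      rw [hv, if_neg (Ne.symm ha), mul_zero]
    · simp
  have hinj : Function.Injective fun t : Fin i → ZMod q => ∑ b, t b • v b := fun s t h =>
    hli.fintypeLinearCombination_injective h
  have hset : (Finset.univ.filter fun w => (hQ w = c ∧ ∀ b, hB w (v b) = 0) ∧
      w ∈ Submodule.span (ZMod q) (Set.range v)) =
      (Finset.univ.filter fun t : Fin i → ZMod q => c = 0 ∧ ∀ b : Fin i, t b * u b = 0).map
        ⟨fun t => ∑ b, t b • v b, hinj⟩ := by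
    ext w
    simp only [Finset.mem_filter, Finset.mem_univ, true_and, Finset.mem_map,
      Function.Embedding.coeFn_mk, Submodule.mem_span_range_iff_exists_fun]
    constructor
    · rintro ⟨⟨h1, h2⟩, t, rfl⟩
      have h3 : ∀ b : Fin i, t b * u b = 0 := fun b => by
        have := h2 b
        rw [hB'] at this
        exact (mul_eq_zero.mp this).resolve_left (two_ne_zero_zmod hq2)
      refine ⟨t, ⟨?_, h3⟩, rfl⟩
      rw [← h1, hv.hQ_sum hq2]
      exact Finset.sum_eq_zero fun b _ => by rw [pow_two, mul_assoc, h3, mul_zero]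
    · rintro ⟨t, ⟨h1, h3⟩, rfl⟩
      refine ⟨⟨?_, fun b => by rw [hB', h3, mul_zero]⟩, t, rfl⟩
      rw [h1, hv.hQ_sum hq2]
      exact Finset.sum_eq_zero fun b _ => by rw [pow_two, mul_assoc, h3, mul_zero]
  rw [hset, Finset.card_map]
  by_cases hc : c = 0
  · rw [if_pos hc]
    simp only [hc, true_and]
    have : (Finset.univ.filter fun t : Fin i → ZMod q => ∀ b : Fin i, t b * u b = 0) =
        Fintype.piFinset fun b : Fin i => if u b = 0 then Finset.univ else {0} := by
      ext t
      simp only [Finset.mem_filter, Finset.mem_univ, true_and, Fintype.mem_piFinset]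
      refine forall_congr' fun b => ?_
      by_cases hb : u b = 0 <;> simp [hb]
    rw [this, Fintype.card_piFinset]
    have : ∀ b : Fin i, (if u b = 0 then (Finset.univ : Finset (ZMod q)) else {0}).card =
        if u b = 0 then q else 1 := fun b => by
      split_ifs <;> simp [ZMod.card]
    rw [Finset.prod_congr rfl fun b _ => this b, Finset.prod_ite, Finset.prod_const,
      Finset.prod_const, one_pow, mul_one]
  · simp [hc]

end

section

variable {q k : ℕ} [hq : Fact q.Prime]

/-! ### Evaluation of the Gauss sums -/

/-- The quadratic character of the signed discriminant `(-1) ^ t ∏_{b < 2t} u b` of the first `2t`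
entries. -/
def xi (u : ℕ → ZMod q) (t : ℕ) : ℤ :=
  quadraticChar (ZMod q) ((-1) ^ t * ∏ b ∈ Finset.range (2 * t), u b)

lemma prod_gauss (hq2 : q ≠ 2) {u : ℕ → ZMod q} {s j : ℕ} (h1 : ∀ b < s, u b ≠ 0)
    (h2 : ∀ b, s ≤ b → b < s + j → u b = 0) {a : ZMod q} (ha : a ≠ 0) :
    ∏ b : Fin (s + j), ∑ t : ZMod q, (ZMod.stdAddChar (-(a⁻¹ * u b) * t ^ 2) : ℂ) =
      (eta q (-a) * gauss q) ^ s * eta q (∏ b ∈ Finset.range s, u b) * (q : ℂ) ^ j := by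
  rw [← Finset.prod_range (fun b => ∑ t : ZMod q, (ZMod.stdAddChar (-(a⁻¹ * u b) * t ^ 2) : ℂ)),
    Finset.prod_range_add]
  congr 1
  · rw [map_prod]
    have : ∀ b ∈ Finset.range s, ∑ t : ZMod q, (ZMod.stdAddChar (-(a⁻¹ * u b) * t ^ 2) : ℂ) =
        (eta q (-a) * gauss q) * eta q (u b) := fun b hb => by
      have hb0 := h1 b (Finset.mem_range.mp hb)
      rw [sum_stdAddChar_sq hq2 (neg_ne_zero.mpr (mul_ne_zero (inv_ne_zero ha) hb0)), ← neg_mul,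
        ← inv_neg, map_mul, eta_inv]
      ring
    rw [Finset.prod_congr rfl this, Finset.prod_mul_distrib, Finset.prod_const, Finset.card_range]
  · have : ∀ b ∈ Finset.range j,
        ∑ t : ZMod q, (ZMod.stdAddChar (-(a⁻¹ * u (s + b)) * t ^ 2) : ℂ) = q := fun b hb => by
      rw [h2 _ (by omega) (by have := Finset.mem_range.mp hb; omega)]
      simp [ZMod.card]
    rw [Finset.prod_congr rfl this, Finset.prod_const, Finset.card_range]

lemma eta_neg_mul_gauss_pow (hq2 : q ≠ 2) {a : ZMod q} (ha : a ≠ 0) (t : ℕ) :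
    (eta q (-a) * gauss q) ^ (2 * t) = eta q ((-1) ^ t) * (q : ℂ) ^ t := by
  rw [pow_mul, mul_pow, gauss_sq hq2, pow_two, eta_mul_self (neg_ne_zero.mpr ha), one_mul, mul_pow,
    map_pow]

lemma xi_cast (u : ℕ → ZMod q) (t : ℕ) :
    ((xi u t : ℤ) : ℂ) = eta q ((-1) ^ t) * eta q (∏ b ∈ Finset.range (2 * t), u b) := by
  rw [← map_mul]; rfl

lemma sum_filter_ne_zero (f : ZMod q → ℂ) :
    ∑ a ∈ Finset.univ.filter (fun a : ZMod q => a ≠ 0), f a = ∑ a, f a - f 0 := by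
  have hset : Finset.univ.filter (fun a : ZMod q => a ≠ 0) = Finset.univ.erase 0 := by
    ext a; simp
  rw [hset, Finset.sum_erase_eq_sub (Finset.mem_univ _)]

/-- The Gauss sums of `DiagGram.card_orthogonal` for an even number of nonzero entries: the dependence on
`a` of the quadratic characters cancels. -/
lemma sum_gauss_even (hq2 : q ≠ 2) {u : ℕ → ZMod q} {t j : ℕ} (h1 : ∀ b < 2 * t, u b ≠ 0)
    (h2 : ∀ b, 2 * t ≤ b → b < 2 * t + j → u b = 0) (c : ZMod q) :
    ∑ a ∈ Finset.univ.filter (fun a : ZMod q => a ≠ 0), (ZMod.stdAddChar (-(a * c)) : ℂ) *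
      ∏ b : Fin (2 * t + j), ∑ y : ZMod q, (ZMod.stdAddChar (-(a⁻¹ * u b) * y ^ 2) : ℂ) =
      ((if c = 0 then (q : ℂ) else 0) - 1) * (xi u t * (q : ℂ) ^ (t + j)) := by
  rw [Finset.sum_congr rfl (g := fun a => (ZMod.stdAddChar (-(a * c)) : ℂ) *
      (xi u t * (q : ℂ) ^ (t + j))) (fun a ha => by
    rw [prod_gauss hq2 h1 h2 (Finset.mem_filter.mp ha).2,
      eta_neg_mul_gauss_pow hq2 (Finset.mem_filter.mp ha).2, xi_cast]
    ring), ← Finset.sum_mul, sum_filter_ne_zero]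
  congr 1
  simp only [zero_mul, neg_zero, AddChar.map_zero_eq_one]
  have := sum_stdAddChar_mul (-c)
  simp only [neg_eq_zero] at this
  rw [← this]
  congr 1
  exact Finset.sum_congr rfl fun a _ => by congr 1; ring

/-- The Gauss sums of `DiagGram.card_orthogonal` for an odd number of nonzero entries: one quadratic
character of `a` is left, and produces a second Gauss sum. -/
lemma sum_gauss_odd (hq2 : q ≠ 2) {u : ℕ → ZMod q} {t j : ℕ} (h1 : ∀ b < 2 * t + 1, u b ≠ 0)
    (h2 : ∀ b, 2 * t + 1 ≤ b → b < 2 * t + 1 + j → u b = 0) (c : ZMod q) :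
    ∑ a ∈ Finset.univ.filter (fun a : ZMod q => a ≠ 0), (ZMod.stdAddChar (-(a * c)) : ℂ) *
      ∏ b : Fin (2 * t + 1 + j), ∑ y : ZMod q, (ZMod.stdAddChar (-(a⁻¹ * u b) * y ^ 2) : ℂ) =
      eta q ((-1) ^ (t + 1)) * eta q (∏ b ∈ Finset.range (2 * t + 1), u b) * eta q c *
        (q : ℂ) ^ (t + 1 + j) := by
  rw [Finset.sum_congr rfl (g := fun a => (eta q (-a) * (ZMod.stdAddChar (-(a * c)) : ℂ)) *
      (gauss q * eta q ((-1) ^ t) * eta q (∏ b ∈ Finset.range (2 * t + 1), u b) *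
        (q : ℂ) ^ (t + j))) (fun a ha => by
    rw [prod_gauss hq2 h1 h2 (Finset.mem_filter.mp ha).2, pow_succ,
      eta_neg_mul_gauss_pow hq2 (Finset.mem_filter.mp ha).2]
    ring), ← Finset.sum_mul, sum_filter_ne_zero]
  have h3 : ∑ a : ZMod q, eta q (-a) * (ZMod.stdAddChar (-(a * c)) : ℂ) = eta q c * gauss q := by
    rw [← sum_eta_mul hq2, ← Equiv.sum_comp (Equiv.neg (ZMod q))]
    exact Finset.sum_congr rfl fun a _ => by
      rw [Equiv.neg_apply]; congr 2; · rw [neg_neg]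
      ring
  rw [h3, neg_zero, MulChar.map_zero, zero_mul, sub_zero, pow_succ (-1 : ZMod q), map_mul]
  have := gauss_sq hq2
  linear_combination (eta q c * eta q ((-1) ^ t) * eta q (∏ b ∈ Finset.range (2 * t + 1), u b) *
        (q : ℂ) ^ (t + j)) * this

/-! ### Counting independent families with a given diagonal Gram matrix -/

/-- The factor contributed by the `i`-th vector of a family whose Gram matrix is diagonal, the
first `s` entries being nonzero and the others zero; `ξ t` is the sign of the first `2t` entries.
The variable stands for `q⁻ᵏ`, where `2k` is the dimension of the space. -/
def kappa (q s : ℕ) (ξ : ℕ → ℤ) (i : ℕ) : ℤ[X] :=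
  if i < s then
    if Even i then 1 - Polynomial.C (ξ (i / 2) * (q : ℤ) ^ (i / 2)) * Polynomial.X
    else 1 + Polynomial.C (ξ ((i + 1) / 2) * (q : ℤ) ^ ((i + 1) / 2)) * Polynomial.X
  else if Even s then
    (1 - Polynomial.C (ξ (s / 2) * (q : ℤ) ^ (i - s + s / 2)) * Polynomial.X) *
      (1 + Polynomial.C (ξ (s / 2) * (q : ℤ) ^ (i - s + s / 2 + 1)) * Polynomial.X)
  else 1 - Polynomial.C ((q : ℤ) ^ (2 * (i - s) + s + 1)) * Polynomial.X ^ 2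

lemma xi_sq {u : ℕ → ZMod q} {t : ℕ} (h : ∀ b < 2 * t, u b ≠ 0) : xi u t * xi u t = 1 := by
  rw [xi, ← pow_two]
  refine quadraticChar_sq_one (mul_ne_zero (pow_ne_zero _ (by simp)) ?_)
  exact Finset.prod_ne_zero_iff.mpr fun b hb => h b (Finset.mem_range.mp hb)

open scoped Classical in
/-- The number of ways to extend a family by one vector: the vectors orthogonal to the family with the
prescribed value of the quadratic form, except those in the radical of its span. -/
lemma DiagGram.card_next (hq2 : q ≠ 2) {s i : ℕ} {u : ℕ → ZMod q} (h1 : ∀ b < s, u b ≠ 0)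
    (h2 : ∀ b, s ≤ b → u b = 0) {v : Fin i → Hyp q k} (hv : DiagGram u v)
    (hli : LinearIndependent (ZMod q) v) :
    (q : ℂ) ^ (i + 1) * (Finset.univ.filter fun w => (hQ w = u i ∧ ∀ b, hB w (v b) = 0) ∧
      w ∉ Submodule.span (ZMod q) (Set.range v)).card =
      (q : ℂ) ^ (2 * k) * Polynomial.aeval (((q : ℂ) ^ k)⁻¹) (kappa q s (xi u) i) := by
  have hqC : (q : ℂ) ≠ 0 := Nat.cast_ne_zero.mpr hq.out.ne_zero
  have hsplit : ((Finset.univ.filter fun w => (hQ w = u i ∧ ∀ b, hB w (v b) = 0) ∧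
      w ∉ Submodule.span (ZMod q) (Set.range v)).card : ℂ) =
      (Finset.univ.filter fun w => hQ w = u i ∧ ∀ b, hB w (v b) = 0).card -
      (if u i = 0 then q ^ (Finset.univ.filter fun b : Fin i => u b = 0).card else 0 : ℕ) := by
    have hsum : ∀ P Q : Hyp q k → Prop, (Finset.univ.filter fun w => P w ∧ ¬ Q w).card +
        (Finset.univ.filter fun w => P w ∧ Q w).card = (Finset.univ.filter P).card := by
      intro P Q
      rw [← Finset.filter_filter, ← Finset.filter_filter, add_comm,
        Finset.card_filter_add_card_filter_not]
    rw [← hv.card_radical hq2 hli (u i), eq_sub_iff_add_eq, ← Nat.cast_add]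
    congr 1
    convert hsum (fun w => hQ w = u i ∧ ∀ b, hB w (v b) = 0)
      (fun w => w ∈ Submodule.span (ZMod q) (Set.range v))
  rw [hsplit, mul_sub, hv.card_orthogonal hq2 hli]
  rcases lt_or_ge i s with his | his
  · rw [if_neg (h1 i his), Nat.cast_zero, mul_zero, sub_zero, kappa, if_pos his]
    rcases Nat.even_or_odd' i with ⟨t, rfl | rfl⟩
    · have := sum_gauss_even hq2 (u := u) (t := t) (j := 0) (fun b hb => h1 b (by omega))
        (fun b hb hb' => by omega) (u (2 * t))
      rw [if_neg (h1 _ his)] at this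
      simp only [add_zero] at this
      erw [this]
      rw [if_pos (even_two_mul t), Nat.mul_div_cancel_left t two_pos]
      simp
      field_simp
      ring
    · have := sum_gauss_odd hq2 (u := u) (t := t) (j := 0) (fun b hb => h1 b (by omega))
        (fun b hb hb' => by omega) (u (2 * t + 1))
      simp only [add_zero] at this
      have hx := xi_cast u (t + 1)
      rw [show 2 * (t + 1) = 2 * t + 1 + 1 by ring, Finset.prod_range_succ, map_mul, ← mul_assoc]
        at hx
      rw [this, ← hx, if_neg (by simp), show (2 * t + 1 + 1) / 2 = t + 1 by omega]
      simp
      field_simp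
      ring
  · obtain ⟨j, rfl⟩ := Nat.exists_eq_add_of_le his
    have hcard : (Finset.univ.filter fun b : Fin (s + j) => u b = 0).card = j := by
      have : (Finset.univ.filter fun b : Fin (s + j) => u b = 0) =
          (Finset.univ : Finset (Fin j)).map (Fin.natAddEmb s) := by
        ext b
        simp only [Finset.mem_filter, Finset.mem_univ, true_and, Finset.mem_map]
        constructor
        · intro hb
          have hsb : s ≤ b := by
            by_contra hlt
            exact h1 b (not_le.mp hlt) hb
          exact ⟨⟨b - s, by omega⟩, Fin.ext (by simp; omega)⟩
        · rintro ⟨c, rfl⟩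
          exact h2 _ (by simp)
      rw [this, Finset.card_map, Finset.card_univ, Fintype.card_fin]
    rw [if_pos (h2 _ his), hcard, kappa, if_neg (not_lt.mpr his), Nat.add_sub_cancel_left]
    rcases Nat.even_or_odd' s with ⟨t, rfl | rfl⟩
    · have := sum_gauss_even hq2 (u := u) (t := t) (j := j) h1
        (fun b hb hb' => h2 b hb) (u (2 * t + j))
      rw [if_pos (h2 _ his)] at this
      rw [this, if_pos (even_two_mul t), Nat.mul_div_cancel_left t two_pos]
      have hx : (xi u t : ℂ) * xi u t = 1 := by exact_mod_cast xi_sq h1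
      simp
      field_simp
      linear_combination ((q : ℂ) ^ (2 * k + 2 * (j + t) + 1)) * hx
    · have := sum_gauss_odd hq2 (u := u) (t := t) (j := j) h1
        (fun b hb hb' => h2 b hb) (u (2 * t + 1 + j))
      rw [h2 _ his, MulChar.map_zero, mul_zero, zero_mul] at this
      rw [h2 _ his, this, if_neg (by simp)]
      simp
      field_simp
      ring

variable (k) in
/-- Linearly independent families of `i` vectors with diagonal Gram matrix. -/
abbrev Frames (u : ℕ → ZMod q) (i : ℕ) :=
  {v : Fin i → Hyp q k // LinearIndependent (ZMod q) v ∧ DiagGram u v}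

lemma card_frames_succ (hq2 : q ≠ 2) {s : ℕ} {u : ℕ → ZMod q} (h1 : ∀ b < s, u b ≠ 0)
    (h2 : ∀ b, s ≤ b → u b = 0) (i : ℕ) :
    (q : ℂ) ^ (i + 1) * Nat.card (Frames k u (i + 1)) =
      Nat.card (Frames k u i) *
        ((q : ℂ) ^ (2 * k) * Polynomial.aeval (((q : ℂ) ^ k)⁻¹) (kappa q s (xi u) i)) := by
  classical
  let e : Frames k u (i + 1) ≃ Σ v : Frames k u i, {w : Hyp q k //
      (hQ w = u i ∧ ∀ b, hB w (v.1 b) = 0) ∧ w ∉ Submodule.span (ZMod q) (Set.range v.1)} :=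
    { toFun := fun v => ⟨⟨fun b => v.1 b.castSucc,
          v.2.1.comp _ (Fin.castSucc_injective i), fun a b => by
            rw [v.2.2]
            simp⟩,
        ⟨v.1 (Fin.last i), ⟨⟨by
          have := v.2.2 (Fin.last i) (Fin.last i)
          rw [hB_self, if_pos rfl, Fin.val_last] at this
          exact mul_left_cancel₀ (two_ne_zero_zmod hq2) this, fun b => by
            rw [v.2.2, if_neg (Fin.castSucc_lt_last b).ne']⟩, by
          have := v.2.1
          rw [← Fin.snoc_init_self v.1, linearIndependent_finSnoc] at this
          exact this.2⟩⟩⟩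
      invFun := fun x => ⟨Fin.snoc (α := fun _ => Hyp q k) x.1.1 x.2.1,
        linearIndependent_finSnoc.mpr ⟨x.1.2.1, x.2.2.2⟩, fun a b => by
          refine Fin.lastCases ?_ (fun a => ?_) a <;> refine Fin.lastCases ?_ (fun b => ?_) b
          · rw [Fin.snoc_last, hB_self, x.2.2.1.1, if_pos rfl, Fin.val_last]
          · rw [Fin.snoc_last, Fin.snoc_castSucc, x.2.2.1.2, if_neg (Fin.castSucc_lt_last b).ne']
          · rw [Fin.snoc_last, Fin.snoc_castSucc, hB_comm, x.2.2.1.2,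
              if_neg (Fin.castSucc_lt_last a).ne]
          · rw [Fin.snoc_castSucc, Fin.snoc_castSucc, x.1.2.2]
            simp⟩
      left_inv := fun v => Subtype.ext (Fin.snoc_init_self v.1)
      right_inv := fun x => by
        obtain ⟨⟨v, hv⟩, ⟨w, hw⟩⟩ := x
        have h3 : (fun b : Fin i => (Fin.snoc v w : Fin (i + 1) → Hyp q k) b.castSucc) = v :=
          funext fun b => Fin.snoc_castSucc ..
        refine Sigma.subtype_ext (Subtype.ext h3)
          (Fin.snoc_last (α := fun _ => Hyp q k) w v) }
  rw [Nat.card_congr e, Nat.card_sigma, Nat.cast_sum, Finset.mul_sum]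
  have : ∀ v : Frames k u i, (q : ℂ) ^ (i + 1) * (Nat.card {w : Hyp q k //
      (hQ w = u i ∧ ∀ b, hB w (v.1 b) = 0) ∧ w ∉ Submodule.span (ZMod q) (Set.range v.1)} : ℂ) =
      (q : ℂ) ^ (2 * k) * Polynomial.aeval (((q : ℂ) ^ k)⁻¹) (kappa q s (xi u) i) := fun v => by
    rw [← v.2.2.card_next hq2 h1 h2 v.2.1, Nat.card_eq_fintype_card, Fintype.card_subtype]
  rw [Finset.sum_congr rfl fun v _ => this v, Finset.sum_const, nsmul_eq_mul, Finset.card_univ,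
    Nat.card_eq_fintype_card]

/-- The number of linearly independent families with a given diagonal Gram matrix, by adding one vector
at a time. -/
lemma card_frames (hq2 : q ≠ 2) {s : ℕ} {u : ℕ → ZMod q} (h1 : ∀ b < s, u b ≠ 0)
    (h2 : ∀ b, s ≤ b → u b = 0) (m : ℕ) :
    (q : ℂ) ^ (∑ i ∈ Finset.range m, (i + 1)) * Nat.card (Frames k u m) =
      (q : ℂ) ^ (2 * k * m) * Polynomial.aeval (((q : ℂ) ^ k)⁻¹)
        (∏ i ∈ Finset.range m, kappa q s (xi u) i) := by
  induction m with
  | zero =>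
    have : Nat.card (Frames k u 0) = 1 := by
      rw [Nat.card_eq_one_iff_unique]
      refine ⟨inferInstance, ⟨⟨fun a => a.elim0, linearIndependent_empty_type, fun a => a.elim0⟩⟩⟩
    simp [this]
  | succ m ih =>
    rw [Finset.sum_range_succ, Finset.prod_range_succ, map_mul, pow_add, mul_assoc,
      card_frames_succ hq2 h1 h2 m, ← mul_assoc, ih]
    ring

end

section

/-! ### Diagonalization of symmetric matrices over a field -/

lemma exists_mul_mul_transpose_eq_diagonal {K : Type*} [Field K] (h2 : (2 : K) ≠ 0) {m : ℕ}
    {S : Matrix (Fin m) (Fin m) K} (hS : S.IsSymm) :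
    ∃ (g : Matrix (Fin m) (Fin m) K) (d : Fin m → K), IsUnit g.det ∧
      g * S * g.transpose = Matrix.diagonal d := by
  let _ : Invertible (2 : K) := invertibleOfNonzero h2
  have hsym : LinearMap.IsSymm (Matrix.toBilin' S) := by
    refine ⟨fun x y => ?_⟩
    simp only [RingHom.id_apply]
    rw [Matrix.toBilin'_apply', Matrix.toBilin'_apply', Matrix.dotProduct_mulVec,
      ← Matrix.mulVec_transpose, hS.eq, dotProduct_comm]
  obtain ⟨v, hv⟩ := LinearMap.BilinForm.exists_orthogonal_basis hsym
  let b : Module.Basis (Fin m) K (Fin m → K) := v.reindex (finCongr (by simp))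
  have hb : ∀ i j, i ≠ j → Matrix.toBilin' S (b i) (b j) = 0 := fun i j hij => by
    rw [Module.Basis.reindex_apply, Module.Basis.reindex_apply]
    exact hv fun h => hij ((Equiv.injective _) h)
  let g : Matrix (Fin m) (Fin m) K := Matrix.of fun i j => b i j
  refine ⟨g, fun i => Matrix.toBilin' S (b i) (b i), ?_, ?_⟩
  · rw [← Matrix.isUnit_iff_isUnit_det, ← Matrix.linearIndependent_rows_iff_isUnit]
    exact b.linearIndependent
  · ext i j
    have : (g * S * g.transpose) i j = Matrix.toBilin' S (b i) (b j) := by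
      rw [Matrix.toBilin'_apply', Matrix.mul_assoc, Matrix.mul_apply']
      congr 1
    rw [this, Matrix.diagonal_apply]
    split_ifs with hij
    · rw [hij]
    · exact hb i j hij

/-- A symmetric matrix is congruent to a diagonal matrix with the nonzero entries first. -/
lemma exists_congruent_sorted_diagonal {K : Type*} [Field K] (h2 : (2 : K) ≠ 0) {m : ℕ}
    {S : Matrix (Fin m) (Fin m) K} (hS : S.IsSymm) :
    ∃ (g : Matrix (Fin m) (Fin m) K) (s : ℕ) (u : ℕ → K), IsUnit g.det ∧ s ≤ m ∧
      (∀ b < s, u b ≠ 0) ∧ (∀ b, s ≤ b → u b = 0) ∧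
      g * S * g.transpose = Matrix.diagonal fun i : Fin m => u i := by
  classical
  obtain ⟨g, d, hg, hd⟩ := exists_mul_mul_transpose_eq_diagonal h2 hS
  -- sort the diagonal by the indicator function of the zeros
  let f : Fin m → ℕ := fun i => if d i = 0 then 1 else 0
  let σ := Tuple.sort f
  have hmono : Monotone (f ∘ σ) := Tuple.monotone_sort f
  let u : ℕ → K := fun b => if hb : b < m then d (σ ⟨b, hb⟩) else 0
  have hex : ∃ s, ∀ b, s ≤ b → u b = 0 := ⟨m, fun b hb => dif_neg (not_lt.mpr hb)⟩
  let s := Nat.find hex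
  have hs : ∀ b, s ≤ b → u b = 0 := Nat.find_spec hex
  have hsm : s ≤ m := Nat.find_min' hex fun b hb => dif_neg (not_lt.mpr hb)
  refine ⟨g.submatrix σ id, s, u, ?_, hsm, fun b hb => ?_, hs, ?_⟩
  · rw [Matrix.det_permute]
    exact IsUnit.mul (by rcases Int.units_eq_one_or (Equiv.Perm.sign σ) with h | h <;> simp [h]) hg
  · have hmin := Nat.find_min hex hb
    push Not at hmin
    obtain ⟨c, hbc, hc⟩ := hmin
    have hcm : c < m := by
      by_contra h
      exact hc (dif_neg h)
    have hle := hmono (a := ⟨b, by omega⟩) (b := ⟨c, hcm⟩) hbc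
    simp only [u] at hc ⊢
    rw [dif_pos hcm] at hc
    rw [dif_pos (by omega)]
    intro h0
    simp [f, h0, hc] at hle
  · have : g.submatrix σ id * S * (g.submatrix σ id).transpose =
        (g * S * g.transpose).submatrix σ σ := by
      ext i j
      simp [Matrix.mul_apply]
    rw [this, hd]
    ext i j
    simp [Matrix.diagonal_apply, u]

end

section

variable {p m k : ℕ} [hp : Fact p.Prime]

/-! ### The primitive part as a count of independent families -/

lemma card_isSymm_zmod (q m : ℕ) [NeZero q] :
    Nat.card {S : Matrix (Fin m) (Fin m) (ZMod q) // S.IsSymm} =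
      q ^ ∑ i ∈ Finset.range m, (i + 1) := by
  have h1 := card_isSymm (m := m) (T := ZMod q) (fun _ _ _ => True) (fun _ _ _ h => h)
  have h2 : Nat.card {S : Matrix (Fin m) (Fin m) (ZMod q) // S.IsSymm} =
      Nat.card {S : Matrix (Fin m) (Fin m) (ZMod q) // S.IsSymm ∧ ∀ _ _ : Fin m, True} :=
    Nat.card_congr (Equiv.subtypeEquivRight fun S => by simp)
  have h3 : Nat.card {a : ZMod q // True} = q := by
    rw [Nat.card_congr (Equiv.subtypeUnivEquiv fun _ => trivial), Nat.card_zmod]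
  rw [h2, h1, Finset.prod_const, h3]
  congr 1
  have h4 := sum_pairs (m := m) fun _ => 1
  simp only [Finset.sum_const, smul_eq_mul, mul_one, Finset.card_univ, Fintype.card_fin] at h4
  have h5 := Finset.sum_range_succ' (fun i => i) m
  have h6 := Finset.sum_range_id_mul_two (m + 1)
  rw [h5, Nat.add_sub_cancel] at h6
  rw [Finset.card_univ]
  linarith

variable (m) in
/-- The additive group of symmetric matrices over `ℤ/q`. -/
def symZMod (q : ℕ) : AddSubgroup (Matrix (Fin m) (Fin m) (ZMod q)) where
  carrier := {S | S.IsSymm}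
  zero_mem' := Matrix.isSymm_zero
  add_mem' ha hb := Matrix.IsSymm.add ha hb
  neg_mem' ha := Matrix.IsSymm.neg ha

/-- The phase `tr(HS) + ∑ S i j (x i · y j)` as an additive function of the symmetric matrix `S`. -/
def phase {q : ℕ} (H : Matrix (Fin m) (Fin m) (ZMod q)) (v : Fin m → Hyp q k) :
    symZMod m q →+ ZMod q where
  toFun S := (H * S.1).trace + beta S.1 v v
  map_zero' := by simp [beta]
  map_add' S T := by
    simp only [AddSubgroup.coe_add, Matrix.mul_add, Matrix.trace_add, beta, Matrix.add_apply,
      add_mul, Finset.sum_add_distrib]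
    ring

lemma two_mul_phase {q : ℕ} [Fact q.Prime] (H : Matrix (Fin m) (Fin m) (ZMod q)) 
    (v : Fin m → Hyp q k) (S : symZMod m q) :
    2 * phase H v S = ∑ i, ∑ j, S.1 i j * (2 * H i j + hB (v i) (v j)) := by
  have hS : ∀ i j, S.1 i j = S.1 j i := fun i j => Matrix.IsSymm.apply S.2 j i
  have h1 : (H * S.1).trace = ∑ i, ∑ j, S.1 i j * H i j := by
    simp only [Matrix.trace, Matrix.diag_apply, Matrix.mul_apply]
    exact Finset.sum_congr rfl fun i _ => Finset.sum_congr rfl fun j _ => by rw [hS j i, mul_comm]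
  have h2 : 2 * beta S.1 v v = ∑ i, ∑ j, S.1 i j * hB (v i) (v j) := by
    have h3 : beta S.1 v v = ∑ i, ∑ j, S.1 i j * ((v j).1 ⬝ᵥ (v i).2) := by
      rw [beta, Finset.sum_comm]
      exact Finset.sum_congr rfl fun i _ => Finset.sum_congr rfl fun j _ => by rw [hS j i]
    rw [two_mul]
    nth_rewrite 1 [beta]
    rw [h3]
    simp only [← Finset.sum_add_distrib, hB, mul_add]
  change 2 * ((H * S.1).trace + beta S.1 v v) = _
  rw [mul_add, h1, h2, Finset.mul_sum]
  simp only [mul_add, Finset.sum_add_distrib, Finset.mul_sum]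
  congr 1
  exact Finset.sum_congr rfl fun i _ => Finset.sum_congr rfl fun j _ => by ring

/-- The phase is trivial exactly when the Gram matrix of `v` for the polar form is `-2H`. -/
lemma phase_eq_zero_iff {q : ℕ} [Fact q.Prime] (hq2 : q ≠ 2)
    {H : Matrix (Fin m) (Fin m) (ZMod q)} (hH : H.IsSymm) (v : Fin m → Hyp q k) :
    phase H v = 0 ↔ ∀ i j, 2 * H i j + hB (v i) (v j) = 0 := by
  have h2 := two_ne_zero_zmod hq2
  constructor
  · intro h i j
    let S : symZMod m q := ⟨Matrix.single i j 1 + Matrix.single j i 1, by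
      change Matrix.IsSymm _
      rw [Matrix.IsSymm, Matrix.transpose_add, Matrix.transpose_single, Matrix.transpose_single,
        add_comm]⟩
    have h3 := two_mul_phase H v S
    rw [h, AddMonoidHom.zero_apply, mul_zero] at h3
    have hsum : ∀ (a b : Fin m) (F : Fin m → Fin m → ZMod q),
        ∑ i, ∑ j, (Matrix.single a b 1 : Matrix _ _ (ZMod q)) i j * F i j = F a b := fun a b F => by
      rw [Finset.sum_eq_single a, Finset.sum_eq_single b]
      · simp
      · intro c _ hc; simp [hc.symm]
      · simp
      · intro c _ hc; simp [hc.symm]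
      · simp
    simp only [S, Matrix.add_apply, add_mul, Finset.sum_add_distrib] at h3
    rw [hsum, hsum, hB_comm (v j), Matrix.IsSymm.apply hH i j, ← two_mul] at h3
    exact (mul_eq_zero.mp h3.symm).resolve_left h2
  · intro h
    ext S
    refine (mul_eq_zero.mp ((two_mul_phase H v S).trans ?_)).resolve_left h2
    simp [h]

/-- Linearly independent families whose Gram matrix for the polar form is `-2H`. -/
abbrev GramFrames (q k : ℕ) [Fact q.Prime] (H : Matrix (Fin m) (Fin m) (ZMod q)) :=
  {v : Fin m → Hyp q k // LinearIndependent (ZMod q) v ∧ ∀ i j, 2 * H i j + hB (v i) (v j) = 0}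

/-- At `X = p⁻ᵏ` the primitive part counts linearly independent families over `ℤ/p` with Gram matrix
`-2h`: the sum over symmetric matrices modulo `p` is an orthogonality relation. -/
lemma aeval_bprim (hp2 : p ≠ 2) {h : Matrix (Fin m) (Fin m) ℤ_[p]} (hh : h.IsSymm) (k : ℕ) :
    (bprim h).eval (((p : ℂ) ^ k)⁻¹) = ((p : ℂ) ^ (2 * m * k))⁻¹ *
      ((p : ℂ) ^ (∑ i ∈ Finset.range m, (i + 1)) *
        Nat.card (GramFrames (p ^ 1) k (h.map (PadicInt.toZModPow 1)))) := by
  classical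
  set H := h.map (PadicInt.toZModPow 1) with hH
  have : NeZero (p ^ 1) := inferInstance
  have hHs : H.IsSymm := hh.map _
  have hred : ∀ w : Hyp (p ^ 1) k, redHyp le_rfl w = w := fun w => by
    have : red (p := p) (M := 1) le_rfl = RingHom.id _ := ZMod.castHom_self
    ext c <;> simp [redHyp, this]
  have hterm : ∀ S : symZMod m (p ^ 1), pair h (ofSym 1 S) *
      ((wprim (ofSym 1 S)).map (Int.castRingHom ℂ)).eval (((p : ℂ) ^ k)⁻¹) =
      ((p : ℂ) ^ (2 * m * k))⁻¹ * ∑ v : Fin m → Hyp (p ^ 1) k,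
        if LinearIndependent (ZMod (p ^ 1)) v then (ZMod.stdAddChar (phase H v S) : ℂ) else 0 := by
    intro S
    have h0 : ofSym 1 S = frac 1 (S.1.map fun a => ((a.val : ℕ) : ℤ_[p]))
        (Matrix.IsSymm.map S.2 _) := rfl
    have h1 := aeval_wprim (p := p) (k := k) (M := 1) le_rfl
      (S.1.map fun a => ((a.val : ℕ) : ℤ_[p])) (Matrix.IsSymm.map S.2 _)
    have h2 : ((wprim (ofSym 1 S)).map (Int.castRingHom ℂ)).eval (((p : ℂ) ^ k)⁻¹) =
        Polynomial.aeval (((p : ℂ) ^ k)⁻¹) (wprim (ofSym 1 S)) := by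
      rw [Polynomial.eval_map, Polynomial.aeval_def]; rfl
    have h3 : pair h (ofSym 1 S) = ZMod.stdAddChar (H * S.1).trace := by
      rw [h0, pair_frac, AddMonoidHom.map_trace, Matrix.map_mul, map_map_val]
    rw [h2, h3]
    rw [map_map_val] at h1
    rw [h0, h1, mul_one, ← mul_assoc, mul_comm (ZMod.stdAddChar _ : ℂ), mul_assoc, Finset.mul_sum]
    congr 1
    refine Finset.sum_congr rfl fun v _ => ?_
    simp only [hred]
    split_ifs
    · rw [← AddChar.map_add_eq_mul]; rfl
    · rw [mul_zero]
  let e : symZMod m (p ^ 1) ≃ tors p m 1 :=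
    (Equiv.subtypeEquivRight fun _ => Iff.rfl).trans (torsEquiv 1)
  have he : ∀ S, (e S : SymQuot p m) = ofSym 1 S := fun S => rfl
  rw [bprim, Polynomial.eval_finsetSum, ← Equiv.sum_comp e]
  simp only [Polynomial.eval_mul, Polynomial.eval_C, he]
  have hcard : (Fintype.card (symZMod m (p ^ 1)) : ℂ) =
      (p : ℂ) ^ (∑ i ∈ Finset.range m, (i + 1)) := by
    rw [← Nat.card_eq_fintype_card]
    have := card_isSymm_zmod (p ^ 1) m
    rw [show Nat.card (symZMod m (p ^ 1)) = _ from this, pow_one, Nat.cast_pow]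
  rw [Finset.sum_congr rfl fun S _ => hterm S, ← Finset.mul_sum, Finset.sum_comm]
  congr 1
  rw [Nat.card_eq_fintype_card, Fintype.card_subtype, ← hcard, mul_comm, ← nsmul_eq_mul,
    ← Finset.sum_const, Finset.sum_filter]
  refine Finset.sum_congr rfl fun v _ => ?_
  by_cases hv : LinearIndependent (ZMod (p ^ 1)) v
  · simp only [hv, if_true, true_and]
    rw [sum_stdAddChar_comp]
    simp only [phase_eq_zero_iff (by rwa [pow_one]) hHs]
  · simp [hv]

end

section

variable {p m k : ℕ} [hp : Fact p.Prime]

/-! ### Transport to a diagonal Gram matrix -/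

lemma hB_tupleMul {q : ℕ} [Fact q.Prime] (g : Matrix (Fin m) (Fin m) (ZMod q))
    (v : Fin m → Hyp q k) (i j : Fin m) :
    hB (tupleMul g v i) (tupleMul g v j) =
      (g * (Matrix.of fun a b => hB (v a) (v b)) * g.transpose) i j := by
  rw [tupleMul_apply, tupleMul_apply, hB_sum_right]
  simp only [Matrix.mul_apply, Matrix.transpose_apply, Matrix.of_apply]
  refine Finset.sum_congr rfl fun b _ => ?_
  rw [hB_comm, hB_sum_right, mul_comm]
  congr 1
  exact Finset.sum_congr rfl fun a _ => by rw [hB_comm]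

lemma linearIndependent_tupleMul {q : ℕ} [Fact q.Prime] {g : Matrix (Fin m) (Fin m) (ZMod q)}
    (hg : IsUnit g.det) {v : Fin m → Hyp q k} (hv : LinearIndependent (ZMod q) v) :
    LinearIndependent (ZMod q) (tupleMul g v) := by
  rw [Fintype.linearIndependent_iff] at *
  intro c hc
  have h1 : ∑ j, (Matrix.vecMul c g) j • v j = 0 := by
    rw [← hc]
    simp only [tupleMul_apply, Finset.smul_sum, smul_smul, Matrix.vecMul, dotProduct,
      Finset.sum_smul]
    exact Finset.sum_comm
  have h2 : Matrix.vecMul c g = 0 := funext (hv _ h1)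
  have h3 := congrArg (fun w => Matrix.vecMul w g⁻¹) h2
  simp only [Matrix.vecMul_vecMul, Matrix.mul_nonsing_inv g hg, Matrix.vecMul_one,
    Matrix.zero_vecMul] at h3
  exact congrFun h3

/-- A congruence moves families with Gram matrix `-2H` to families with diagonal Gram matrix. -/
lemma card_gramFrames {q : ℕ} [Fact q.Prime] {H g : Matrix (Fin m) (Fin m) (ZMod q)} {u : ℕ → ZMod q}
    (hg : IsUnit g.det) (hu : g * (-H) * g.transpose = Matrix.diagonal fun i : Fin m => u i) :
    Nat.card (GramFrames q k H) = Nat.card (Frames k u m) := by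
  have hg' : IsUnit (g⁻¹).det := Matrix.isUnit_nonsing_inv_det g hg
  have h1 : ∀ v : Fin m → Hyp q k, tupleMul g⁻¹ (tupleMul g v) = v := fun v => by
    rw [← tupleMul_mul, Matrix.nonsing_inv_mul g hg, tupleMul_one]
  have h2 : ∀ v : Fin m → Hyp q k, tupleMul g (tupleMul g⁻¹ v) = v := fun v => by
    rw [← tupleMul_mul, Matrix.mul_nonsing_inv g hg, tupleMul_one]
  have hgram : ∀ v : Fin m → Hyp q k, (∀ i j, 2 * H i j + hB (v i) (v j) = 0) ↔
      (Matrix.of fun a b => hB (v a) (v b)) = (2 : ZMod q) • (-H) := fun v => by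
    rw [← Matrix.ext_iff]
    refine forall₂_congr fun i j => ?_
    rw [Matrix.of_apply, Matrix.smul_apply, Matrix.neg_apply, smul_eq_mul]
    constructor <;> intro h <;> linear_combination h
  have hdiag : ∀ v : Fin m → Hyp q k, DiagGram u v ↔
      (Matrix.of fun a b => hB (v a) (v b)) =
        (2 : ZMod q) • Matrix.diagonal fun i : Fin m => u i := fun v => by
    rw [← Matrix.ext_iff]
    refine forall₂_congr fun i j => ?_
    rw [Matrix.of_apply, Matrix.smul_apply, Matrix.diagonal_apply, smul_eq_mul, mul_ite, mul_zero]
  have hmul : ∀ (g : Matrix (Fin m) (Fin m) (ZMod q)) (v : Fin m → Hyp q k),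
      (Matrix.of fun a b => hB (tupleMul g v a) (tupleMul g v b)) =
        g * (Matrix.of fun a b => hB (v a) (v b)) * g.transpose := fun g v => by
    ext i j
    exact hB_tupleMul g v i j
  refine Nat.card_congr
    { toFun := fun v => ⟨tupleMul g v.1, linearIndependent_tupleMul hg v.2.1, ?_⟩
      invFun := fun v => ⟨tupleMul g⁻¹ v.1, linearIndependent_tupleMul hg' v.2.1, ?_⟩
      left_inv := fun v => Subtype.ext (h1 v.1)
      right_inv := fun v => Subtype.ext (h2 v.1) }
  · rw [hdiag, hmul, (hgram v.1).mp v.2.2, Matrix.mul_smul, Matrix.smul_mul, hu]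
  · rw [hgram, hmul, (hdiag v.1).mp v.2.2, Matrix.mul_smul, Matrix.smul_mul, ← hu]
    congr 1
    rw [Matrix.mul_assoc g, ← Matrix.mul_assoc g⁻¹, Matrix.nonsing_inv_mul g hg, Matrix.one_mul,
      Matrix.mul_assoc, ← Matrix.transpose_mul, Matrix.nonsing_inv_mul g hg, Matrix.transpose_one,
      Matrix.mul_one]

/-- The primitive part is a product of factors read off from the reduction of `h` modulo `p`. -/
theorem bprim_eq_prod_kappa (hp2 : p ≠ 2) {h : Matrix (Fin m) (Fin m) ℤ_[p]} (hh : h.IsSymm)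
    {g : Matrix (Fin m) (Fin m) (ZMod (p ^ 1))} {s : ℕ} {u : ℕ → ZMod (p ^ 1)} (hg : IsUnit g.det)
    (h1 : ∀ b < s, u b ≠ 0) (h2 : ∀ b, s ≤ b → u b = 0)
    (hu : g * (-(h.map (PadicInt.toZModPow 1))) * g.transpose =
      Matrix.diagonal fun i : Fin m => u i) :
    bprim h = (∏ i ∈ Finset.range m, kappa p s (xi u) i).map (Int.castRingHom ℂ) := by
  have hpC : (p : ℂ) ≠ 0 := Nat.cast_ne_zero.mpr hp.out.ne_zero
  have hev : ∀ k : ℕ, (bprim h).eval (((p : ℂ) ^ k)⁻¹) =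
      ((∏ i ∈ Finset.range m, kappa p s (xi u) i).map (Int.castRingHom ℂ)).eval
        (((p : ℂ) ^ k)⁻¹) := fun k => by
    have h3 := card_frames (k := k) (by rwa [pow_one]) h1 h2 m
    rw [← card_gramFrames hg hu] at h3
    have h4 : ((p ^ 1 : ℕ) : ℂ) = p := by rw [pow_one]
    have h5 : kappa (p ^ 1) s (xi u) = kappa p s (xi u) := congrArg (kappa · s (xi u)) (pow_one p)
    rw [h4, h5] at h3
    rw [aeval_bprim hp2 hh, h3, Polynomial.eval_map, Polynomial.aeval_def,
      show 2 * m * k = 2 * k * m by ring, inv_mul_cancel_left₀ (pow_ne_zero _ hpC)]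
    rfl
  refine Polynomial.eq_of_infinite_eval_eq _ _ ?_
  refine Set.infinite_of_injective_forall_mem (f := fun k : ℕ => ((p : ℂ) ^ k)⁻¹) ?_ hev
  intro a b hab
  have h3 : (p : ℂ) ^ a = (p : ℂ) ^ b := inv_injective hab
  have h4 : p ^ a = p ^ b := by exact_mod_cast h3
  exact Nat.pow_right_injective hp.out.two_le h4

end

section

/-! ### Factorization of the primitive part -/

/-- `∏ (1 - q ^ (2i) X ^ 2)` over `a < i ≤ a + N`. -/
def quadProd (q a N : ℕ) : ℤ[X] :=
  ∏ b ∈ Finset.range N, (1 - (q : ℤ[X]) ^ (2 * (a + b + 1)) * Polynomial.X ^ 2)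

lemma quadProd_zero (q a : ℕ) : quadProd q a 0 = 1 := by simp [quadProd]

lemma quadProd_succ (q a N : ℕ) : quadProd q a (N + 1) =
    quadProd q a N * (1 - (q : ℤ[X]) ^ (2 * (a + N + 1)) * Polynomial.X ^ 2) := by
  rw [quadProd, Finset.prod_range_succ, quadProd]

lemma quadProd_add (q a N N' : ℕ) :
    quadProd q a (N + N') = quadProd q a N * quadProd q (a + N) N' := by
  rw [quadProd, Finset.prod_range_add, quadProd, quadProd]
  simp only [add_assoc]

lemma kappa_even {q s : ℕ} (ξ : ℕ → ℤ) {t : ℕ} (h : 2 * t < s) :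
    kappa q s ξ (2 * t) = 1 - (ξ t : ℤ[X]) * (q : ℤ[X]) ^ t * Polynomial.X := by
  rw [kappa, if_pos h, if_pos (even_two_mul t), Nat.mul_div_cancel_left t two_pos]
  simp

lemma kappa_odd {q s : ℕ} (ξ : ℕ → ℤ) {t : ℕ} (h : 2 * t + 1 < s) :
    kappa q s ξ (2 * t + 1) =
      1 + (ξ (t + 1) : ℤ[X]) * (q : ℤ[X]) ^ (t + 1) * Polynomial.X := by
  rw [kappa, if_pos h, if_neg (by simp), show (2 * t + 1 + 1) / 2 = t + 1 by omega]
  simp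

lemma kappa_isotropic_even (q : ℕ) (ξ : ℕ → ℤ) (t j : ℕ) :
    kappa q (2 * t) ξ (2 * t + j) = (1 - (ξ t : ℤ[X]) * (q : ℤ[X]) ^ (j + t) * Polynomial.X) *
      (1 + (ξ t : ℤ[X]) * (q : ℤ[X]) ^ (j + t + 1) * Polynomial.X) := by
  rw [kappa, if_neg (by omega), if_pos (even_two_mul t), Nat.mul_div_cancel_left t two_pos,
    Nat.add_sub_cancel_left]
  simp

lemma kappa_isotropic_odd (q : ℕ) (ξ : ℕ → ℤ) (t j : ℕ) :
    kappa q (2 * t + 1) ξ (2 * t + 1 + j) =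
      1 - (q : ℤ[X]) ^ (2 * (j + t + 1)) * Polynomial.X ^ 2 := by
  rw [kappa, if_neg (by omega), if_neg (by simp), Nat.add_sub_cancel_left]
  simp
  ring

/-- The factors for an odd number of vectors with nonzero values pair off. -/
lemma prod_kappa_nondegenerate {q s : ℕ} {ξ : ℕ → ℤ} (h0 : ξ 0 = 1)
    (hξ : ∀ t, 2 * t ≤ s → ξ t * ξ t = 1) (t : ℕ) (ht : 2 * t + 1 ≤ s) :
    ∏ i ∈ Finset.range (2 * t + 1), kappa q s ξ i = (1 - Polynomial.X) * quadProd q 0 t := by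
  induction t with
  | zero =>
    rw [mul_zero, zero_add, Finset.prod_range_one, quadProd_zero]
    have := kappa_even (q := q) (s := s) ξ (t := 0) (by omega)
    rw [mul_zero] at this
    rw [this, h0]
    simp
  | succ t ih =>
    have h1 : (ξ (t + 1) : ℤ[X]) * ξ (t + 1) = 1 := by exact_mod_cast hξ (t + 1) (by omega)
    rw [show 2 * (t + 1) + 1 = 2 * t + 1 + 1 + 1 by ring, Finset.prod_range_succ,
      Finset.prod_range_succ, ih (by omega), kappa_odd ξ (by omega),
      show 2 * t + 1 + 1 = 2 * (t + 1) by ring, kappa_even ξ (by omega), quadProd_succ]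
    linear_combination (-(1 - Polynomial.X) * quadProd q 0 t * (q : ℤ[X]) ^ (2 * (t + 1)) *
      Polynomial.X ^ 2) * h1

/-- The product of all factors when the rank `2t` is even: the second half of each factor combines with
the first half of the next one. -/
lemma prod_kappa_even {q t : ℕ} {ξ : ℕ → ℤ} (h0 : ξ 0 = 1)
    (hξ : ∀ t', 2 * t' ≤ 2 * t → ξ t' * ξ t' = 1) (r N : ℕ) (hN : t + r = N + 1) :
    ∏ i ∈ Finset.range (2 * t + r), kappa q (2 * t) ξ i =
      (1 - Polynomial.X) * quadProd q 0 N *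
        (1 + (ξ t : ℤ[X]) * (q : ℤ[X]) ^ (N + 1) * Polynomial.X) := by
  induction r generalizing N with
  | zero =>
    obtain rfl : t = N + 1 := by omega
    rw [show 2 * (N + 1) + 0 = 2 * N + 1 + 1 by ring, Finset.prod_range_succ,
      prod_kappa_nondegenerate h0 hξ N (by omega), kappa_odd ξ (by omega)]
  | succ r ih =>
    have h1 : (ξ t : ℤ[X]) * ξ t = 1 := by exact_mod_cast hξ t le_rfl
    rw [← add_assoc, Finset.prod_range_succ, kappa_isotropic_even]
    obtain rfl : N = t + r := by omega
    rcases Nat.eq_zero_or_pos (t + r) with h | h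
    · obtain ⟨rfl, rfl⟩ : t = 0 ∧ r = 0 := by omega
      simp [quadProd_zero, h0]
    · obtain ⟨N, hN'⟩ := Nat.exists_eq_succ_of_ne_zero h.ne'
      rw [ih N hN', hN', add_comm r t, hN', quadProd_succ]
      simp only [Nat.succ_eq_add_one]
      linear_combination (-(1 - Polynomial.X) * quadProd q 0 N * (q : ℤ[X]) ^ (2 * (N + 1)) *
        Polynomial.X ^ 2 * (1 + (ξ t : ℤ[X]) * (q : ℤ[X]) ^ (N + 1 + 1) * Polynomial.X)) * h1

lemma prod_kappa_odd {q t : ℕ} {ξ : ℕ → ℤ} (h0 : ξ 0 = 1)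
    (hξ : ∀ t', 2 * t' ≤ 2 * t + 1 → ξ t' * ξ t' = 1) (r : ℕ) :
    ∏ i ∈ Finset.range (2 * t + 1 + r), kappa q (2 * t + 1) ξ i =
      (1 - Polynomial.X) * quadProd q 0 (t + r) := by
  induction r with
  | zero => exact prod_kappa_nondegenerate h0 hξ t le_rfl
  | succ r ih =>
    rw [← add_assoc, Finset.prod_range_succ, kappa_isotropic_odd, ih, ← add_assoc, quadProd_succ]
    ring

/-! ### Norm bounds -/

section NormBounds

variable {p : ℕ} [hp : Fact p.Prime] {K : Type*} [NormedField K]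

lemma one_le_cast_pow (N : ℕ) : (1 : ℝ) ≤ (p : ℝ) ^ N :=
  one_le_pow₀ (by exact_mod_cast hp.out.one_le)

lemma norm_pow_mul_pow_le (hpK : ‖(p : K)‖ = (p : ℝ)⁻¹) {x : K} {k : ℕ} (hx : ‖x‖ = (p : ℝ) ^ k)
    {e d N : ℕ} (h : d * k ≤ e + N) : ‖(p : K) ^ e * x ^ d‖ ≤ (p : ℝ) ^ N := by
  have hp0 : (0 : ℝ) < p := by exact_mod_cast hp.out.pos
  rw [norm_mul, norm_pow, norm_pow, hpK, hx, inv_pow, inv_mul_le_iff₀ (pow_pos hp0 _), ← pow_mul,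
    ← pow_add]
  exact pow_le_pow_right₀ (by exact_mod_cast hp.out.one_le) (by rwa [mul_comm k d])

/-- As `c p ^ e x ^ d` has norm at most `p ^ (d k - e)`, any natural number `N ≥ d k - e` will do. -/
lemma norm_one_add_le [IsUltrametricDist K] (hpK : ‖(p : K)‖ = (p : ℝ)⁻¹) {x : K} {k : ℕ}
    (hx : ‖x‖ = (p : ℝ) ^ k)
    (c : ℤ) {e d N : ℕ} (h : d * k ≤ e + N) :
    ‖1 + (c : K) * ((p : K) ^ e * x ^ d)‖ ≤ (p : ℝ) ^ N := by
  refine (IsUltrametricDist.norm_add_le_max _ _).trans (max_le ?_ ?_)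
  · rw [norm_one]; exact one_le_cast_pow N
  · rw [norm_mul]
    exact (mul_le_of_le_one_left (norm_nonneg _)
      (IsUltrametricDist.norm_intCast_le_one K c)).trans (norm_pow_mul_pow_le hpK hx h)

lemma norm_aeval_quadProd_le [IsUltrametricDist K] (hpK : ‖(p : K)‖ = (p : ℝ)⁻¹) {x : K} {n t : ℕ}
    (hx : ‖x‖ = (p : ℝ) ^ (n + 1 + t)) (N : ℕ) :
    ‖Polynomial.aeval x (quadProd p n N)‖ ≤ (p : ℝ) ^ (2 * t * N) := by
  rw [quadProd, map_prod, norm_prod, pow_mul, ← Finset.card_range N, ← Finset.prod_const,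
    Finset.card_range]
  refine Finset.prod_le_prod (fun _ _ => norm_nonneg _) fun b _ => ?_
  have := norm_one_add_le hpK hx (-1) (e := 2 * (n + b + 1)) (d := 2) (N := 2 * t) (by omega)
  simpa [sub_eq_add_neg] using this

end NormBounds

/-- The primitive part, for a reduction of rank `s` and corank `r`, is divisible by the denominator of
the local factor, and the quotient satisfies the norm bound. Here `v` stands for the valuation
of the determinant, and `v / 2` is rounded down. -/
lemma exists_prod_kappa_eq {p n s r v : ℕ} [Fact p.Prime] {K : Type*} [NormedField K]
    [IsUltrametricDist K] (hpK : ‖(p : K)‖ = (p : ℝ)⁻¹) {ξ : ℕ → ℤ} {ρ : ℤ} (hn : 0 < n)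
    (hsr : s + r = 2 * n) (h0 : ξ 0 = 1) (hξ : ∀ t, 2 * t ≤ s → ξ t * ξ t = 1) (hrv : r ≤ v)
    (hρ0 : r = 0 → ρ = ξ n) (hρv : ρ ≠ 0 → Even v) :
    ∃ F : ℤ[X], (1 - (ρ : ℤ[X]) * (p : ℤ[X]) ^ n * Polynomial.X) *
        ∏ i ∈ Finset.range (2 * n), kappa p s ξ i =
      (1 - Polynomial.X) * quadProd p 0 n * F ∧
      ∀ (t : ℕ) (x : K), ‖x‖ = (p : ℝ) ^ (n + 1 + t) →
        ‖Polynomial.aeval x F‖ ≤ (p : ℝ) ^ ((2 * t + 1) * (v / 2)) := by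
  have hp1 : (1 : ℝ) ≤ p := by exact_mod_cast (Fact.out : p.Prime).one_le
  have hρ : ∀ (t : ℕ) (x : K), ‖x‖ = (p : ℝ) ^ (n + 1 + t) →
      ‖Polynomial.aeval x (1 - (ρ : ℤ[X]) * (p : ℤ[X]) ^ n * Polynomial.X)‖ ≤ (p : ℝ) ^ (t + 1) :=
    fun t x hx => by
      have := norm_one_add_le hpK hx (-ρ) (e := n) (d := 1) (N := t + 1) (by omega)
      simpa [sub_eq_add_neg, mul_assoc] using this
  rcases Nat.even_or_odd' s with ⟨t₀, rfl | rfl⟩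
  · have hprod := prod_kappa_even (q := p) h0 hξ r (t₀ + r - 1) (by omega)
    rw [hsr] at hprod
    rcases Nat.eq_zero_or_pos r with rfl | hr
    · obtain rfl : t₀ = n := by omega
      obtain ⟨n, rfl⟩ := Nat.exists_eq_succ_of_ne_zero hn.ne'
      refine ⟨1, ?_, fun t x _ => ?_⟩
      · have h1 : (ξ (n + 1) : ℤ[X]) * ξ (n + 1) = 1 := by exact_mod_cast hξ (n + 1) (by omega)
        rw [hprod, hρ0 rfl]
        simp only [Nat.succ_eq_add_one, add_zero, Nat.add_sub_cancel]
        rw [quadProd_succ]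
        linear_combination (-(1 - Polynomial.X) * quadProd p 0 n * (p : ℤ[X]) ^ (2 * (n + 1)) *
          Polynomial.X ^ 2) * h1
      · rw [map_one, norm_one]
        exact one_le_cast_pow _
    · obtain ⟨a, rfl⟩ : ∃ a, r = 2 * (a + 1) := ⟨n - t₀ - 1, by omega⟩
      obtain rfl : n = t₀ + a + 1 := by omega
      refine ⟨(1 - (ρ : ℤ[X]) * (p : ℤ[X]) ^ (t₀ + a + 1) * Polynomial.X) *
        quadProd p (t₀ + a + 1) a * (1 + (ξ t₀ : ℤ[X]) * (p : ℤ[X]) ^ (t₀ + a + 1 + a + 1) *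
          Polynomial.X), ?_, fun t x hx => ?_⟩
      · rw [hprod, show t₀ + 2 * (a + 1) - 1 = t₀ + a + 1 + a by omega, quadProd_add, zero_add]
        ring
      · have h3 := norm_one_add_le hpK hx (ξ t₀) (e := t₀ + a + 1 + a + 1) (d := 1) (N := t)
          (by omega)
        rw [map_mul, map_mul, norm_mul, norm_mul]
        calc _ ≤ (p : ℝ) ^ (t + 1) * (p : ℝ) ^ (2 * t * a) * (p : ℝ) ^ t := by
              gcongr
              · exact hρ t x hx
              · exact norm_aeval_quadProd_le hpK hx a
              · simpa [mul_assoc] using h3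
          _ = (p : ℝ) ^ (t + 1 + 2 * t * a + t) := by ring
          _ ≤ _ := by
            apply pow_le_pow_right₀ hp1
            -- `2t + 1 + 2ta ≤ (2t + 1)(a + 1)`
            have : a + 1 ≤ v / 2 := by omega
            nlinarith
  · obtain ⟨a, rfl⟩ : ∃ a, r = 2 * a + 1 := ⟨n - t₀ - 1, by omega⟩
    obtain rfl : n = t₀ + a + 1 := by omega
    have hprod := prod_kappa_odd (q := p) h0 hξ (2 * a + 1)
    rw [hsr, show t₀ + (2 * a + 1) = t₀ + a + 1 + a by ring, quadProd_add, zero_add] at hprod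
    refine ⟨(1 - (ρ : ℤ[X]) * (p : ℤ[X]) ^ (t₀ + a + 1) * Polynomial.X) *
        quadProd p (t₀ + a + 1) a, ?_, fun t x hx => ?_⟩
    · rw [hprod]; ring
    · rw [map_mul, norm_mul]
      have hquad := norm_aeval_quadProd_le hpK hx a
      by_cases hρ' : ρ = 0
      · subst hρ'
        simp only [Int.cast_zero, zero_mul, sub_zero, map_one, norm_one, one_mul]
        refine hquad.trans (pow_le_pow_right₀ hp1 ?_)
        have : a ≤ v / 2 := by omega
        nlinarith
      · calc _ ≤ (p : ℝ) ^ (t + 1) * (p : ℝ) ^ (2 * t * a) := by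
              gcongr
              exact hρ t x hx
          _ = (p : ℝ) ^ (t + 1 + 2 * t * a) := by ring
          _ ≤ _ := by
            apply pow_le_pow_right₀ hp1
            -- here `v` is even and at least `r = 2a + 1`, hence at least `2a + 2`
            obtain ⟨w, rfl⟩ := hρv hρ'
            have : a + 1 ≤ (w + w) / 2 := by omega
            nlinarith

end

section

variable {p m n : ℕ} [hp : Fact p.Prime]

/-! ### The quadratic character of the discriminant -/

lemma isUnit_iff_toZModPow_ne_zero (z : ℤ_[p]) : IsUnit z ↔ PadicInt.toZModPow 1 z ≠ 0 := by
  rw [Ne, toZModPow_eq_zero_iff, pow_one, ← PadicInt.norm_lt_one_iff_dvd, PadicInt.isUnit_iff, not_lt]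
  exact ⟨fun h => h.ge, fun h => le_antisymm z.norm_le_one h⟩

lemma quadCharAt_mul_sq {D w : ℚ_[p]} (hD : D ≠ 0) (hw : w ≠ 0) :
    quadCharAt (D * w ^ 2) = quadCharAt D := by
  have h1 : Odd (D * w ^ 2).valuation ↔ Odd D.valuation := by
    rw [Padic.valuation_mul hD (pow_ne_zero 2 hw), Padic.valuation_pow]
    simp [Int.odd_add]
  have h2 : IsSquare (D * w ^ 2) ↔ IsSquare D := by
    constructor
    · intro h
      have := h.mul ((IsSquare.sq w).inv)
      rwa [mul_inv_cancel_right₀ (pow_ne_zero 2 hw)] at this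
    · exact fun h => h.mul (IsSquare.sq w)
  rw [quadCharAt, quadCharAt]
  split_ifs <;> tauto

/-- Hensel: a unit is a square if and only if its residue is. -/
lemma isSquare_coe_iff (hp2 : p ≠ 2) {z : ℤ_[p]} (hz : IsUnit z) :
    IsSquare (z : ℚ_[p]) ↔ IsSquare (PadicInt.toZModPow 1 z) := by
  constructor
  · rintro ⟨w, hw⟩
    have hw1 : ‖w‖ ≤ 1 := by
      have h1 : ‖w‖ * ‖w‖ = 1 := by
        rw [← norm_mul, ← hw]
        exact PadicInt.isUnit_iff.mp hz
      nlinarith [norm_nonneg w]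
    obtain ⟨w, rfl⟩ : ∃ w' : ℤ_[p], (w' : ℚ_[p]) = w := ⟨⟨w, hw1⟩, rfl⟩
    refine ⟨PadicInt.toZModPow 1 w, ?_⟩
    rw [← map_mul, PadicInt.ext (hw.trans (PadicInt.coe_mul w w).symm)]
  · rintro ⟨b, hb⟩
    obtain ⟨a, rfl⟩ := toZModPow_surjective 1 b
    have ha : IsUnit a := by
      rw [isUnit_iff_toZModPow_ne_zero] at hz ⊢
      intro h
      exact hz (by rw [hb, h, mul_zero])
    have h2 : ‖(2 : ℤ_[p])‖ = 1 := by
      rw [← PadicInt.isUnit_iff, isUnit_iff_toZModPow_ne_zero]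
      rw [map_ofNat]
      exact two_ne_zero_zmod (by rwa [pow_one])
    have hH := hensels_lemma (F := (Polynomial.X ^ 2 - Polynomial.C z : ℤ_[p][X])) (a := a) (by
      simp only [map_sub, Polynomial.aeval_X_pow, Polynomial.aeval_C, Polynomial.derivative_X_pow,
        Polynomial.derivative_C, sub_zero, Algebra.algebraMap_self, RingHom.id_apply]
      have h3 : ‖a ^ 2 - z‖ < 1 := by
        rw [PadicInt.norm_lt_one_iff_dvd, ← pow_one (p : ℤ_[p]), ← toZModPow_eq_zero_iff, map_sub, hb,
          pow_two, map_mul, sub_self]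
      have h4 := PadicInt.isUnit_iff.mp ha
      simpa [h2, h4] using h3)
    obtain ⟨w, hw, -⟩ := hH
    refine ⟨w, ?_⟩
    simp only [map_sub, Polynomial.aeval_X_pow, Polynomial.aeval_C, Algebra.algebraMap_self,
      RingHom.id_apply, sub_eq_zero] at hw
    rw [← hw, pow_two, PadicInt.coe_mul]

/-- At a unit the character is the quadratic character of the residue. -/
lemma quadCharAt_coe_unit (hp2 : p ≠ 2) {z : ℤ_[p]} (hz : IsUnit z) :
    quadCharAt (z : ℚ_[p]) = quadraticChar (ZMod (p ^ 1)) (PadicInt.toZModPow 1 z) := by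
  have h0 := (isUnit_iff_toZModPow_ne_zero z).mp hz
  have hval : (z : ℚ_[p]).valuation = 0 := by
    rw [PadicInt.valuation_coe]
    have h1 : z.valuation < 1 := by
      by_contra h
      have := (PadicInt.mem_span_pow_iff_le_valuation z hz.ne_zero 1).mpr (not_lt.mp h)
      rw [Ideal.mem_span_singleton, ← toZModPow_eq_zero_iff] at this
      exact h0 this
    omega
  rw [quadCharAt, hval, if_neg (by simp), isSquare_coe_iff hp2 hz]
  split_ifs with h
  · exact ((quadraticChar_one_iff_isSquare h0).mpr h).symm
  · exact ((quadraticChar_neg_one_iff_not_isSquare).mpr h).symm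

/-- The factor `2 ^ (2n)` in `det (2h)` is a square. -/
lemma rho_eq {h : Matrix (Fin (2 * n)) (Fin (2 * n)) ℤ_[p]} (hdet : h.det ≠ 0) :
    rho h = quadCharAt ((((-1) ^ n * h.det : ℤ_[p])) : ℚ_[p]) := by
  have hd : ((((-1) ^ n * h.det : ℤ_[p])) : ℚ_[p]) ≠ 0 := by
    rw [Ne, PadicInt.coe_eq_zero]
    exact mul_ne_zero (pow_ne_zero _ (by simp)) hdet
  rw [rho, ← quadCharAt_mul_sq hd (w := 2 ^ n) (pow_ne_zero _ two_ne_zero)]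
  congr 1
  rw [← Nat.cast_smul_eq_nsmul ℤ_[p], Matrix.det_smul, Fintype.card_fin]
  push_cast
  rw [show ((2 : ℤ_[p]) : ℚ_[p]) = 2 from rfl]
  ring

lemma even_valuation_of_rho_ne_zero {h : Matrix (Fin (2 * n)) (Fin (2 * n)) ℤ_[p]}
    (hdet : h.det ≠ 0) (hρ : rho h ≠ 0) : Even h.det.valuation := by
  rw [rho_eq hdet, quadCharAt] at hρ
  have h1 : ¬ Odd ((((-1) ^ n * h.det : ℤ_[p])) : ℚ_[p]).valuation := fun h => hρ (if_pos h)
  rw [PadicInt.valuation_coe] at h1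
  have h2 : ((-1) ^ n * h.det).valuation = h.det.valuation := by
    rcases neg_one_pow_eq_or ℤ_[p] n with h | h
    · rw [h, one_mul]
    · rw [h, PadicInt.valuation_mul (by simp) hdet]
      have := PadicInt.valuation_pow (-1 : ℤ_[p]) 2
      rw [neg_one_sq, PadicInt.valuation_one] at this
      omega
  rw [h2] at h1
  exact_mod_cast Int.not_odd_iff_even.mp h1

/-! ### Elementary divisors of the reduction -/

lemma exists_lift_isUnit_det {g : Matrix (Fin m) (Fin m) (ZMod (p ^ 1))} (hg : IsUnit g.det) :
    ∃ G : Matrix (Fin m) (Fin m) ℤ_[p], IsUnit G.det ∧ G.map (PadicInt.toZModPow 1) = g := by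
  choose f hf using toZModPow_surjective (p := p) 1
  have h1 : (g.map f).map (PadicInt.toZModPow 1) = g := by
    ext i j
    exact hf _
  refine ⟨g.map f, ?_, h1⟩
  rw [isUnit_iff_toZModPow_ne_zero, RingHom.map_det, RingHom.mapMatrix_apply, h1]
  exact hg.ne_zero

/-- The corank `m - s` of the reduction of `h` is at most the valuation of `det h`: after a congruence
over `ℤ_[p]`, the last `m - s` rows are divisible by `p`. -/
lemma corank_le_valuation_det {h : Matrix (Fin m) (Fin m) ℤ_[p]} (hdet : h.det ≠ 0)
    {g : Matrix (Fin m) (Fin m) (ZMod (p ^ 1))} {s : ℕ} {u : ℕ → ZMod (p ^ 1)} (hg : IsUnit g.det)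
    (h2 : ∀ b, s ≤ b → u b = 0)
    (hu : g * (-(h.map (PadicInt.toZModPow 1))) * g.transpose =
      Matrix.diagonal fun i : Fin m => u i) : m - s ≤ h.det.valuation := by
  obtain ⟨G, hG, rfl⟩ := exists_lift_isUnit_det hg
  set h' := G * (-h) * G.transpose
  have hred : h'.map (PadicInt.toZModPow 1) = Matrix.diagonal fun i : Fin m => u i := by
    rw [← hu]
    simp only [h', Matrix.map_mul, Matrix.transpose_map]
    congr 2
    ext i j
    simp
  have hdvd : ∀ i j, ∃ c, h' i j = (if s ≤ (i : ℕ) then (p : ℤ_[p]) else 1) * c := fun i j => by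
    split_ifs with hi
    · have : PadicInt.toZModPow 1 (h' i j) = 0 := by
        have := congrFun (congrFun hred i) j
        rw [Matrix.map_apply, Matrix.diagonal_apply] at this
        rw [this, h2 _ hi, ite_self]
      rwa [toZModPow_eq_zero_iff, pow_one] at this
    · exact ⟨_, (one_mul _).symm⟩
  choose c hc using hdvd
  have h3 : h'.det = (∏ i : Fin m, if s ≤ (i : ℕ) then (p : ℤ_[p]) else 1) * (Matrix.of c).det := by
    rw [← Matrix.det_mul_column]
    congr 1
    ext i j
    exact hc i j
  have h4 : (∏ i : Fin m, if s ≤ (i : ℕ) then (p : ℤ_[p]) else 1) = p ^ (m - s) := by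
    rw [Fin.prod_univ_eq_prod_range (fun i => if s ≤ i then (p : ℤ_[p]) else 1) m,
      Finset.prod_ite, Finset.prod_const, Finset.prod_const_one, mul_one]
    congr 1
    have : Finset.filter (fun i => s ≤ i) (Finset.range m) = Finset.Ico s m := by
      ext i; simp; omega
    rw [this, Nat.card_Ico]
  have h5 : (p : ℤ_[p]) ^ (m - s) ∣ h.det := by
    have h6 : IsUnit (G.det * (-1) ^ m * G.det) := (hG.mul ((isUnit_one.neg).pow m)).mul hG
    rw [← h6.dvd_mul_left]
    have h7 : G.det * (-1) ^ m * G.det * h.det = h'.det := by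
      simp only [h', Matrix.det_mul, Matrix.det_neg, Matrix.det_transpose, Fintype.card_fin]
      ring
    rw [h7, h3, h4]
    exact dvd_mul_right _ _
  rw [← Ideal.mem_span_singleton] at h5
  exact (PadicInt.mem_span_pow_iff_le_valuation _ hdet _).mp h5

/-- For `h` with nonsingular reduction, `ρ_h(p)` is the sign of the reduction; passing from `h` to `-h`
does not matter in even dimension. -/
lemma rho_eq_xi (hp2 : p ≠ 2) {h : Matrix (Fin (2 * n)) (Fin (2 * n)) ℤ_[p]} (hdet : h.det ≠ 0)
    {g : Matrix (Fin (2 * n)) (Fin (2 * n)) (ZMod (p ^ 1))} {u : ℕ → ZMod (p ^ 1)}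
    (hg : IsUnit g.det) (h1 : ∀ b < 2 * n, u b ≠ 0)
    (hu : g * (-(h.map (PadicInt.toZModPow 1))) * g.transpose =
      Matrix.diagonal fun i : Fin (2 * n) => u i) : rho h = xi u n := by
  have hprod : ∏ b ∈ Finset.range (2 * n), u b = PadicInt.toZModPow 1 h.det * g.det ^ 2 := by
    have h2 := congrArg Matrix.det hu
    rw [Matrix.det_diagonal, Fin.prod_univ_eq_prod_range (fun i => u i), Matrix.det_mul,
      Matrix.det_mul, Matrix.det_transpose, Matrix.det_neg, Fintype.card_fin, pow_mul, neg_one_sq,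
      one_pow, one_mul] at h2
    rw [← h2, RingHom.map_det, RingHom.mapMatrix_apply]
    ring
  have hne : PadicInt.toZModPow 1 h.det ≠ 0 := fun h0 => by
    rw [h0, zero_mul] at hprod
    exact Finset.prod_ne_zero_iff.mpr (fun b hb => h1 b (Finset.mem_range.mp hb)) hprod
  have hunit : IsUnit ((-1) ^ n * h.det) :=
    ((isUnit_one.neg).pow n).mul ((isUnit_iff_toZModPow_ne_zero _).mpr hne)
  rw [rho_eq hdet, quadCharAt_coe_unit hp2 hunit, xi, hprod, ← mul_assoc, map_mul _ _ (g.det ^ 2),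
    quadraticChar_sq_one' hg.ne_zero, mul_one]
  simp

end

section

variable {p m n : ℕ} [hp : Fact p.Prime]

/-! ### Existence, uniqueness and norm bound for the local factor -/

/-- Integral polynomials as complex power series. -/
def toSeries : ℤ[X] →+* ℂ⟦X⟧ :=
  Polynomial.coeToPowerSeries.ringHom.comp (Polynomial.mapRingHom (Int.castRingHom ℂ))

lemma toSeries_apply (f : ℤ[X]) :
    toSeries f = ((f.map (Int.castRingHom ℂ) : ℂ[X]) : ℂ⟦X⟧) := rfl

lemma toSeries_X : toSeries Polynomial.X = PowerSeries.X := by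
  rw [toSeries_apply, Polynomial.map_X, Polynomial.coe_X]

lemma toSeries_injective : Function.Injective toSeries := fun f g h => by
  rw [toSeries_apply, toSeries_apply, Polynomial.coe_inj] at h
  exact Polynomial.map_injective _ (RingHom.injective_int _) h

/-- The denominator `(1 - X) ∏_{i=1}^n (1 - p ^ (2i) X ^ 2)` of the local factor. -/
def denom (p n : ℕ) : ℤ[X] := (1 - Polynomial.X) * quadProd p 0 n

lemma toSeries_denom (p n : ℕ) : toSeries (denom p n) = (1 - PowerSeries.X) *
    ∏ i ∈ Finset.Icc 1 n, (1 - PowerSeries.C ((p : ℂ) ^ (2 * i)) * PowerSeries.X ^ 2) := by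
  rw [denom, quadProd, map_mul, map_sub, map_one, toSeries_X, map_prod]
  congr 1
  rw [← Finset.Ico_add_one_right_eq_Icc, Finset.prod_Ico_eq_prod_range, Nat.add_sub_cancel]
  refine Finset.prod_congr rfl fun b _ => ?_
  simp [toSeries_X, add_comm]

lemma denom_ne_zero (p n : ℕ) : denom p n ≠ 0 := by
  intro h
  have := congrArg (Polynomial.eval 0) h
  simp [denom, quadProd, Polynomial.eval_prod] at this

lemma isLocalFactor_iff {h : Matrix (Fin (2 * n)) (Fin (2 * n)) ℤ_[p]} {f : ℤ[X]} :
    IsLocalFactor h f ↔ toSeries f * toSeries (denom p n) =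
      toSeries (1 - (rho h : ℤ[X]) * (p : ℤ[X]) ^ n * Polynomial.X) * siegelSeries h := by
  rw [IsLocalFactor, toSeries_denom, toSeries_apply]
  simp [toSeries_X]

lemma IsLocalFactor.unique {h : Matrix (Fin (2 * n)) (Fin (2 * n)) ℤ_[p]} {f g : ℤ[X]}
    (hf : IsLocalFactor h f) (hg : IsLocalFactor h g) : f = g := by
  rw [isLocalFactor_iff] at hf hg
  refine toSeries_injective (mul_right_cancel₀ ?_ (hf.trans hg.symm))
  rw [Ne, map_eq_zero_iff _ toSeries_injective]
  exact denom_ne_zero p n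

/-- The part of the local factor coming from the primitive part of the Siegel series. -/
lemma exists_bprim_factor {K : Type*} [NormedField K] [IsUltrametricDist K]
    (hpK : ‖(p : K)‖ = (p : ℝ)⁻¹) (hp2 : p ≠ 2) (hn : 0 < n)
    {h : Matrix (Fin (2 * n)) (Fin (2 * n)) ℤ_[p]} (hh : h.IsSymm) (hdet : h.det ≠ 0) :
    ∃ F : ℤ[X], toSeries F * toSeries (denom p n) =
      toSeries (1 - (rho h : ℤ[X]) * (p : ℤ[X]) ^ n * Polynomial.X) * ((bprim h : ℂ[X]) : ℂ⟦X⟧) ∧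
      ∀ (t : ℕ) (x : K), ‖x‖ = (p : ℝ) ^ (n + 1 + t) →
        ‖Polynomial.aeval x F‖ ≤ (p : ℝ) ^ ((2 * t + 1) * (h.det.valuation / 2)) := by
  have h2 := two_ne_zero_zmod (q := p ^ 1) (by rwa [pow_one])
  obtain ⟨g, s, u, hg, hs, hu1, hu2, hu⟩ :=
    exists_congruent_sorted_diagonal h2 (hh.map (PadicInt.toZModPow (p := p) 1)).neg
  have hx0 : xi u 0 = 1 := by simp [xi]
  obtain ⟨F, hF, hbound⟩ := exists_prod_kappa_eq (p := p) (n := n) (s := s) (r := 2 * n - s) hpK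
    (ξ := xi u) (ρ := rho h) (v := h.det.valuation) hn (by omega) hx0
    (fun t ht => xi_sq fun b hb => hu1 b (by omega)) (corank_le_valuation_det hdet hg hu2 hu)
    (fun hr => rho_eq_xi hp2 hdet hg (fun b hb => hu1 b (by omega)) hu)
    (even_valuation_of_rho_ne_zero hdet)
  refine ⟨F, ?_, hbound⟩
  rw [bprim_eq_prod_kappa hp2 hh hg hu1 hu2 hu, ← toSeries_apply, ← map_mul, ← map_mul, hF, denom,
    mul_comm]

lemma Relations.U_empty : (Relations.empty : Relations p m).U = 1 := by
  ext i j
  simp [Relations.U, Relations.coef, Relations.empty]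

lemma Relations.D_empty : (Relations.empty : Relations p m).D = 1 := by
  simp [Relations.D, Relations.empty]

lemma Relations.siegel_empty (h : Matrix (Fin m) (Fin m) ℤ_[p]) :
    (Relations.empty : Relations p m).siegel h = siegelSeries h := by
  have H : ∃ h' : Matrix (Fin m) (Fin m) ℤ_[p], (Relations.empty : Relations p m).U * h *
      (Relations.empty : Relations p m).U.transpose = (Relations.empty : Relations p m).D * h' *
        (Relations.empty : Relations p m).D := ⟨h, by simp [U_empty, D_empty]⟩
  rw [Relations.siegel, dif_pos H]
  have hs := H.choose_spec
  generalize H.choose = h' at hs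
  rw [U_empty, D_empty, Matrix.transpose_one, Matrix.one_mul, Matrix.one_mul, Matrix.mul_one,
    Matrix.mul_one] at hs
  rw [hs]

lemma Relations.isSymm_of_eq (o : Relations p m) {h h' : Matrix (Fin m) (Fin m) ℤ_[p]}
    (hh : h.IsSymm) (H : o.U * h * o.U.transpose = o.D * h' * o.D) : h'.IsSymm := by
  have h1 : o.D * h'.transpose * o.D = o.D * h' * o.D := by
    rw [← H, ← Matrix.transpose_inj, Matrix.transpose_mul, Matrix.transpose_mul, o.transpose_D,
      Matrix.transpose_transpose, ← Matrix.mul_assoc, ← H]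
    simp [Matrix.mul_assoc, hh.eq]
  ext i j
  have h2 := congrFun (congrFun h1 i) j
  have h3 := fun S => o.D_mul_mul_D (RingHom.id ℤ_[p]) S i j
  simp only [RingHom.coe_id, Matrix.map_id, id_eq] at h3
  rw [h3, h3] at h2
  exact mul_left_cancel₀ (pow_ne_zero _ (NeZero.ne _)) h2

lemma Relations.det_eq (o : Relations p m) {h h' : Matrix (Fin m) (Fin m) ℤ_[p]}
    (H : o.U * h * o.U.transpose = o.D * h' * o.D) :
    h.det = (p : ℤ_[p]) ^ (2 * o.rk) * h'.det := by
  have := congrArg Matrix.det H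
  simp only [Matrix.det_mul, Matrix.det_transpose, o.det_U, o.det_D] at this
  linear_combination this

/-- The local factor exists and satisfies the norm bound, with `‖x‖ = pᵏ` and `k = n + 1 + t`. By
induction on the valuation of the determinant: by `bprim_eq_sum` the local factor is the
contribution of the primitive part minus contributions of forms `h'` with
`det h = p ^ (2 rk) det h'` and `ρ_{h'} = ρ_h`. -/
theorem exists_isLocalFactor {K : Type*} [NormedField K] [IsUltrametricDist K]
    (hpK : ‖(p : K)‖ = (p : ℝ)⁻¹) (hp2 : p ≠ 2) (hn : 0 < n)
    (h : Matrix (Fin (2 * n)) (Fin (2 * n)) ℤ_[p]) (hh : h.IsSymm) (hdet : h.det ≠ 0) :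
    ∃ f : ℤ[X], IsLocalFactor h f ∧ ∀ (t : ℕ) (x : K), ‖x‖ = (p : ℝ) ^ (n + 1 + t) →
      ‖Polynomial.aeval x f‖ ≤ (p : ℝ) ^ ((2 * t + 1) * (h.det.valuation / 2)) := by
  classical
  induction hv : h.det.valuation using Nat.strong_induction_on generalizing h with
  | _ v ih =>
    subst hv
    obtain ⟨F, hF, hFb⟩ := exists_bprim_factor hpK hp2 hn hh hdet
    have hstep : ∀ o : Relations p (2 * n), o ≠ Relations.empty → ∃ f : ℤ[X],
        toSeries f * toSeries (denom p n) =
          toSeries (1 - (rho h : ℤ[X]) * (p : ℤ[X]) ^ n * Polynomial.X) *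
            (PowerSeries.C ((-1) ^ o.rk * (p : ℂ) ^ ((2 * n + 1) * o.rk)) *
              PowerSeries.X ^ (2 * o.rk) * o.siegel h) ∧
        ∀ (t : ℕ) (x : K), ‖x‖ = (p : ℝ) ^ (n + 1 + t) →
          ‖Polynomial.aeval x f‖ ≤ (p : ℝ) ^ ((2 * t + 1) * (h.det.valuation / 2)) := by
      intro o ho
      by_cases H : ∃ h', o.U * h * o.U.transpose = o.D * h' * o.D
      · have hs := H.choose_spec
        have hsiegel : o.siegel h = siegelSeries H.choose := by rw [Relations.siegel, dif_pos H]
        generalize H.choose = h' at hs hsiegel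
        have hd := o.det_eq hs
        have hd' : h'.det ≠ 0 := fun h0 => hdet (by rw [hd, h0, mul_zero])
        have hrk : o.rk ≠ 0 := fun h0 => ho (o.rk_eq_zero_iff.mp h0)
        have hval : h.det.valuation = 2 * o.rk + h'.det.valuation := by
          rw [hd, PadicInt.valuation_p_pow_mul _ _ hd']
        have hρ : rho h = rho h' := by
          have hne : ((((-1) ^ n * h'.det : ℤ_[p])) : ℚ_[p]) ≠ 0 := by
            rw [Ne, PadicInt.coe_eq_zero]
            exact mul_ne_zero (pow_ne_zero _ (by simp)) hd'
          rw [rho_eq hdet, rho_eq hd', hd, ← quadCharAt_mul_sq hne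
            (w := (p : ℚ_[p]) ^ o.rk) (pow_ne_zero _ padic_p_ne_zero)]
          congr 1
          push_cast
          ring
        obtain ⟨f, hf, hfb⟩ := ih _ (by omega) h' (o.isSymm_of_eq hh hs) hd' rfl
        refine ⟨(-1) ^ o.rk * (p : ℤ[X]) ^ ((2 * n + 1) * o.rk) * Polynomial.X ^ (2 * o.rk) * f,
          ?_, fun t x hx => ?_⟩
        · rw [isLocalFactor_iff, ← hρ] at hf
          rw [hsiegel, map_mul, mul_assoc, hf]
          simp only [map_mul, map_pow, map_neg, map_one, map_natCast, toSeries_X]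
          ring
        · -- the factor `p ^ ((2n + 1) rk) x ^ (2 rk)` has norm `p ^ ((2t + 1) rk)`
          have h1 := norm_pow_mul_pow_le hpK hx (e := (2 * n + 1) * o.rk) (d := 2 * o.rk)
            (N := (2 * t + 1) * o.rk) (by nlinarith)
          have h2 := hfb t x hx
          have h3 : Polynomial.aeval x ((-1) ^ o.rk * (p : ℤ[X]) ^ ((2 * n + 1) * o.rk) *
              Polynomial.X ^ (2 * o.rk) * f) = (-1) ^ o.rk * ((p : K) ^ ((2 * n + 1) * o.rk) *
                x ^ (2 * o.rk)) * Polynomial.aeval x f := by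
            simp [mul_assoc]
          rw [h3, norm_mul, norm_mul, norm_pow, norm_neg, norm_one, one_pow, one_mul,
            show h.det.valuation / 2 = o.rk + h'.det.valuation / 2 by omega, mul_add, pow_add]
          gcongr
      · refine ⟨0, ?_, fun t x _ => ?_⟩
        · rw [Relations.siegel, dif_neg H]; simp
        · rw [map_zero, norm_zero]
          positivity
    choose! f hf hfb using hstep
    refine ⟨F - ∑ o ∈ Finset.univ.erase Relations.empty, f o, ?_, fun t x hx => ?_⟩
    · have hb := bprim_eq_sum hp2 hh
      rw [← Finset.add_sum_erase _ _ (Finset.mem_univ Relations.empty), Relations.siegel_empty,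
        (Relations.rk_eq_zero_iff _).mpr rfl] at hb
      simp only [pow_zero, mul_zero, mul_one, map_one, one_mul] at hb
      rw [isLocalFactor_iff, map_sub, sub_mul, hF, hb, map_sum, Finset.sum_mul,
        Finset.sum_congr rfl fun o ho => hf o (Finset.ne_of_mem_erase ho), ← Finset.mul_sum]
      ring
    · rw [map_sub, map_sum, sub_eq_add_neg]
      refine (IsUltrametricDist.norm_add_le_max _ _).trans (max_le (hFb t x hx) ?_)
      rw [norm_neg]
      exact IsUltrametricDist.norm_sum_le_of_forall_le_of_nonneg (by positivity)
        fun o ho => hfb o (Finset.ne_of_mem_erase ho) t x hx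

end

section

variable {p : ℕ} [hp : Fact p.Prime]

/-! ### The valuation on the complex numbers -/

lemma norm_padicAlgCl_p : ‖(p : PadicAlgCl p)‖ = (p : ℝ)⁻¹ := by
  rw [← map_natCast (algebraMap ℚ_[p] (PadicAlgCl p)), ← Padic.norm_p (p := p)]
  exact PadicAlgCl.norm_extends p p

lemma norm_map_root_of_unity_mul (ι : ℂ ≃+* PadicAlgCl p) {c : ℂ} {r : ℕ} (hr : 0 < r)
    (hc : c ^ r = 1) (k : ℕ) : ‖ι (c * ((p : ℂ) ^ k)⁻¹)‖ = (p : ℝ) ^ k := by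
  have h1 : ‖ι c‖ = 1 := by
    rw [← pow_eq_one_iff_of_nonneg (norm_nonneg _) hr.ne', ← norm_pow, ← map_pow, hc, map_one,
      norm_one]
  rw [map_mul, norm_mul, h1, one_mul, map_inv₀, map_pow, map_natCast, norm_inv, norm_pow,
    norm_padicAlgCl_p, inv_pow, inv_inv]

lemma add_valC_nonneg (ι : ℂ ≃+* PadicAlgCl p) {z : ℂ} {a : ℝ} {N : ℕ} (ha : a = N)
    (h : ‖ι z‖ ≤ (p : ℝ) ^ N) : 0 ≤ (a : WithTop ℝ) + valC ι z := by
  rw [valC]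
  split_ifs with hz
  · rw [add_top]; exact le_top
  · have hp1 : (1 : ℝ) < p := by exact_mod_cast hp.out.one_lt
    have hpos : 0 < ‖ι z‖ := norm_pos_iff.mpr ((map_ne_zero ι).mpr hz)
    have h1 : Real.logb p ‖ι z‖ ≤ N := by
      rw [Real.logb_le_iff_le_rpow hp1 hpos, Real.rpow_natCast]
      exact h
    rw [← WithTop.coe_add, ← WithTop.coe_zero, WithTop.coe_le_coe]
    linarith

end

end SiegelSeries

end

theorem proposition4p4 (n k N p : ℕ) [Fact p.Prime] (hn : 0 < n) (hN : 0 < N) (hk : n + 1 ≤ k)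
    (χ : SiegelSeries.HeckeCharacter N) (hpN : ¬ p ∣ 2 * N)
    (h : Matrix (Fin (2 * n)) (Fin (2 * n)) ℤ_[p]) (hsymm : h.IsSymm) (hdet : h.det ≠ 0)
    (hpdet : (p : ℤ_[p]) ∣ h.det) (ι : ℂ ≃+* PadicAlgCl p) :
    (∃! f : ℤ[X], SiegelSeries.IsLocalFactor h f) ∧
    ∀ f : ℤ[X], SiegelSeries.IsLocalFactor h f →
      0 ≤ ((((k : ℝ) - n - 1 / 2) * ((h.det.valuation : ℝ) - SiegelSeries.parity h) : ℝ) :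
          WithTop ℝ) +
        SiegelSeries.valC ι
          (Polynomial.aeval (((χ.fin p (SiegelSeries.uniformizer p) : ℂˣ) : ℂ) * ((p : ℂ) ^ k)⁻¹) f) := by
  have hp2 : p ≠ 2 := by
    rintro rfl
    exact hpN (dvd_mul_right 2 N)
  obtain ⟨f, hf, hbound⟩ := SiegelSeries.exists_isLocalFactor SiegelSeries.norm_padicAlgCl_p hp2 hn
    h hsymm hdet
  refine ⟨⟨f, hf, fun g hg => hg.unique hf⟩, fun g hg => ?_⟩
  obtain rfl := hg.unique hf
  obtain ⟨r, hr, -, hχ⟩ := χ.finite_order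
  obtain ⟨t, rfl⟩ := Nat.exists_eq_add_of_le hk
  have hc : ((χ.fin p (SiegelSeries.uniformizer p) : ℂˣ) : ℂ) ^ r = 1 := by
    rw [← Units.val_pow_eq_pow_val, hχ, Units.val_one]
  -- `(k - n - 1/2)(v - e) = (t + 1/2) * 2 * ⌊v / 2⌋`, where `k = n + 1 + t` and `v = v(det h)`
  refine SiegelSeries.add_valC_nonneg ι (N := (2 * t + 1) * (h.det.valuation / 2)) ?_ ?_
  · have h1 : (h.det.valuation : ℝ) = 2 * (h.det.valuation / 2 : ℕ) + SiegelSeries.parity h := by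
      exact_mod_cast (Nat.div_add_mod _ 2).symm
    rw [h1]
    push_cast
    ring
  · have h2 := Polynomial.aeval_algHom_apply ι.toRingHom.toIntAlgHom
      (((χ.fin p (SiegelSeries.uniformizer p) : ℂˣ) : ℂ) * ((p : ℂ) ^ (n + 1 + t))⁻¹) g
    have h3 := hbound t _ (SiegelSeries.norm_map_root_of_unity_mul ι hr hc (n + 1 + t))
    exact (congrArg norm h2).symm.trans_le h3
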